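/- Let $2<q<\infty$ and $1<\rho<\infty$. Let $K(x,y)$ be a complex-valued kernel defined for $x,y\in\mathbb R$, $x\ne y$, such that for some constants $\delta>0$ and $C>0$ \[ |K(x,y)|\le \frac{C}{|x-y|}\quad (x\ne y), \] \[ |K(x,y)-K(z,y)|\le \frac{C|x-z|^{\delta}}{|x-y|^{1+\delta}},\qquad |K(y,x)-K(y,z)|\le \frac{C|x-z|^{\delta}}{|x-y|^{1+\delta}}\quad\text{whenever } |x-y|>2|x-z|. \] For $t>0$ let $K_tf(x)=\int_{|x-y|>t}K(x,y)f(y)\,dy$, and let \[ \mathcal V_q\mathcal K(f)(x)=\sup\Big(\sum_{j\ge 0}\big|K_{t_j}f(x)-K_{t_{j+1}}f(x)\big|^q\Big)^{1/q}\in[0,\infty], \] where the supremum is over all increasing sequences $(t_j)_{j\ge0}$ of positive numbers. Assume that for some $1<p_0<\infty$ there is a constant $C_0<\infty$ such that $\int_{\mathbb R}(\mathcal V_q\mathcal K(f))^{p_0}dx\le C_0\int_{\mathbb R}|f|^{p_0}dx$ for all $f\in L^{p_0}(\mathbb R)$. A weight is a locally integrable function $w$ on $\mathbb R$ that is positive almost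 everywhere; write $w(E)=\int_E w\,dx$. It belongs to $A_1$ if for some constant $C$ one has $Mw\le Cw$ almost everywhere, where $Mw(x)$ is the supremum of the averages of $w$ over the bounded intervals containing $x$; it belongs to $A_p$, $1<p<\infty$, if for some constant $C$ one has $\int_I w\,\big(\int_I w^{-1/(p-1)}\big)^{p-1}\le C|I|^p$ for all bounded intervals $I$. Then: (i) For every $w\in A_1$ there is a constant $C<\infty$ such that for all sequences $(f_k)_{k\ge1}$ in $L^1(\mathbb R,w)$ the integrals defining $K_tf_k(x)$ converge absolutely for all $k$, $x\in\mathbb R$ and $t>0$, and for all $\lambda>0$ \[ w\Big(\Big\{x:\Big(\sum_k\big(\mathcal V_q\mathcal K(f_k)(x)\big)^\rho\Big)^{1/\rho}>\lambda\Big\}\Big)\le\frac C\lambda\int_{\mathbb R}\Big(\sum_k|f_k(x)|^\rho\Big)^{1/\rho}w(x)\,dx. \] (ii) For every $1<p<\infty$ and every $w\in A_p$ there is a constant $C<\infty$ such that for all sequences $(f_k)_{k\ge1}$ in $L^p(\mathbb R,w)$ the integrals defining $K_tf_k(x)$ converge absolutely for all $k$, $x\in\mathbb R$ and $t>0$, and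 \[ \int_{\mathbb R}\Big(\sum_k\big(\mathcal V_q\mathcal K(f_k)(x)\big)^\rho\Big)^{p/\rho}w(x)\,dx\le C\int_{\mathbb R}\Big(\sum_k|f_k(x)|^\rho\Big)^{p/\rho}w(x)\,dx. \] -/

import Mathlib

open MeasureTheory Set
open scoped ENNReal NNReal

noncomputable section

namespace VqCZ

/-- The regularity conditions of a Calderón–Zygmund kernel off the diagonal: a size condition and
Hölder conditions in each of the two variables. The values `K x x` play no role. -/
def IsRegularKernel (K : ℝ → ℝ → ℂ) : Prop :=
  ∃ δ > (0 : ℝ), ∃ C > (0 : ℝ),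
    (∀ x y, x ≠ y → ‖K x y‖ ≤ C / |x - y|) ∧
    (∀ x y z, |x - y| > 2 * |x - z| →
      ‖K x y - K z y‖ ≤ C * |x - z| ^ δ / |x - y| ^ (1 + δ)) ∧
    (∀ x y z, |x - y| > 2 * |x - z| →
      ‖K y x - K y z‖ ≤ C * |x - z| ^ δ / |x - y| ^ (1 + δ))

/-- The truncated singular integral `K_t f (x) = ∫_{|x-y|>t} K(x,y) f(y) dy`. -/
def truncated (K : ℝ → ℝ → ℂ) (f : ℝ → ℂ) (x t : ℝ) : ℂ :=
  ∫ y in {y : ℝ | t < |x - y|}, K x y * f y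

/-- The `q`-variation of a family `(a_t)_{t>0}` of complex numbers, with values in `[0,∞]`. -/
def qVariation (q : ℝ) (a : ℝ → ℂ) : ℝ≥0∞ :=
  ⨆ (t : ℕ → ℝ) (_ : Monotone t) (_ : ∀ j, 0 < t j),
    (∑' j, ‖a (t j) - a (t (j + 1))‖ₑ ^ q) ^ (1 / q)

/-- The `q`-variation operator of the family of truncations, `x ↦ ‖(K_t f (x))_{t>0}‖_{v_q}`. -/
def variationOp (K : ℝ → ℝ → ℂ) (q : ℝ) (f : ℝ → ℂ) (x : ℝ) : ℝ≥0∞ :=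
  qVariation q (truncated K f x)

/-- A weight on `ℝ`: locally integrable and positive almost everywhere. -/
def IsWeight (w : ℝ → ℝ) : Prop :=
  LocallyIntegrable w volume ∧ ∀ᵐ x, 0 < w x

/-- The measure `w dx`. -/
def weightMeasure (w : ℝ → ℝ) : Measure ℝ :=
  volume.withDensity fun x => ENNReal.ofReal (w x)

/-- The Hardy–Littlewood maximal function: the supremum of the averages of `|f|` over all
bounded intervals of positive length that contain `x`. -/
def maximalFunction (f : ℝ → ℝ) (x : ℝ) : ℝ≥0∞ :=
  ⨆ (a : ℝ) (b : ℝ) (_ : a < b) (_ : x ∈ Icc a b),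
    (∫⁻ y in Icc a b, ‖f y‖ₑ) / ENNReal.ofReal (b - a)

/-- The class `A_1`: weights with `M w ≤ C w` almost everywhere. -/
def IsA1Weight (w : ℝ → ℝ) : Prop :=
  IsWeight w ∧ ∃ C : ℝ≥0, ∀ᵐ x, maximalFunction w x ≤ C * ENNReal.ofReal (w x)

/-- The class `A_p` for `1 < p < ∞`: weights with
`(∫_I w) (∫_I w^{-1/(p-1)})^{p-1} ≤ C |I|^p` for every bounded interval `I`. -/
def IsApWeight (p : ℝ) (w : ℝ → ℝ) : Prop :=
  IsWeight w ∧ ∃ C : ℝ≥0, ∀ a b : ℝ, a < b →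
    (∫⁻ x in Icc a b, ENNReal.ofReal (w x)) *
      (∫⁻ x in Icc a b, ENNReal.ofReal (w x) ^ (-(1 / (p - 1)))) ^ (p - 1)
      ≤ C * ENNReal.ofReal (b - a) ^ p

end VqCZ

end

/-! ### `ℓ^p` norms with values in `[0,∞]`. -/

noncomputable section

namespace VqCZ

/-! Write T for the `ℓ^ρ`-valued operator `vecOp` and F for the pointwise norm `vecNorm ρ f`. If the
scalar variation operator is bounded on L^ρ(W), then summing over k bounds T on L^ρ(W; ℓ^ρ) at no
cost. From this single exponent the remaining estimates follow by Calderón–Zygmund theory and sparse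
domination.

Variation. Let a function be carried by disjoint intervals I_i and let x be away from them. At time
t an interval contained in {|x-y| > t} contributes its full integral. This contribution switches off
once as t grows, so all of these together cost at most the sum of |∫_{I_i} K f|, which is small for
mean-zero pieces. The rest comes from intervals containing x-t or x+t, at most two at a time. Such
bounded overlap in time turns q-variation into an `ℓ^q` sum of masses (`qVariation_sum_le`,
`variationOp_le_of_intervals`). In the `ℓ^ρ`-valued setting Minkowski gives an `ℓ^r` sum with r =
min q ρ (`lpn_comm_le`). Since r > 1, the terms (mass / distance)^r are integrable at infinity.

Weak type (1,1), `exists_weak_type`. Decompose f over the components of {MF > l}. The good part is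
bounded by l and is handled in L^ρ. Off the tripled intervals the bad part is controlled by
`czTheta` (kernel regularity) and `czEta` (boundary intervals), both estimated by Chebyshev. The A_1
condition enters in the integrated form `A1Measure`, which Lebesgue measure satisfies too, so one
argument covers both the weighted and the unweighted case.

Sparse domination, `exists_sparse_domination`. On an interval I the points where Tf, MF or `czEta`
is large compared with the average of F over the dilate of I fill less than half of I. Cover them by
an open set U of measure less than |I|/2; the components of U ∩ I are the children. Each child has
an endpoint x outside U, where every quantity is under control, and the comparison
`variationOp_far_le` carries this control from x to all points of the child. Hence the part of f
outside the dilate of the child contributes only a multiple of the average, and the argument is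
repeated inside the child. Almost every point leaves the construction after finitely many
generations, so no limit of operators is needed.

Weights. A sparse operator is bounded on L^p(w) for w in A_p: the A_p condition splits each term of
its bilinear form into an average for w dx and one for the dual weight, and Hölder with the Carleson
embedding `sum_average_rpow_le` for both measures sums them.

Assembly. The argument is run first with `ℓ^{p₀}`-valued functions, where the hypothesis is the
required strong bound, and its conclusion for a single function gives the bound on L^ρ. It is run
again with `ℓ^ρ`, which gives (ii). For (i), A_1 ⊆ A_ρ supplies the weighted L^ρ bound that the
weighted weak type argument needs. -/

/-- The `ℓ^p` norm of a family of extended nonnegative numbers. -/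
def lpn {ι : Type*} (p : ℝ) (a : ι → ℝ≥0∞) : ℝ≥0∞ := (∑' i, a i ^ p) ^ (1 / p)

section Lpn

variable {ι κ : Type*} {p : ℝ}

lemma lpn_rpow (hp : 0 < p) (a : ι → ℝ≥0∞) : lpn p a ^ p = ∑' i, a i ^ p := by
  rw [lpn, ← ENNReal.rpow_mul, one_div_mul_cancel hp.ne', ENNReal.rpow_one]

lemma lpn_le_iff (hp : 0 < p) {a : ι → ℝ≥0∞} {M : ℝ≥0∞} :
    lpn p a ≤ M ↔ ∑' i, a i ^ p ≤ M ^ p := by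
  rw [← lpn_rpow hp, ENNReal.rpow_le_rpow_iff hp]

lemma lpn_mono (hp : 0 < p) {a b : ι → ℝ≥0∞} (h : ∀ i, a i ≤ b i) : lpn p a ≤ lpn p b := by
  unfold lpn
  gcongr with i
  exact h i

lemma le_lpn (hp : 0 < p) (a : ι → ℝ≥0∞) (i : ι) : a i ≤ lpn p a := by
  rw [← ENNReal.rpow_le_rpow_iff hp, lpn_rpow hp]
  exact ENNReal.le_tsum i

lemma lpn_const_mul (hp : 0 < p) (c : ℝ≥0∞) (a : ι → ℝ≥0∞) :
    lpn p (fun i => c * a i) = c * lpn p a := by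
  unfold lpn
  simp_rw [ENNReal.mul_rpow_of_nonneg _ _ hp.le]
  rw [ENNReal.tsum_mul_left, ENNReal.mul_rpow_of_nonneg _ _ (by positivity), ← ENNReal.rpow_mul,
    mul_one_div_cancel hp.ne', ENNReal.rpow_one]

lemma lpn_zero (hp : 0 < p) : lpn p (fun _ : ι => (0 : ℝ≥0∞)) = 0 := by
  simp [lpn, hp]

lemma tsum_rpow_le (hp : 1 ≤ p) (a : ι → ℝ≥0∞) : ∑' i, a i ^ p ≤ (∑' i, a i) ^ p := by
  have h : ∀ x : ℝ≥0∞, x ^ p = x * x ^ (p - 1) := fun x => by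
    conv_lhs => rw [show p = 1 + (p - 1) by ring, ENNReal.rpow_add_of_nonneg _ _ zero_le_one
      (by linarith), ENNReal.rpow_one]
  rw [h (∑' i, a i), ← ENNReal.tsum_mul_right]
  refine ENNReal.tsum_le_tsum fun i => ?_
  rw [h]
  have := ENNReal.le_tsum (f := a) i
  have hp' : 0 ≤ p - 1 := by linarith
  gcongr

lemma lpn_antitone {r q : ℝ} (hr : 0 < r) (hrq : r ≤ q) (a : ι → ℝ≥0∞) :
    lpn q a ≤ lpn r a := by
  rw [lpn_le_iff (by linarith)]
  have h := tsum_rpow_le (p := q / r) ((one_le_div hr).2 hrq) (fun i => a i ^ r)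
  simp_rw [← ENNReal.rpow_mul, mul_div_cancel₀ q hr.ne'] at h
  rwa [lpn, ← ENNReal.rpow_mul, one_div_mul_eq_div]

lemma measurable_lpn {α : Type*} [MeasurableSpace α] [Countable ι]
    {f : ι → α → ℝ≥0∞} (hf : ∀ i, Measurable (f i)) :
    Measurable (fun x => lpn p (fun i => f i x)) := by
  unfold lpn
  exact (Measurable.tsum fun i => (hf i).pow_const _).pow_const _

/-- **Minkowski's integral inequality** for a sum outside and an integral inside. -/
lemma lpn_lintegral_le {α : Type*} [MeasurableSpace α] {μ : Measure α} (hp : 1 ≤ p)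
    {f : ι → α → ℝ≥0∞} (hf : ∀ i, AEMeasurable (f i) μ) :
    lpn p (fun i => ∫⁻ x, f i x ∂μ) ≤ ∫⁻ x, lpn p (fun i => f i x) ∂μ := by
  have hp0 : 0 < p := by linarith
  set M := ∫⁻ x, lpn p (fun i => f i x) ∂μ with hM
  rcases eq_or_ne M ∞ with hMt | hMt
  · rw [hMt]; exact le_top
  rw [lpn_le_iff hp0, ENNReal.tsum_eq_iSup_sum]
  refine iSup_le fun s => ?_
  have hA : ∀ i, ∫⁻ x, f i x ∂μ ≤ M := fun i =>
    lintegral_mono fun x => le_lpn hp0 (fun i => f i x) i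
  set A := fun i => ∫⁻ x, f i x ∂μ with hAdef
  have hAt : ∀ i, A i ≠ ∞ := fun i => ne_top_of_le_ne_top hMt (hA i)
  have hfin : ∀ x, (∑ i ∈ s, f i x ^ p) ^ (1 / p) ≤ lpn p (fun i => f i x) := fun x => by
    unfold lpn
    gcongr
    exact ENNReal.sum_le_tsum s
  rcases eq_or_lt_of_le hp with h1 | h1
  · subst h1
    simp only [ENNReal.rpow_one]
    rw [← lintegral_finsetSum' s fun i _ => hf i]
    refine lintegral_mono fun x => ?_
    simpa using hfin x
  set S := ∑ i ∈ s, A i ^ p with hS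
  have hSt : S ≠ ∞ := by
    rw [hS]
    exact (ENNReal.sum_lt_top.2 fun i _ => ENNReal.rpow_lt_top_of_nonneg hp0.le (hAt i)).ne
  rcases eq_or_ne S 0 with hS0 | hS0
  · rw [hS0]; exact zero_le
  have hpq : p.HolderConjugate (p / (p - 1)) := Real.HolderConjugate.conjExponent h1
  -- Hölder against the weights `A i ^ (p - 1)`. The finite index set makes `S` finite, so the
  -- conjugate power of `S` can be cancelled afterwards.
  have key : S ≤ S ^ (1 / (p / (p - 1))) * M := by
    calc S = ∑ i ∈ s, ∫⁻ x, A i ^ (p - 1) * f i x ∂μ := by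
          refine Finset.sum_congr rfl fun i _ => ?_
          rw [lintegral_const_mul' _ _ (ENNReal.rpow_ne_top_of_nonneg (by linarith) (hAt i))]
          change A i ^ p = A i ^ (p - 1) * A i
          conv_lhs => rw [show p = (p - 1) + 1 by ring, ENNReal.rpow_add_of_nonneg _ _ (by linarith)
            zero_le_one, ENNReal.rpow_one]
      _ = ∫⁻ x, ∑ i ∈ s, A i ^ (p - 1) * f i x ∂μ := by
          rw [lintegral_finsetSum' s fun i _ => (hf i).const_mul _]
      _ ≤ ∫⁻ x, S ^ (1 / (p / (p - 1))) * lpn p (fun i => f i x) ∂μ := by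
          refine lintegral_mono fun x => ?_
          refine (ENNReal.inner_le_Lp_mul_Lq s _ _ hpq.symm).trans ?_
          simp_rw [← ENNReal.rpow_mul, mul_div_cancel₀ p (sub_pos.2 h1).ne']
          gcongr
          exact hfin x
      _ = _ := by
          rw [lintegral_const_mul' _ _ (ENNReal.rpow_ne_top_of_nonneg (by
            have := hpq.symm.pos; positivity) hSt)]
  have h2 : S = S ^ (1 / (p / (p - 1))) * S ^ (1 / p) := by
    rw [← ENNReal.rpow_add _ _ hS0 hSt]
    have := hpq.inv_add_inv_eq_one
    rw [one_div, one_div, add_comm, this, ENNReal.rpow_one]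
  have hq0 : 0 ≤ 1 / (p / (p - 1)) := by have := hpq.symm.pos; positivity
  have h3 : S ^ (1 / p) ≤ M := by
    rw [h2] at key
    have key' : S ^ (1 / (p / (p - 1))) * S ^ (1 / p) ≤ S ^ (1 / (p / (p - 1))) * M := by
      rw [← h2] at key ⊢; exact key
    refine (ENNReal.mul_le_mul_iff_right ?_ ?_).1 key'
    · exact (ENNReal.rpow_pos (pos_iff_ne_zero.2 hS0) hSt).ne'
    · exact ENNReal.rpow_ne_top_of_nonneg hq0 hSt
  calc S = (S ^ (1 / p)) ^ p := by
        rw [← ENNReal.rpow_mul, one_div_mul_cancel hp0.ne', ENNReal.rpow_one]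
    _ ≤ M ^ p := by gcongr

lemma lpn_tsum_le (hp : 1 ≤ p) (a : ι → κ → ℝ≥0∞) :
    lpn p (fun i => ∑' j, a i j) ≤ ∑' j, lpn p (fun i => a i j) := by
  let _ : MeasurableSpace κ := ⊤
  have := lpn_lintegral_le (μ := (Measure.count : Measure κ)) hp (f := a)
    (fun i => measurable_from_top.aemeasurable)
  simpa only [lintegral_count] using this

lemma lpn_add_le (hp : 1 ≤ p) (a b : ι → ℝ≥0∞) :
    lpn p (fun i => a i + b i) ≤ lpn p a + lpn p b := by
  have := lpn_tsum_le hp (fun i (j : Bool) => if j then a i else b i)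
  simpa [tsum_fintype] using this

/-- Replacing `ℓ^q` by the larger norm `ℓ^r`, r = min q ρ ≤ ρ, makes Minkowski in `ℓ^(ρ/r)`
available for the r-th powers. The exponent `min q ρ` of all later boundary sums originates here. -/
lemma lpn_comm_le {ρ q : ℝ} (hρ : 1 ≤ ρ) (hq : 1 ≤ q) (A : ι → κ → ℝ≥0∞) :
    lpn ρ (fun k => lpn q (A k)) ≤ lpn (min q ρ) (fun m => lpn ρ (fun k => A k m)) := by
  set r := min q ρ
  have hr : 0 < r := lt_min (by linarith) (by linarith)
  have hrρ : r ≤ ρ := min_le_right _ _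
  have h0 : 0 < ρ := by linarith
  have key := lpn_tsum_le (p := ρ / r) ((one_le_div hr).2 hrρ) (fun k m => A k m ^ r)
  have e1 : ∀ b : ι → ℝ≥0∞, lpn (ρ / r) (fun k => b k ^ r) = lpn ρ b ^ r := fun b => by
    unfold lpn
    simp_rw [← ENNReal.rpow_mul, mul_div_cancel₀ ρ hr.ne']
    congr 1
    field_simp
  simp_rw [e1] at key
  calc _ ≤ lpn ρ (fun k => lpn r (A k)) :=
        lpn_mono h0 fun k => lpn_antitone hr (min_le_left _ _) _
    _ ≤ _ := by
        rw [← ENNReal.rpow_le_rpow_iff hr, ← e1, lpn_rpow hr]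
        simp_rw [lpn_rpow hr]
        exact key

/-- If every row of a matrix has at most `N` nonzero entries then the `ℓ^r` norm of the row sums
is controlled by the `ℓ^r` norm of the column sums. -/
lemma tsum_tsum_rpow_le {r : ℝ} (hr : 1 ≤ r) (N : ℕ) (x : κ → ι → ℝ≥0∞)
    (hx : ∀ j, ∃ s : Finset ι, s.card ≤ N ∧ ∀ i ∉ s, x j i = 0) :
    ∑' j, (∑' i, x j i) ^ r ≤ N ^ r * ∑' i, (∑' j, x j i) ^ r := by
  have hr0 : 0 < r := by linarith
  -- A row sum has at most `N` nonzero terms, each at most the `ℓ^r` norm of the row. After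
  -- exchanging the sums, superadditivity of the r-th power closes the columns.
  have h1 : ∀ j, (∑' i, x j i) ^ r ≤ N ^ r * ∑' i, x j i ^ r := fun j => by
    obtain ⟨s, hs, h0⟩ := hx j
    rw [tsum_eq_sum h0]
    have h2 : ∑ i ∈ s, x j i ≤ N * lpn r (x j) := by
      calc ∑ i ∈ s, x j i ≤ ∑ _i ∈ s, lpn r (x j) := Finset.sum_le_sum fun i _ => le_lpn hr0 _ i
        _ = s.card * lpn r (x j) := by simp
        _ ≤ _ := by gcongr
    calc _ ≤ (N * lpn r (x j)) ^ r := by gcongr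
      _ = _ := by rw [ENNReal.mul_rpow_of_nonneg _ _ hr0.le, lpn_rpow hr0]
  calc _ ≤ ∑' j, N ^ r * ∑' i, x j i ^ r := ENNReal.tsum_le_tsum h1
    _ = N ^ r * ∑' i, ∑' j, x j i ^ r := by rw [ENNReal.tsum_mul_left, ENNReal.tsum_comm]
    _ ≤ _ := by
        gcongr with i
        exact tsum_rpow_le hr _

/-- Fatou's lemma for counting measure; powers commute with `liminf` because they are order
isomorphisms of `[0,∞]`. -/
lemma lpn_liminf_le (hp : 0 < p) (a : ℕ → ι → ℝ≥0∞) [Countable ι] :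
    lpn p (fun k => Filter.liminf (fun n => a n k) Filter.atTop) ≤
      Filter.liminf (fun n => lpn p (a n)) Filter.atTop := by
  have hmon : ∀ c : ℝ, 0 < c → ∀ u : ℕ → ℝ≥0∞, (Filter.liminf u Filter.atTop) ^ c =
      Filter.liminf (fun n => u n ^ c) Filter.atTop := fun c hc u =>
    (ENNReal.orderIsoRpow c hc).liminf_apply
  unfold lpn
  rw [← hmon _ (by positivity)]
  simp_rw [hmon p hp]
  gcongr
  let _ : MeasurableSpace ι := ⊤
  have := lintegral_liminf_le (μ := (Measure.count : Measure ι)) (u := Filter.atTop) (f := fun n k => a n k ^ p)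
    (fun n => measurable_from_top)
  simpa only [lintegral_count] using this

end Lpn

end VqCZ

end

/-! ### The q-variation of a one-parameter family. -/

noncomputable section

namespace VqCZ

section Variation

variable {q : ℝ}

lemma qVariation_le {a : ℝ → ℂ} {M : ℝ≥0∞}
    (h : ∀ t : ℕ → ℝ, Monotone t → (∀ j, 0 < t j) →
      lpn q (fun j => ‖a (t j) - a (t (j + 1))‖ₑ) ≤ M) : qVariation q a ≤ M :=
  iSup_le fun t => iSup_le fun ht => iSup_le fun ht0 => h t ht ht0

lemma le_qVariation (a : ℝ → ℂ) {t : ℕ → ℝ} (ht : Monotone t) (ht0 : ∀ j, 0 < t j) :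
    lpn q (fun j => ‖a (t j) - a (t (j + 1))‖ₑ) ≤ qVariation q a :=
  le_iSup_of_le t (le_iSup_of_le ht (le_iSup_of_le ht0 le_rfl))

lemma qVariation_congr {a b : ℝ → ℂ} (h : ∀ t, 0 < t → a t = b t) :
    qVariation q a = qVariation q b := by
  unfold qVariation
  refine iSup_congr fun t => iSup_congr fun _ => iSup_congr fun ht => ?_
  simp_rw [fun j => h (t j) (ht j)]

lemma qVariation_le_one (hq : 1 ≤ q) (a : ℝ → ℂ) : qVariation q a ≤ qVariation 1 a :=
  qVariation_le fun _ ht ht0 => (lpn_antitone one_pos hq _).trans (le_qVariation a ht ht0)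

lemma qVariation_one_le {a : ℝ → ℂ} {M : ℝ≥0∞}
    (h : ∀ t : ℕ → ℝ, Monotone t → (∀ j, 0 < t j) →
      ∑' j, ‖a (t j) - a (t (j + 1))‖ₑ ≤ M) : qVariation 1 a ≤ M :=
  qVariation_le fun t ht ht0 => by simpa [lpn] using h t ht ht0

lemma tsum_le_qVariation_one (a : ℝ → ℂ) {t : ℕ → ℝ} (ht : Monotone t) (ht0 : ∀ j, 0 < t j) :
    ∑' j, ‖a (t j) - a (t (j + 1))‖ₑ ≤ qVariation 1 a := by
  simpa [lpn] using le_qVariation (q := 1) a ht ht0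

lemma qVariation_zero (hq : 0 < q) : qVariation q (fun _ => 0) = 0 := by
  refine le_antisymm (qVariation_le fun t _ _ => ?_) zero_le
  simp [lpn, hq]

lemma qVariation_add_le (hq : 1 ≤ q) (a b : ℝ → ℂ) :
    qVariation q (fun t => a t + b t) ≤ qVariation q a + qVariation q b := by
  refine qVariation_le fun t ht ht0 => ?_
  calc _ ≤ lpn q (fun j => ‖a (t j) - a (t (j + 1))‖ₑ + ‖b (t j) - b (t (j + 1))‖ₑ) := by
        refine lpn_mono (by linarith) fun j => ?_
        rw [add_sub_add_comm]
        exact enorm_add_le _ _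
    _ ≤ _ := (lpn_add_le hq _ _).trans
        (add_le_add (le_qVariation a ht ht0) (le_qVariation b ht ht0))

lemma qVariation_neg (a : ℝ → ℂ) : qVariation q (fun t => -a t) = qVariation q a := by
  unfold qVariation
  simp_rw [neg_sub_neg, enorm_sub_rev]

lemma qVariation_sub_le (hq : 1 ≤ q) (a b : ℝ → ℂ) :
    qVariation q (fun t => a t - b t) ≤ qVariation q a + qVariation q b := by
  simp_rw [sub_eq_add_neg]
  rw [← qVariation_neg b]
  exact qVariation_add_le hq _ _

lemma qVariation_one_hasSum_le {ι : Type*} {e : ι → ℝ → ℂ} {a : ℝ → ℂ}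
    (h : ∀ t, 0 < t → HasSum (fun i => e i t) (a t)) :
    qVariation 1 a ≤ ∑' i, qVariation 1 (e i) := by
  refine qVariation_one_le fun t ht ht0 => ?_
  calc _ ≤ ∑' j, ∑' i, ‖e i (t j) - e i (t (j + 1))‖ₑ := by
        refine ENNReal.tsum_le_tsum fun j => ?_
        rw [← ((h _ (ht0 j)).sub (h _ (ht0 (j + 1)))).tsum_eq]
        exact enorm_tsum_le_tsum_enorm
    _ = ∑' i, ∑' j, ‖e i (t j) - e i (t (j + 1))‖ₑ := ENNReal.tsum_comm
    _ ≤ _ := ENNReal.tsum_le_tsum fun i => tsum_le_qVariation_one _ ht ht0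

/-- The variation of a sum of families of which at most `N` are active at each time. -/
lemma qVariation_sum_le (hq : 1 ≤ q) {ι : Type*} (N : ℕ) {e : ι → ℝ → ℂ} {a : ℝ → ℂ}
    (h : ∀ t, 0 < t → ∃ s : Finset ι, s.card ≤ N ∧ (∀ i ∉ s, e i t = 0) ∧
      a t = ∑ i ∈ s, e i t) :
    qVariation q a ≤ (2 * N : ℕ) * lpn q (fun i => qVariation 1 (e i)) := by
  classical
  have hq0 : 0 < q := by linarith
  refine qVariation_le fun t ht ht0 => ?_
  rw [lpn_le_iff hq0, ENNReal.mul_rpow_of_nonneg _ _ hq0.le, lpn_rpow hq0]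
  choose! s hs hs0 hsa using h
  calc _ ≤ ∑' j, (∑' i, ‖e i (t j) - e i (t (j + 1))‖ₑ) ^ q := by
        gcongr with j
        have h1 : ∀ t' ∈ ({t j, t (j + 1)} : Set ℝ),
            a t' = ∑ i ∈ s (t j) ∪ s (t (j + 1)), e i t' := by
          intro t' ht'
          have ht'0 : 0 < t' := by
            rcases ht' with rfl | rfl
            exacts [ht0 _, ht0 _]
          rw [hsa t' ht'0]
          refine Finset.sum_subset ?_ fun i _ hi => hs0 t' ht'0 i hi
          rcases ht' with rfl | rfl
          exacts [Finset.subset_union_left, Finset.subset_union_right]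
        rw [h1 (t j) (by simp), h1 (t (j + 1)) (by simp), ← Finset.sum_sub_distrib]
        exact (enorm_sum_le _ _).trans (ENNReal.sum_le_tsum _)
    _ ≤ (2 * N : ℕ) ^ q * ∑' i, (∑' j, ‖e i (t j) - e i (t (j + 1))‖ₑ) ^ q := by
        -- An increment involves two times, each with at most `N` active members; hence `2 * N`.
        refine tsum_tsum_rpow_le hq (2 * N) _ fun j => ⟨s (t j) ∪ s (t (j + 1)), ?_, ?_⟩
        · have := Finset.card_union_le (s (t j)) (s (t (j + 1)))
          have := hs _ (ht0 j)
          have := hs _ (ht0 (j + 1))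
          omega
        · intro i hi
          rw [Finset.mem_union, not_or] at hi
          simp [hs0 _ (ht0 j) i hi.1, hs0 _ (ht0 (j + 1)) i hi.2]
    _ ≤ _ := by
        gcongr with i
        exact tsum_le_qVariation_one _ ht ht0

/-- The domains shrink with t, so successive increments are integrals over disjoint shells and their
total is at most the full mass. -/
lemma qVariation_one_setIntegral_le {α : Type*} [MeasurableSpace α] {μ : Measure α}
    {φ : α → ℝ} (hφ : Measurable φ) {G : α → ℂ}
    (hG : ∀ t, 0 < t → IntegrableOn G {y | t < φ y} μ) :
    qVariation 1 (fun t => ∫ y in {y | t < φ y}, G y ∂μ) ≤ ∫⁻ y in {y | 0 < φ y}, ‖G y‖ₑ ∂μ := by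
  refine qVariation_one_le fun t ht ht0 => ?_
  have hm : ∀ s, MeasurableSet {y | s < φ y} := fun s => measurableSet_lt measurable_const hφ
  have hm2 : ∀ j, MeasurableSet (φ ⁻¹' Ioc (t j) (t (j + 1))) := fun j => hφ measurableSet_Ioc
  have h1 : ∀ j, (∫ y in {y | t j < φ y}, G y ∂μ) - ∫ y in {y | t (j + 1) < φ y}, G y ∂μ =
      ∫ y in φ ⁻¹' Ioc (t j) (t (j + 1)), G y ∂μ := fun j => by
    have hsub : {y | t (j + 1) < φ y} ⊆ {y | t j < φ y} := fun y hy =>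
      (ht (Nat.le_succ j)).trans_lt hy
    rw [← setIntegral_sdiff (hm _) (hG _ (ht0 j)) hsub]
    congr 2
    ext y
    simp [not_lt]
  simp_rw [h1]
  calc _ ≤ ∑' j, ∫⁻ y in φ ⁻¹' Ioc (t j) (t (j + 1)), ‖G y‖ₑ ∂μ :=
        ENNReal.tsum_le_tsum fun j => enorm_integral_le_lintegral_enorm _
    _ = ∫⁻ y in ⋃ j, φ ⁻¹' Ioc (t j) (t (j + 1)), ‖G y‖ₑ ∂μ := by
        rw [lintegral_iUnion hm2]
        intro i j hij
        exact (ht.pairwise_disjoint_on_Ioc_succ hij).preimage φ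
    _ ≤ _ := by
        refine lintegral_mono_set ?_
        refine iUnion_subset fun j y hy => (ht0 j).trans hy.1

/-- `P` holds on an initial segment of times, so there is at most one jump along an increasing
sequence. -/
lemma qVariation_one_ite_le {P : ℝ → Prop} [DecidablePred P]
    (hP : ∀ s t, s ≤ t → P t → P s) (m : ℂ) :
    qVariation 1 (fun t => if P t then m else 0) ≤ ‖m‖ₑ := by
  refine qVariation_one_le fun t ht _ => ?_
  by_cases h : ∃ j, P (t j) ∧ ¬ P (t (j + 1))
  · obtain ⟨j, hj, hj'⟩ := h
    rw [tsum_eq_single j]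
    · simp [hj, hj']
    intro i hi
    rcases lt_or_gt_of_ne hi with h | h
    · have h1 := hP _ _ (ht h) hj
      have h2 := hP _ _ (ht h.le) hj
      simp_all
    · have h1 : ¬ P (t i) := fun hh => hj' (hP _ _ (ht h) hh)
      have h2 : ¬ P (t (i + 1)) := fun hh => h1 (hP _ _ (ht (Nat.le_succ i)) hh)
      simp_all
  · push Not at h
    rw [ENNReal.tsum_eq_zero.2]
    · exact zero_le
    intro j
    by_cases h1 : P (t j)
    · simp [h1, h j h1]
    · have h2 : ¬ P (t (j + 1)) := fun hh => h1 (hP _ _ (ht (Nat.le_succ j)) hh)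
      simp [h1, h2]

end Variation

end VqCZ

end

/-! ### Truncated integrals: convergence, measurability, semicontinuity. -/

noncomputable section

namespace VqCZ

/-- The conditions of `IsRegularKernel` with explicit constants. -/
def KernelBounds (K : ℝ → ℝ → ℂ) (δ C : ℝ) : Prop :=
  0 < δ ∧ 0 < C ∧
    (∀ x y, x ≠ y → ‖K x y‖ ≤ C / |x - y|) ∧
    (∀ x y z, |x - y| > 2 * |x - z| →
      ‖K x y - K z y‖ ≤ C * |x - z| ^ δ / |x - y| ^ (1 + δ)) ∧
    (∀ x y z, |x - y| > 2 * |x - z| →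
      ‖K y x - K y z‖ ≤ C * |x - z| ^ δ / |x - y| ^ (1 + δ))

/-- Measurable functions for which all truncated singular integrals converge absolutely. -/
def Admissible (f : ℝ → ℂ) : Prop :=
  Measurable f ∧ ∫⁻ y, ‖f y‖ₑ * ENNReal.ofReal ((1 + |y|)⁻¹) ≠ ∞

section Kernel

open Filter Topology

variable {K : ℝ → ℝ → ℂ} {δ C q : ℝ} {f g : ℝ → ℂ}

lemma tendsto_zero_of_hoelder (hδ : 0 < δ) (x y : ℝ) :
    Tendsto (fun z => C * |x - z| ^ δ / |x - y| ^ (1 + δ)) (𝓝 x) (𝓝 0) := by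
  have h : Tendsto (fun z => |x - z|) (𝓝 x) (𝓝 0) := by
    have : ContinuousAt (fun z => |x - z|) x := by fun_prop
    simpa [ContinuousAt] using this
  have h2 := h.rpow_const (p := δ) (Or.inr hδ.le)
  rw [Real.zero_rpow hδ.ne'] at h2
  simpa using (h2.const_mul C).div_const (|x - y| ^ (1 + δ))

lemma eventually_two_mul_lt {x y : ℝ} (hxy : x ≠ y) : ∀ᶠ z in 𝓝 x, |x - y| > 2 * |x - z| := by
  have h0 : 0 < |x - y| := abs_pos.2 (sub_ne_zero.2 hxy)
  have : ContinuousAt (fun z => 2 * |x - z|) x := by fun_prop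
  exact this.eventually_lt continuousAt_const (by simpa using h0)

lemma KernelBounds.continuousAt_left (hK : KernelBounds K δ C) {x y : ℝ} (hxy : x ≠ y) :
    ContinuousAt (fun z => K z y) x := by
  obtain ⟨hδ, -, -, h, -⟩ := hK
  rw [ContinuousAt, tendsto_iff_norm_sub_tendsto_zero]
  refine squeeze_zero' (Eventually.of_forall fun _ => norm_nonneg _) ?_
    (tendsto_zero_of_hoelder (C := C) hδ x y)
  filter_upwards [eventually_two_mul_lt hxy] with z hz
  rw [norm_sub_rev]
  exact h x y z hz

lemma KernelBounds.continuousAt_right (hK : KernelBounds K δ C) {x y : ℝ} (hxy : x ≠ y) :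
    ContinuousAt (fun z => K y z) x := by
  obtain ⟨hδ, -, -, -, h⟩ := hK
  rw [ContinuousAt, tendsto_iff_norm_sub_tendsto_zero]
  refine squeeze_zero' (Eventually.of_forall fun _ => norm_nonneg _) ?_
    (tendsto_zero_of_hoelder (C := C) hδ x y)
  filter_upwards [eventually_two_mul_lt hxy] with z hz
  rw [norm_sub_rev]
  exact h x y z hz

/-- Measurability of K is not a hypothesis: the Hölder condition makes K(x,·) continuous off the
diagonal, and the diagonal value is replaced by 0. -/
lemma KernelBounds.measurable_off (hK : KernelBounds K δ C) (x : ℝ) :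
    Measurable (({x}ᶜ : Set ℝ).indicator (K x)) := by
  classical
  rw [← piecewise_eq_indicator]
  refine (ContinuousOn.measurable_piecewise (s := ({x}ᶜ : Set ℝ)) (f := K x) (g := 0) ?_
    continuousOn_const (measurableSet_singleton x).compl)
  exact fun y hy => (hK.continuousAt_right hy).continuousWithinAt

lemma measurableSet_far (x t : ℝ) : MeasurableSet {y : ℝ | t < |x - y|} :=
  measurableSet_lt measurable_const (by fun_prop)

lemma KernelBounds.enorm_le (hK : KernelBounds K δ C) {x y : ℝ} (hxy : x ≠ y) :
    ‖K x y‖ₑ ≤ ENNReal.ofReal (C / |x - y|) := by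
  rw [← ofReal_norm]
  exact ENNReal.ofReal_le_ofReal (hK.2.2.1 x y hxy)

lemma KernelBounds.aestronglyMeasurable (hK : KernelBounds K δ C) (x : ℝ) :
    AEStronglyMeasurable (K x) volume := by
  refine (hK.measurable_off x).aestronglyMeasurable.congr ?_
  have : ∀ᵐ y : ℝ, y ≠ x := by simp [ae_iff]
  filter_upwards [this] with y hy
  exact indicator_of_mem hy _

/-- The constant depends on `x₀` and not on `x`, which gives a common majorant for all points near
`x₀` and hence dominated convergence in x. -/
lemma inv_abs_sub_le {x x₀ y t : ℝ} (ht : 0 < t) (hx : |x - x₀| ≤ t / 2) (hy : t < |x - y|) :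
    |x - y|⁻¹ ≤ ((1 + |x₀|) / t + 2) * (1 + |y|)⁻¹ := by
  have hpos : 0 < |x - y| := ht.trans hy
  rw [← div_eq_mul_inv, inv_le_comm₀ hpos (by positivity), inv_div, div_le_iff₀ (by positivity)]
  have h1 : |y| ≤ |x₀| + |x - x₀| + |x - y| := by
    have : y = x₀ + (x - x₀) - (x - y) := by ring
    calc |y| = |x₀ + (x - x₀) - (x - y)| := by rw [← this]
      _ ≤ |x₀ + (x - x₀)| + |x - y| := abs_sub _ _
      _ ≤ _ := by gcongr; exact abs_add_le _ _
  have h2 : 1 + |x₀| ≤ |x - y| * ((1 + |x₀|) / t) := by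
    rw [mul_div_assoc', le_div_iff₀ ht]
    have : 0 ≤ 1 + |x₀| := by positivity
    nlinarith
  nlinarith

lemma Admissible.integrable (hf : Admissible f) :
    Integrable (fun y => ‖f y‖ * (1 + |y|)⁻¹) := by
  refine ⟨(hf.1.norm.mul (by fun_prop)).aestronglyMeasurable, ?_⟩
  have : ∀ y, ‖‖f y‖ * (1 + |y|)⁻¹‖ₑ = ‖f y‖ₑ * ENNReal.ofReal ((1 + |y|)⁻¹) := fun y => by
    rw [enorm_mul, enorm_norm, Real.enorm_of_nonneg (by positivity)]
  simp_rw [HasFiniteIntegral, this]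
  exact lt_top_iff_ne_top.2 hf.2

lemma Admissible.of_le (hf : Admissible f) (hg : Measurable g) (h : ∀ x, ‖g x‖ ≤ ‖f x‖) :
    Admissible g := by
  refine ⟨hg, ne_top_of_le_ne_top hf.2 (lintegral_mono fun y => ?_)⟩
  gcongr ?_ * _
  exact enorm_le_iff_norm_le.2 (h y)

lemma Admissible.indicator (hf : Admissible f) {s : Set ℝ} (hs : MeasurableSet s) :
    Admissible (s.indicator f) :=
  hf.of_le (hf.1.indicator hs) fun _ => norm_indicator_le_norm_self _ _

lemma Admissible.of_lintegral (hf : Measurable f) (h : ∫⁻ y, ‖f y‖ₑ ≠ ∞) : Admissible f := by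
  refine ⟨hf, ne_top_of_le_ne_top h (lintegral_mono fun y => ?_)⟩
  have : ENNReal.ofReal ((1 + |y|)⁻¹) ≤ 1 := by
    rw [ENNReal.ofReal_le_one]
    exact inv_le_one_of_one_le₀ (by linarith [abs_nonneg y])
  exact mul_le_of_le_one_right' this

lemma Admissible.add (hf : Admissible f) (hg : Admissible g) :
    Admissible (fun x => f x + g x) := by
  refine ⟨hf.1.add hg.1, ?_⟩
  refine ne_top_of_le_ne_top (ENNReal.add_ne_top.2 ⟨hf.2, hg.2⟩) ?_
  have hm : Measurable fun y => ‖f y‖ₑ * ENNReal.ofReal ((1 + |y|)⁻¹) :=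
    hf.1.enorm.mul (by fun_prop)
  rw [← lintegral_add_left hm]
  refine lintegral_mono fun y => ?_
  rw [← add_mul]
  gcongr
  exact enorm_add_le _ _

lemma norm_kernel_mul_le (hK : KernelBounds K δ C) {x x₀ y t : ℝ} (ht : 0 < t)
    (hx : |x - x₀| ≤ t / 2) (hy : t < |x - y|) :
    ‖K x y * f y‖ ≤ C * ((1 + |x₀|) / t + 2) * (‖f y‖ * (1 + |y|)⁻¹) := by
  have hne : x ≠ y := fun h => by rw [h, sub_self, abs_zero] at hy; linarith
  have hC := hK.2.1
  calc _ = ‖K x y‖ * ‖f y‖ := norm_mul _ _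
    _ ≤ (C * |x - y|⁻¹) * ‖f y‖ := by
        gcongr
        exact hK.2.2.1 x y hne
    _ ≤ (C * (((1 + |x₀|) / t + 2) * (1 + |y|)⁻¹)) * ‖f y‖ := by
        gcongr
        exact inv_abs_sub_le ht hx hy
    _ = _ := by ring

lemma integrableOn_kernel_mul (hK : KernelBounds K δ C) (hf : Admissible f) (x : ℝ) {t : ℝ}
    (ht : 0 < t) : IntegrableOn (fun y => K x y * f y) {y | t < |x - y|} := by
  refine Integrable.mono' (hf.integrable.const_mul (C * ((1 + |x|) / t + 2))).integrableOn
    ((hK.aestronglyMeasurable x).mul hf.1.aestronglyMeasurable).restrict ?_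
  filter_upwards [ae_restrict_mem (measurableSet_far x t)] with y hy
  exact norm_kernel_mul_le hK ht (by simpa using (half_pos ht).le) hy

lemma ae_abs_sub_ne (x t : ℝ) : ∀ᵐ y : ℝ, |x - y| ≠ t := by
  have : ({x - t, x + t} : Set ℝ)ᶜ ∈ ae volume := by
    rw [mem_ae_iff, compl_compl]
    exact (Set.toFinite _).measure_zero _
  filter_upwards [this] with y hy h
  refine hy ?_
  rcases abs_choice (x - y) with h1 | h1 <;> rw [h1] at h
  · left; linarith
  · right; simp only [mem_singleton_iff]; linarith

/-- Dominated convergence: the integrand is continuous in x at `x₀` except for the two values of y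
with |x₀ - y| = t, a null set. -/
lemma continuous_truncated (hK : KernelBounds K δ C) (hf : Admissible f) {t : ℝ} (ht : 0 < t) :
    Continuous (fun x => truncated K f x t) := by
  rw [continuous_iff_continuousAt]
  intro x₀
  have hrw : (fun x => truncated K f x t) =
      fun x => ∫ y, {y : ℝ | t < |x - y|}.indicator (fun y => K x y * f y) y := by
    funext x
    rw [integral_indicator (measurableSet_far x t), truncated]
  rw [hrw]
  have hnear : ∀ᶠ x in 𝓝 x₀, |x - x₀| ≤ t / 2 := by
    filter_upwards [Metric.closedBall_mem_nhds x₀ (half_pos ht)] with x hx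
    simpa [Real.dist_eq] using hx
  refine continuousAt_of_dominated (bound := fun y =>
    C * ((1 + |x₀|) / t + 2) * (‖f y‖ * (1 + |y|)⁻¹)) ?_ ?_ (hf.integrable.const_mul _) ?_
  · refine Eventually.of_forall fun x => ?_
    exact ((hK.aestronglyMeasurable x).mul hf.1.aestronglyMeasurable).indicator
      (measurableSet_far x t)
  · filter_upwards [hnear] with x hx
    refine Eventually.of_forall fun y => ?_
    by_cases hy : t < |x - y|
    · rw [indicator_of_mem (by exact hy)]
      exact norm_kernel_mul_le hK ht hx hy
    · rw [indicator_of_notMem (by exact hy), norm_zero]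
      have := hK.2.1
      positivity
  · filter_upwards [ae_abs_sub_ne x₀ t] with y hy
    have hc : ContinuousAt (fun x => |x - y|) x₀ := by fun_prop
    rcases lt_or_gt_of_ne hy with h | h
    · have : ∀ᶠ x in 𝓝 x₀, |x - y| < t := hc.eventually_lt continuousAt_const h
      refine (continuousAt_const (y := (0 : ℂ))).congr ?_
      filter_upwards [this] with x hx
      rw [indicator_of_notMem (by simpa using hx.le)]
    · have : ∀ᶠ x in 𝓝 x₀, t < |x - y| := continuousAt_const.eventually_lt hc h
      have hne : x₀ ≠ y := fun e => by
        rw [e, sub_self, abs_zero] at h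
        linarith
      refine ((hK.continuousAt_left hne).mul (continuousAt_const (y := f y))).congr ?_
      filter_upwards [this] with x hx
      rw [indicator_of_mem (by exact hx)]
      rfl

/-- The supremum runs over uncountably many sequences, so measurability of the variation is not
automatic. Each sequence gives a lower semicontinuous function of x, and this survives arbitrary
suprema. -/
lemma lowerSemicontinuous_variationOp (hK : KernelBounds K δ C) (hf : Admissible f)
    (hq : 0 < q) : LowerSemicontinuous (variationOp K q f) := by
  have h : variationOp K q f = fun x => ⨆ (t : ℕ → ℝ) (_ : Monotone t) (_ : ∀ j, 0 < t j),
    (∑' j, ‖truncated K f x (t j) - truncated K f x (t (j + 1))‖ₑ ^ q) ^ (1 / q) := rfl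
  rw [h]
  refine lowerSemicontinuous_iSup fun t => lowerSemicontinuous_iSup fun ht =>
    lowerSemicontinuous_iSup fun ht0 => ?_
  refine Continuous.comp_lowerSemicontinuous (g := fun u : ℝ≥0∞ => u ^ (1 / q))
    ENNReal.continuous_rpow_const ?_ (ENNReal.monotone_rpow_of_nonneg (by positivity))
  refine lowerSemicontinuous_tsum fun j => ?_
  refine Continuous.lowerSemicontinuous ?_
  exact ENNReal.continuous_rpow_const.comp
    ((continuous_truncated hK hf (ht0 j)).sub (continuous_truncated hK hf (ht0 (j + 1)))).enorm

lemma measurable_variationOp (hK : KernelBounds K δ C) (hf : Admissible f)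
    (hq : 0 < q) : Measurable (variationOp K q f) :=
  (lowerSemicontinuous_variationOp hK hf hq).measurable

lemma truncated_add (hK : KernelBounds K δ C) (hf : Admissible f) (hg : Admissible g) (x : ℝ)
    {t : ℝ} (ht : 0 < t) :
    truncated K (fun y => f y + g y) x t = truncated K f x t + truncated K g x t := by
  unfold truncated
  rw [← integral_add (integrableOn_kernel_mul hK hf x ht) (integrableOn_kernel_mul hK hg x ht)]
  simp_rw [mul_add]

lemma truncated_congr_ae (h : f =ᵐ[volume] g) (x t : ℝ) :
    truncated K f x t = truncated K g x t := by
  refine integral_congr_ae (ae_restrict_of_ae ?_)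
  filter_upwards [h] with y hy
  rw [hy]

lemma variationOp_congr_ae (h : f =ᵐ[volume] g) (x : ℝ) :
    variationOp K q f x = variationOp K q g x :=
  qVariation_congr fun t _ => truncated_congr_ae h x t

lemma variationOp_zero (hq : 0 < q) (x : ℝ) : variationOp K q (fun _ => 0) x = 0 := by
  rw [variationOp, ← qVariation_zero hq]
  exact qVariation_congr fun t _ => by simp [truncated]

lemma variationOp_add_le (hK : KernelBounds K δ C) (hf : Admissible f) (hg : Admissible g)
    (hq : 1 ≤ q) (x : ℝ) :
    variationOp K q (fun y => f y + g y) x ≤ variationOp K q f x + variationOp K q g x := by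
  unfold variationOp
  rw [qVariation_congr fun t ht => truncated_add hK hf hg x ht]
  exact qVariation_add_le hq _ _

lemma variationOp_le_lintegral (hK : KernelBounds K δ C) (hf : Admissible f) (hq : 1 ≤ q)
    (x : ℝ) :
    variationOp K q f x ≤ ∫⁻ y in {y | 0 < |x - y|}, ‖K x y‖ₑ * ‖f y‖ₑ := by
  refine (qVariation_le_one hq _).trans ?_
  simp_rw [← enorm_mul]
  exact qVariation_one_setIntegral_le (φ := fun y => |x - y|) (by fun_prop)
    fun t ht => integrableOn_kernel_mul hK hf x ht

/-- Cutting f off around the very point x where the operator is evaluated only replaces the time t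
by `max t s`. The cut-off therefore cannot increase the variation at x. -/
lemma truncated_indicator_far (x s t : ℝ) :
    truncated K ({y | s < |x - y|}.indicator f) x t = truncated K f x (max t s) := by
  unfold truncated
  have h : (fun y => K x y * {y | s < |x - y|}.indicator f y) =
      {y | s < |x - y|}.indicator fun y => K x y * f y := by
    funext y
    by_cases hy : y ∈ {y | s < |x - y|} <;> simp [hy]
  rw [h, setIntegral_indicator (measurableSet_far x s)]
  congr 2
  ext y
  simp

lemma variationOp_indicator_far_le (x s : ℝ) :
    variationOp K q ({y | s < |x - y|}.indicator f) x ≤ variationOp K q f x := by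
  refine qVariation_le fun t ht ht0 => ?_
  simp_rw [truncated_indicator_far]
  exact le_qVariation (truncated K f x) (t := fun j => max (t j) s)
    (fun i j hij => max_le_max_right s (ht hij)) fun j => lt_max_of_lt_left (ht0 j)

/-- Lower semicontinuity of the variation operator under dominated convergence. -/
lemma variationOp_le_liminf (hK : KernelBounds K δ C) (hf : Admissible f) (hq : 0 < q)
    {F : ℕ → ℝ → ℂ} (hF : ∀ n, Measurable (F n)) (hFf : ∀ n y, ‖F n y‖ ≤ ‖f y‖)
    (hlim : ∀ᵐ y, Tendsto (fun n => F n y) atTop (𝓝 (f y))) (x : ℝ) :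
    variationOp K q f x ≤ liminf (fun n => variationOp K q (F n) x) atTop := by
  have htr : ∀ t, 0 < t → Tendsto (fun n => truncated K (F n) x t) atTop
      (𝓝 (truncated K f x t)) := fun t ht => by
    unfold truncated
    refine tendsto_integral_of_dominated_convergence (fun y => ‖K x y * f y‖) ?_
      (integrableOn_kernel_mul hK hf x ht).norm ?_ ?_
    · exact fun n => ((hK.aestronglyMeasurable x).mul (hF n).aestronglyMeasurable).restrict
    · refine fun n => Eventually.of_forall fun y => ?_
      rw [norm_mul, norm_mul]
      gcongr
      exact hFf n y
    · refine ae_restrict_of_ae ?_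
      filter_upwards [hlim] with y hy
      exact hy.const_mul _
  refine qVariation_le fun t ht ht0 => ?_
  have h1 : ∀ j, ‖truncated K f x (t j) - truncated K f x (t (j + 1))‖ₑ =
      liminf (fun n => ‖truncated K (F n) x (t j) - truncated K (F n) x (t (j + 1))‖ₑ) atTop :=
    fun j => (((htr _ (ht0 j)).sub (htr _ (ht0 (j + 1)))).enorm).liminf_eq.symm
  simp_rw [h1]
  refine (lpn_liminf_le hq _).trans ?_
  exact liminf_le_liminf (Eventually.of_forall fun n => le_qVariation _ ht ht0)

end Kernel

end VqCZ

end

/-! ### Pointwise estimates for the scalar operator. -/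

noncomputable section

namespace VqCZ

section ScalarEstimates

open Filter Topology

variable {K : ℝ → ℝ → ℂ} {δ C q : ℝ} {f g : ℝ → ℂ}

lemma exists_finset_of_points {α : Type*} {I : ℕ → Set α} (hI : Pairwise (Function.onFun Disjoint I))
    (P : Finset α) : ∃ s : Finset ℕ, s.card ≤ P.card ∧ ∀ i ∉ s, ∀ p ∈ P, p ∉ I i := by
  classical
  -- Each point lies in at most one interval. The default index 0, for points in none, can only add
  -- a superfluous element without affecting the cardinality bound.
  refine ⟨P.image fun p => if h : ∃ i, p ∈ I i then h.choose else 0, Finset.card_image_le, ?_⟩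
  intro i hi p hp hpi
  refine hi (Finset.mem_image.2 ⟨p, hp, ?_⟩)
  have h : ∃ i, p ∈ I i := ⟨i, hpi⟩
  rw [dif_pos h]
  by_contra hne
  exact Set.disjoint_left.1 (hI hne) h.choose_spec hpi

/-- The variation operator on a sum of functions supported in disjoint intervals, at a point away
from these intervals. -/
lemma variationOp_le_of_intervals (hK : KernelBounds K δ C) (hg : Admissible g) (hq : 1 ≤ q)
    {a b : ℕ → ℝ} (hdisj : Pairwise (Function.onFun Disjoint fun i => Ioo (a i) (b i)))
    (hsupp : ∀ y, y ∉ ⋃ i, Ioo (a i) (b i) → g y = 0) {x : ℝ}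
    (hx : ∀ i, ∃ s > 0, Ioo (a i) (b i) ⊆ {y | s < |x - y|}) :
    variationOp K q g x ≤ ∑' i, ‖∫ y in Ioo (a i) (b i), K x y * g y‖ₑ +
      4 * lpn q (fun i => 2 * ∫⁻ y in Ioo (a i) (b i), ‖K x y‖ₑ * ‖g y‖ₑ) := by
  classical
  set I := fun i => Ioo (a i) (b i) with hI
  set S := fun t => {y : ℝ | t < |x - y|} with hS
  set G := fun y => K x y * g y with hG
  have hGS : ∀ t, 0 < t → IntegrableOn G (S t) := fun t ht => integrableOn_kernel_mul hK hg x ht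
  have hGI : ∀ i, IntegrableOn G (I i) := fun i => by
    obtain ⟨s, hs, hsub⟩ := hx i
    exact (hGS s hs).mono_set hsub
  set m := fun i => ∫ y in I i, G y with hm
  set E := fun i t => ∫ y in S t ∩ I i, G y with hE
  set P := fun i t => I i ⊆ S t with hP
  -- What remains of the i-th piece once its complete contribution is removed; it is nonzero only
  -- while the interval straddles the boundary of `S t`.
  set e := fun i t => E i t - if P i t then m i else 0 with he
  set a' := fun t => truncated K g x t with ha'
  have hsum : ∀ t, 0 < t → HasSum (fun i => E i t) (a' t) := fun t ht => by
    have h1 := hasSum_integral_iUnion (μ := volume) (s := fun i => S t ∩ I i) (f := G)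
      (fun i => (measurableSet_far x t).inter measurableSet_Ioo)
      (fun i j hij => (hdisj hij).mono inter_subset_right inter_subset_right)
      ((hGS t ht).mono_set (iUnion_subset fun i => inter_subset_left))
    have h2 : a' t = ∫ y in ⋃ i, S t ∩ I i, G y := ?_
    · rw [h2]
      exact h1
    change ∫ y in S t, G y = _
    refine setIntegral_eq_of_subset_of_forall_sdiff_eq_zero (measurableSet_far x t)
      (iUnion_subset fun i => inter_subset_left) ?_
    intro y hy
    have : y ∉ ⋃ i, I i := fun h => by
      obtain ⟨i, hi⟩ := mem_iUnion.1 h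
      exact hy.2 (mem_iUnion.2 ⟨i, hy.1, hi⟩)
    rw [hG]
    simp [hsupp y this]
  -- An interval on one side of x that meets both `S t` and its complement contains x + t or x - t.
  -- Disjointness leaves at most two such intervals.
  have hact : ∀ t, ∃ s : Finset ℕ, s.card ≤ 2 ∧ ∀ i ∉ s, e i t = 0 := fun t => by
    obtain ⟨s, hs, hs'⟩ := exists_finset_of_points hdisj {x + t, x - t}
    refine ⟨s, hs.trans Finset.card_le_two, fun i hi => ?_⟩
    have hp := hs' i hi (x + t) (by simp)
    have hp' := hs' i hi (x - t) (by simp)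
    by_cases hPi : P i t
    · have : S t ∩ I i = I i := inter_eq_right.2 hPi
      simp [he, hPi, hE, hm, this]
    have hempty : S t ∩ I i = ∅ := by
      by_contra hne
      obtain ⟨y', hy'S, hy'⟩ := nonempty_iff_ne_empty.2 hne
      obtain ⟨y, hy, hyS⟩ := not_subset.1 hPi
      obtain ⟨s₀, hs₀, hsub⟩ := hx i
      have hxI : x ∉ I i := fun h => by
        have := hsub h
        simp only [mem_ofPred_eq, sub_self, abs_zero] at this
        linarith
      simp only [hS, mem_ofPred_eq, not_lt] at hyS hy'S
      simp only [hI, mem_Ioo, not_and_or, not_lt] at hxI hy hy' hp hp'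
      rcases hxI with hxa | hxb
      · rw [abs_of_nonpos (by linarith)] at hyS hy'S
        rcases hp with h | h <;> linarith [hy.1, hy.2, hy'.1, hy'.2]
      · rw [abs_of_nonneg (by linarith)] at hyS hy'S
        rcases hp' with h | h <;> linarith [hy.1, hy.2, hy'.1, hy'.2]
    simp [he, hPi, hE, hempty]
  choose s hs2 hs0 using hact
  set A2 := fun t => ∑ i ∈ s t, e i t with hA2
  have hsum1 : ∀ t, 0 < t → HasSum (fun i => if P i t then m i else 0) (a' t - A2 t) :=
    fun t ht => by
      have h1 := (hsum t ht).sub (hasSum_sum_of_ne_finset_zero (hs0 t))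
      have h2 : (fun i => E i t - e i t) = fun i => if P i t then m i else 0 := by
        funext i
        simp [he]
      rw [h2] at h1
      exact h1
  have hV1 : qVariation q (fun t => a' t - A2 t) ≤ ∑' i, ‖m i‖ₑ := by
    refine (qVariation_le_one hq _).trans ((qVariation_one_hasSum_le hsum1).trans ?_)
    refine ENNReal.tsum_le_tsum fun i => qVariation_one_ite_le ?_ _
    exact fun s t hst h y hy => hst.trans_lt (h hy)
  have hD : ∀ i, ‖m i‖ₑ ≤ ∫⁻ y in I i, ‖K x y‖ₑ * ‖g y‖ₑ := fun i => by
    simp_rw [← enorm_mul]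
    exact enorm_integral_le_lintegral_enorm _
  have hVe : ∀ i, qVariation 1 (e i) ≤ 2 * ∫⁻ y in I i, ‖K x y‖ₑ * ‖g y‖ₑ := fun i => by
    refine (qVariation_sub_le le_rfl _ _).trans ?_
    rw [two_mul]
    refine add_le_add ?_ ((qVariation_one_ite_le ?_ _).trans (hD i))
    · have h1 := qVariation_one_setIntegral_le (μ := volume.restrict (I i))
        (φ := fun y => |x - y|) (by fun_prop) (G := G) fun t ht => (hGS t ht).mono_measure
          Measure.restrict_le_self
      have h2 : ∀ t, E i t = ∫ y in {y | t < |x - y|}, G y ∂(volume.restrict (I i)) := fun t => by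
        rw [Measure.restrict_restrict (measurableSet_far x t)]
      simp_rw [← h2] at h1
      refine h1.trans ?_
      simp_rw [← enorm_mul]
      exact lintegral_mono' Measure.restrict_le_self le_rfl
    · exact fun s t hst h y hy => hst.trans_lt (h hy)
  have hV2 : qVariation q A2 ≤ 4 * lpn q (fun i => 2 * ∫⁻ y in I i, ‖K x y‖ₑ * ‖g y‖ₑ) := by
    refine (qVariation_sum_le hq 2 fun t _ => ⟨s t, hs2 t, hs0 t, rfl⟩).trans ?_
    norm_num
    gcongr
    exact lpn_mono (by linarith) hVe
  have hsplit : variationOp K q g x = qVariation q (fun t => (a' t - A2 t) + A2 t) := by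
    simp only [sub_add_cancel]
    rfl
  rw [hsplit]
  exact (qVariation_add_le hq _ _).trans (add_le_add hV1 hV2)

/-- The same for functions of mean zero on each interval, in terms of their integrals. -/
lemma variationOp_le_of_mean_zero (hK : KernelBounds K δ C) (hgm : Measurable g)
    (hg : ∫⁻ y, ‖g y‖ₑ ≠ ∞) (hq : 1 ≤ q)
    {a b : ℕ → ℝ} (hab : ∀ i, a i ≤ b i)
    (hdisj : Pairwise (Function.onFun Disjoint fun i => Ioo (a i) (b i)))
    (hsupp : ∀ y, y ∉ ⋃ i, Ioo (a i) (b i) → g y = 0)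
    (hmean : ∀ i, ∫ y in Ioo (a i) (b i), g y = 0) {x : ℝ}
    (hx : ∀ i, x ∉ Ioo (a i - (b i - a i)) (b i + (b i - a i))) :
    variationOp K q g x ≤
      ∑' i, ENNReal.ofReal (C * (b i - a i) ^ δ * |x - (a i + b i) / 2| ^ (-(1 + δ))) *
        (∫⁻ y in Ioo (a i) (b i), ‖g y‖ₑ) +
      4 * lpn q (fun i => ENNReal.ofReal (4 * C * |x - (a i + b i) / 2|⁻¹) *
        ∫⁻ y in Ioo (a i) (b i), ‖g y‖ₑ) := by
  have hgi : Integrable g := ⟨hgm.aestronglyMeasurable, lt_top_iff_ne_top.2 hg⟩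
  have hadm := Admissible.of_lintegral hgm hg
  obtain ⟨hδ, hC, hK1, -, hK3⟩ := id hK
  -- Outside the tripled interval x is at least three half-lengths from the centre, so the
  -- regularity condition holds with the centre as reference point.
  have hfar : ∀ i, ∀ y ∈ Ioo (a i) (b i), |(a i + b i) / 2 - y| ≤ (b i - a i) / 2 ∧
      3 / 2 * (b i - a i) ≤ |x - (a i + b i) / 2| ∧ 0 < b i - a i := fun i y hy => by
    have h := hx i
    simp only [mem_Ioo, not_and_or, not_lt] at h hy
    refine ⟨abs_le.2 ⟨by linarith, by linarith⟩, le_abs.2 ?_, by linarith⟩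
    rcases h with h | h
    · right; linarith
    · left; linarith
  have hnear : ∀ i, ∀ y ∈ Ioo (a i) (b i), |x - (a i + b i) / 2| ≤ 2 * |x - y| ∧
      (b i - a i) / 2 < |x - y| := fun i y hy => by
    obtain ⟨h1, h2, h3⟩ := hfar i y hy
    have h4 : |x - (a i + b i) / 2| ≤ |x - y| + |(a i + b i) / 2 - y| := by
      have : x - (a i + b i) / 2 = (x - y) - ((a i + b i) / 2 - y) := by ring
      rw [this]
      exact abs_sub _ _
    constructor <;> linarith
  have hx' : ∀ i, ∃ s > 0, Ioo (a i) (b i) ⊆ {y | s < |x - y|} := fun i => by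
    rcases (hab i).eq_or_lt with h | h
    · exact ⟨1, one_pos, by simp [h]⟩
    · exact ⟨(b i - a i) / 2, by linarith, fun y hy => (hnear i y hy).2⟩
  refine (variationOp_le_of_intervals hK hadm hq hdisj hsupp hx').trans ?_
  gcongr with i i
  · have hKg : IntegrableOn (fun y => K x y * g y) (Ioo (a i) (b i)) := by
      obtain ⟨s, hs, hsub⟩ := hx' i
      exact (integrableOn_kernel_mul hK hadm x hs).mono_set hsub
    -- The mean-zero condition allows the kernel at the centre to be subtracted; the regularity in
    -- the second variable then supplies the decay.
    have h1 : ∫ y in Ioo (a i) (b i), K x y * g y =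
        ∫ y in Ioo (a i) (b i), (K x y - K x ((a i + b i) / 2)) * g y := by
      simp_rw [sub_mul]
      rw [integral_sub hKg (hgi.integrableOn.const_mul _), integral_const_mul, hmean i, mul_zero,
        sub_zero]
    rw [h1]
    refine (enorm_integral_le_lintegral_enorm _).trans ?_
    rw [← lintegral_const_mul _ hgm.enorm]
    refine setLIntegral_mono (by fun_prop) fun y hy => ?_
    rw [enorm_mul]
    gcongr
    obtain ⟨h1, h2, h3⟩ := hfar i y hy
    rw [← ofReal_norm, norm_sub_rev]
    refine ENNReal.ofReal_le_ofReal ((hK3 _ _ _ ?_).trans ?_)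
    · rw [abs_sub_comm _ x]
      linarith
    · rw [abs_sub_comm _ x, Real.rpow_neg (abs_nonneg _), div_eq_mul_inv]
      gcongr
      linarith
  · refine lpn_mono (by linarith) fun i => ?_
    rw [show 4 * C * |x - (a i + b i) / 2|⁻¹ = 2 * (2 * C * |x - (a i + b i) / 2|⁻¹) by ring,
      ENNReal.ofReal_mul zero_le_two, mul_assoc, ENNReal.ofReal_ofNat]
    gcongr
    rw [← lintegral_const_mul _ hgm.enorm]
    refine setLIntegral_mono (by fun_prop) fun y hy => ?_
    obtain ⟨h1, h2, h3⟩ := hfar i y hy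
    obtain ⟨h4, h5⟩ := hnear i y hy
    have hxy : 0 < |x - y| := by linarith
    gcongr
    refine (hK.enorm_le (fun h => by simp [h] at hxy)).trans (ENNReal.ofReal_le_ofReal ?_)
    rw [div_le_iff₀ hxy, mul_right_comm, ← div_eq_mul_inv, le_div_iff₀ (by linarith)]
    nlinarith

/-- Comparison of the variation operator at two points. -/
lemma variationOp_far_le (hK : KernelBounds K δ C) (hf : Admissible f) (hq : 1 ≤ q)
    {x ξ h : ℝ} (hh : 0 < h) (hxξ : |x - ξ| ≤ h) :
    variationOp K q ({y | 4 * h < |x - y|}.indicator f) ξ ≤ variationOp K q f x +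
      (∫⁻ y in {y | 4 * h < |x - y|},
        ENNReal.ofReal (C * h ^ δ * |x - y| ^ (-(1 + δ))) * ‖f y‖ₑ) +
      16 * lpn q (fun m : ℕ => ENNReal.ofReal (2 * C / ((m + 4) * h)) *
        ∫⁻ y in {y | (m + 4) * h < |x - y| ∧ |x - y| ≤ (m + 5) * h}, ‖f y‖ₑ) := by
  classical
  obtain ⟨hδ, hC, hK1, hK2, -⟩ := id hK
  have h4 : 0 < 4 * h := by linarith
  set Far := {y : ℝ | 4 * h < |x - y|} with hFar
  have hFm : MeasurableSet Far := measurableSet_far x _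
  set g := Far.indicator f with hg
  have hga : Admissible g := hf.indicator hFm
  set G := fun y => K x y * g y with hG
  have hGind : G = Far.indicator fun y => K x y * f y := by
    funext y
    by_cases hy : y ∈ Far <;> simp [hG, hg, hy]
  have hGi : Integrable G := by
    rw [hGind]
    exact (integrableOn_kernel_mul hK hf x h4).integrable_indicator hFm
  -- Moving the centre of truncation from x to ξ changes the domain only where |x - y| is within h
  -- of t. Shells of width h localise this change in time.
  set Sh := fun m : ℕ => {y : ℝ | (m + 4) * h < |x - y| ∧ |x - y| ≤ (m + 5) * h} with hSh
  have hShm : ∀ m, MeasurableSet (Sh m) := fun m =>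
    (by fun_prop : Measurable fun y => |x - y|) measurableSet_Ioc
  set Gm := fun m => (Sh m).indicator G with hGm
  have hGmi : ∀ m, Integrable (Gm m) := fun m => hGi.indicator (hShm m)
  set A := fun t => {y : ℝ | t < |ξ - y|} with hA
  set B := fun t => {y : ℝ | t < |x - y|} with hB
  have hAm : ∀ t, MeasurableSet (A t) := fun t => measurableSet_far ξ t
  have hBm : ∀ t, MeasurableSet (B t) := fun t => measurableSet_far x t
  set cm := fun m t => (∫ y in A t, Gm m y) - ∫ y in B t, Gm m y with hcm
  set c := fun t => (∫ y in A t, G y) - ∫ y in B t, G y with hc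
  set d := fun t => ∫ y in A t, (K ξ y - K x y) * g y with hd
  -- Here `d` changes the kernel while keeping the domain centred at ξ, and `c` changes the domain
  -- while keeping the kernel at x.
  have hsplit : ∀ t, 0 < t → truncated K g ξ t = (truncated K g x t + d t) + c t := by
    intro t ht
    have h1 : d t = truncated K g ξ t - ∫ y in A t, G y := by
      simp only [hd, sub_mul]
      rw [integral_sub (integrableOn_kernel_mul hK hga ξ ht) hGi.integrableOn]
      rfl
    have h2 : truncated K g x t = ∫ y in B t, G y := rfl
    rw [h1, h2, hc]
    ring
  have htri : ∀ y, |x - y| ≤ |ξ - y| + h ∧ |ξ - y| ≤ |x - y| + h := fun y => by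
    have e1 : x - y = (ξ - y) + (x - ξ) := by ring
    have e2 : ξ - y = (x - y) - (x - ξ) := by ring
    constructor
    · calc |x - y| = |(ξ - y) + (x - ξ)| := by rw [← e1]
        _ ≤ |ξ - y| + |x - ξ| := abs_add_le _ _
        _ ≤ _ := by gcongr
    · calc |ξ - y| = |(x - y) - (x - ξ)| := by rw [← e2]
        _ ≤ |x - y| + |x - ξ| := abs_sub _ _
        _ ≤ _ := by gcongr
  -- the part coming from the difference of the kernels
  have hdV : qVariation q d ≤ ∫⁻ y in Far,
      ENNReal.ofReal (C * h ^ δ * |x - y| ^ (-(1 + δ))) * ‖f y‖ₑ := by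
    refine (qVariation_le_one hq _).trans ?_
    refine (qVariation_one_setIntegral_le (φ := fun y => |ξ - y|) (by fun_prop)
      (G := fun y => (K ξ y - K x y) * g y) fun t ht => ?_).trans ?_
    · simp_rw [sub_mul]
      exact (integrableOn_kernel_mul hK hga ξ ht).sub hGi.integrableOn
    refine (setLIntegral_le_lintegral _ _).trans ?_
    rw [← lintegral_indicator hFm]
    refine lintegral_mono fun y => ?_
    by_cases hy : y ∈ Far
    · have hy' : 4 * h < |x - y| := hy
      rw [indicator_of_mem hy, hg, indicator_of_mem hy, enorm_mul]
      gcongr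
      rw [← ofReal_norm, norm_sub_rev]
      refine ENNReal.ofReal_le_ofReal ((hK2 x y ξ (by linarith)).trans ?_)
      rw [Real.rpow_neg (abs_nonneg _), div_eq_mul_inv]
      gcongr
    · rw [indicator_of_notMem hy, hg, indicator_of_notMem hy]
      simp
  -- the part coming from the difference of the truncations
  have hcmV : ∀ m, qVariation 1 (cm m) ≤ ENNReal.ofReal (2 * C / ((m + 4) * h)) *
      ∫⁻ y in Sh m, ‖f y‖ₑ := fun m => by
    have hle : ∫⁻ y, ‖Gm m y‖ₑ ≤ ENNReal.ofReal (C / ((m + 4) * h)) * ∫⁻ y in Sh m, ‖f y‖ₑ := by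
      simp_rw [hGm, enorm_indicator_eq_indicator_enorm]
      rw [lintegral_indicator (hShm m), ← lintegral_const_mul _ hf.1.enorm]
      refine setLIntegral_mono (hf.1.enorm.const_mul _) fun y hy => ?_
      have h0 : 0 < ((m : ℝ) + 4) * h := by positivity
      have hxy : 0 < |x - y| := h0.trans hy.1
      rw [hG, enorm_mul]
      gcongr
      · refine (hK.enorm_le (fun h => by simp [h] at hxy)).trans (ENNReal.ofReal_le_ofReal ?_)
        gcongr
        exact hy.1.le
      · exact enorm_le_iff_norm_le.2 (norm_indicator_le_norm_self _ _)
    refine (qVariation_sub_le le_rfl _ _).trans ?_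
    rw [mul_div_assoc, ENNReal.ofReal_mul zero_le_two, ENNReal.ofReal_ofNat, mul_assoc, two_mul]
    refine add_le_add ?_ ?_
    · refine (qVariation_one_setIntegral_le (φ := fun y => |ξ - y|) (by fun_prop)
        fun t _ => (hGmi m).integrableOn).trans ?_
      exact (setLIntegral_le_lintegral _ _).trans hle
    · refine (qVariation_one_setIntegral_le (φ := fun y => |x - y|) (by fun_prop)
        fun t _ => (hGmi m).integrableOn).trans ?_
      exact (setLIntegral_le_lintegral _ _).trans hle
  -- An active shell satisfies (m+3)h ≤ t ≤ (m+6)h. The window of at most eight indices is slightly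
  -- generous, and the factor 16 is twice eight.
  have hactive : ∀ t m y, y ∈ Sh m → ¬ (y ∈ A t ↔ y ∈ B t) →
      m ∈ Finset.Icc (⌊t / h⌋₊ - 7) ⌊t / h⌋₊ := by
    intro t m y hy hne
    simp only [hA, hB, mem_ofPred_eq, hSh] at hne hy
    obtain ⟨h1, h2⟩ := htri y
    have h3 : ((m : ℝ) + 3) * h ≤ t ∧ t ≤ (m + 6) * h := by
      by_cases hb : t < |x - y|
      · have ha : ¬ t < |ξ - y| := fun ha => hne ⟨fun _ => hb, fun _ => ha⟩
        constructor <;> linarith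
      · have ha : t < |ξ - y| := by
          by_contra ha
          exact hne ⟨fun h => absurd h ha, fun h => absurd h hb⟩
        constructor <;> linarith
    have h5 : (m : ℝ) + 3 ≤ t / h := (le_div_iff₀ hh).2 h3.1
    have h6 : t / h ≤ (m : ℝ) + 6 := (div_le_iff₀ hh).2 h3.2
    rw [Finset.mem_Icc]
    constructor
    · have : ⌊t / h⌋₊ ≤ m + 6 := Nat.floor_le_of_le (by push_cast; exact h6)
      omega
    · exact Nat.le_floor (by linarith)
  have hcsum : ∀ t, c t = ∑ m ∈ Finset.Icc (⌊t / h⌋₊ - 7) ⌊t / h⌋₊, cm m t := by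
    intro t
    have e1 : ∀ H : ℝ → ℂ, Integrable H → (∫ y in A t, H y) - ∫ y in B t, H y =
        ∫ y, ((A t).indicator H y - (B t).indicator H y) := fun H hH => by
      rw [integral_sub (hH.indicator (hAm t)) (hH.indicator (hBm t)),
        integral_indicator (hAm t), integral_indicator (hBm t)]
    simp only [hc, hcm]
    rw [e1 G hGi, Finset.sum_congr rfl fun m _ => e1 (Gm m) (hGmi m),
      ← integral_finsetSum (f := fun m y => (A t).indicator (Gm m) y - (B t).indicator (Gm m) y) _
        fun m _ => ((hGmi m).indicator (hAm t)).sub ((hGmi m).indicator (hBm t))]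
    refine integral_congr_ae (Eventually.of_forall fun y => ?_)
    beta_reduce
    by_cases hy : y ∈ Far
    swap
    · have hGy : G y = 0 := by rw [hGind, indicator_of_notMem hy]
      have hGmy : ∀ m, Gm m y = 0 := fun m => by simp [hGm, indicator_apply, hGy]
      simp [indicator_apply, hGy, hGmy]
    obtain ⟨m₀, hm₀⟩ : ∃ m₀, y ∈ Sh m₀ := by
      have hy' : 4 * h < |x - y| := hy
      have h5 : 4 < |x - y| / h := (lt_div_iff₀ hh).2 hy'
      have h6 : 5 ≤ ⌈|x - y| / h⌉₊ := Nat.lt_ceil.2 (by exact_mod_cast h5)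
      obtain ⟨k, hk⟩ := Nat.exists_eq_add_of_le h6
      have h7 := Nat.le_ceil (|x - y| / h)
      have h8 := Nat.ceil_lt_add_one (a := |x - y| / h) (by positivity)
      rw [hk] at h7 h8
      push_cast at h7 h8
      refine ⟨k, ?_, ?_⟩
      · exact (lt_div_iff₀ hh).1 (by linarith)
      · exact (div_le_iff₀ hh).1 (by linarith)
    have huniq : ∀ m, m ≠ m₀ → Gm m y = 0 := fun m hm => by
      refine indicator_of_notMem (fun hy' => hm ?_) _
      have q1 : (m : ℝ) + 4 < m₀ + 5 := lt_of_mul_lt_mul_right (hy'.1.trans_le hm₀.2) hh.le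
      have q2 : (m₀ : ℝ) + 4 < m + 5 := lt_of_mul_lt_mul_right (hm₀.1.trans_le hy'.2) hh.le
      have q3 : m < m₀ + 1 := by exact_mod_cast (by linarith : (m : ℝ) < m₀ + 1)
      have q4 : m₀ < m + 1 := by exact_mod_cast (by linarith : (m₀ : ℝ) < m + 1)
      omega
    have hGm₀ : Gm m₀ y = G y := indicator_of_mem hm₀ _
    by_cases hmem : m₀ ∈ Finset.Icc (⌊t / h⌋₊ - 7) ⌊t / h⌋₊
    · rw [Finset.sum_eq_single m₀]
      · simp [indicator_apply, hGm₀]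
      · intro m _ hm
        simp [indicator_apply, huniq m hm]
      · exact fun h => absurd hmem h
    · have hiff : y ∈ A t ↔ y ∈ B t := by
        by_contra hne
        exact hmem (hactive t m₀ y hm₀ hne)
      rw [Finset.sum_eq_zero]
      · simp [indicator_apply, hiff]
      · intro m hm
        have : m ≠ m₀ := fun h => hmem (h ▸ hm)
        simp [indicator_apply, huniq m this]
  have hcV : qVariation q c ≤ 16 * lpn q (fun m : ℕ => ENNReal.ofReal (2 * C / ((m + 4) * h)) *
        ∫⁻ y in Sh m, ‖f y‖ₑ) := by
    refine (qVariation_sum_le hq 8 (e := cm) fun t _ =>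
      ⟨Finset.Icc (⌊t / h⌋₊ - 7) ⌊t / h⌋₊, ?_, ?_, hcsum t⟩).trans ?_
    · simp only [Nat.card_Icc]
      omega
    · intro m hm
      have hz : ∀ y, y ∈ Sh m → (y ∈ A t ↔ y ∈ B t) := fun y hy => by
        by_contra hne
        exact hm (hactive t m y hy hne)
      have : (A t).indicator (Gm m) = (B t).indicator (Gm m) := by
        funext y
        by_cases hy : y ∈ Sh m
        · simp [indicator_apply, hz y hy]
        · simp [indicator_apply, hGm, hy]
      simp only [hcm]
      rw [← integral_indicator (hAm t), ← integral_indicator (hBm t), this, sub_self]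
    · norm_num
      gcongr
      exact lpn_mono (by linarith) hcmV
  rw [variationOp, qVariation_congr hsplit]
  refine (qVariation_add_le hq _ _).trans (add_le_add ((qVariation_add_le hq _ _).trans
    (add_le_add ?_ hdV)) hcV)
  exact variationOp_indicator_far_le x _

end ScalarEstimates

end VqCZ

end

/-! ### Open sets on the line, the maximal function and `A_1` measures. -/

noncomputable section

namespace VqCZ

section RealLine

open Filter Topology

/-- A connected open subset of the line of finite measure is a bounded open interval. -/
lemma eq_Ioo_of_isOpen_of_isConnected {c : Set ℝ} (ho : IsOpen c) (hc : IsConnected c)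
    (hv : volume c ≠ ∞) : sInf c < sSup c ∧ c = Ioo (sInf c) (sSup c) := by
  obtain ⟨x, hx⟩ := hc.nonempty
  have hord := hc.isPreconnected.ordConnected
  have hbd : ∀ y ∈ c, |y - x| ≤ (volume c).toReal := fun y hy => by
    have h1 : uIcc x y ⊆ c := hord.uIcc_subset hx hy
    have h2 := measure_mono (μ := volume) h1
    rw [Real.volume_interval] at h2
    rw [← ENNReal.ofReal_le_iff_le_toReal hv]
    exact h2
  have hA : BddAbove c := ⟨x + (volume c).toReal, fun y hy => by
    linarith [le_abs_self (y - x), hbd y hy]⟩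
  have hB : BddBelow c := ⟨x - (volume c).toReal, fun y hy => by
    linarith [neg_abs_le (y - x), hbd y hy]⟩
  have hsub : c ⊆ Ioo (sInf c) (sSup c) := fun y hy => by
    obtain ⟨ε, hε, hball⟩ := Metric.isOpen_iff.1 ho y hy
    have h1 : y - ε / 2 ∈ c := hball (by simp [abs_of_pos hε, hε])
    have h2 : y + ε / 2 ∈ c := hball (by simp [abs_of_pos hε, hε])
    have := csInf_le hB h1
    have := le_csSup hA h2
    constructor <;> linarith
  exact ⟨(hsub hx).1.trans (hsub hx).2, hsub.antisymm (hc.Ioo_csInf_csSup_subset hB hA)⟩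

/-- Decomposition of an open set of finite measure into its components. -/
lemma exists_components {U : Set ℝ} (hU : IsOpen U) (hv : volume U ≠ ∞) :
    ∃ a b : ℕ → ℝ, (∀ i, a i ≤ b i) ∧
      Pairwise (Function.onFun Disjoint fun i => Ioo (a i) (b i)) ∧
      U = ⋃ i, Ioo (a i) (b i) ∧ ∀ i, a i < b i → a i ∉ U ∧ b i ∉ U := by
  classical
  set 𝒞 : Set (Set ℝ) := (fun x => connectedComponentIn U x) '' U with h𝒞
  have hopen : ∀ c ∈ 𝒞, IsOpen c := by
    rintro _ ⟨x, hx, rfl⟩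
    exact hU.connectedComponentIn
  have hconn : ∀ c ∈ 𝒞, IsConnected c := by
    rintro _ ⟨x, hx, rfl⟩
    exact isConnected_connectedComponentIn_iff.2 hx
  have hsubU : ∀ c ∈ 𝒞, c ⊆ U := by
    rintro _ ⟨x, hx, rfl⟩
    exact connectedComponentIn_subset _ _
  have hdisj : 𝒞.PairwiseDisjoint id := by
    rintro _ ⟨x, hx, rfl⟩ _ ⟨y, hy, rfl⟩ hne
    rw [Function.onFun, id, id]
    by_contra h
    obtain ⟨z, hz1, hz2⟩ := Set.not_disjoint_iff.1 h
    exact hne ((connectedComponentIn_eq hz1).trans (connectedComponentIn_eq hz2).symm)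
  have hcount : 𝒞.Countable :=
    hdisj.countable_of_isOpen (fun c hc => hopen c hc) fun c hc => (hconn c hc).nonempty
  have hIoo : ∀ c ∈ 𝒞, sInf c < sSup c ∧ c = Ioo (sInf c) (sSup c) := fun c hc =>
    eq_Ioo_of_isOpen_of_isConnected (hopen c hc) (hconn c hc)
      (ne_top_of_le_ne_top hv (measure_mono (hsubU c hc)))
  -- A limit point of a component that lay in `U` would have an open component meeting the given
  -- one, hence equal to it.
  have hend : ∀ c ∈ 𝒞, ∀ p, p ∉ c → (∀ ε > 0, ∃ z ∈ c, |z - p| < ε) → p ∉ U := by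
    rintro _ ⟨x, hx, rfl⟩ p hp hnear hpU
    have ho : IsOpen (connectedComponentIn U p) := hU.connectedComponentIn
    obtain ⟨ε, hε, hball⟩ := Metric.isOpen_iff.1 ho p (mem_connectedComponentIn hpU)
    obtain ⟨z, hz, hzp⟩ := hnear ε hε
    have hz' : z ∈ connectedComponentIn U p := hball (by rwa [Metric.mem_ball, Real.dist_eq])
    refine hp ?_
    have : connectedComponentIn U x = connectedComponentIn U p :=
      (connectedComponentIn_eq hz).trans (connectedComponentIn_eq hz').symm
    beta_reduce
    rw [this]
    exact mem_connectedComponentIn hpU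
  have : Countable 𝒞 := hcount
  obtain ⟨φ, hφ⟩ := exists_injective_nat 𝒞
  -- Indices not used by the injection receive the empty interval (0,0). This is why the endpoint
  -- statement is restricted to `a i < b i`.
  set a := Function.extend φ (fun c => sInf (c : Set ℝ)) (fun _ => 0) with ha
  set b := Function.extend φ (fun c => sSup (c : Set ℝ)) (fun _ => 0) with hb
  have hin : ∀ c : 𝒞, a (φ c) = sInf (c : Set ℝ) ∧ b (φ c) = sSup (c : Set ℝ) := fun c =>
    ⟨hφ.extend_apply _ _ c, hφ.extend_apply _ _ c⟩
  have hout : ∀ i, (¬ ∃ c, φ c = i) → a i = 0 ∧ b i = 0 := fun i hi =>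
    ⟨Function.extend_apply' _ _ _ hi, Function.extend_apply' _ _ _ hi⟩
  have hI : ∀ c : 𝒞, Ioo (a (φ c)) (b (φ c)) = c := fun c => by
    rw [(hin c).1, (hin c).2]
    exact (hIoo c c.2).2.symm
  refine ⟨a, b, fun i => ?_, fun i j hij => ?_, ?_, fun i hi => ?_⟩
  · by_cases h : ∃ c, φ c = i
    · obtain ⟨c, rfl⟩ := h
      rw [(hin c).1, (hin c).2]
      exact (hIoo c c.2).1.le
    · rw [(hout i h).1, (hout i h).2]
  · rw [Function.onFun]
    by_cases h : ∃ c, φ c = i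
    swap
    · simp [hout i h]
    by_cases h' : ∃ c, φ c = j
    swap
    · simp [hout j h']
    obtain ⟨c, rfl⟩ := h
    obtain ⟨c', rfl⟩ := h'
    rw [hI, hI]
    exact hdisj c.2 c'.2 fun h => hij (by rw [Subtype.ext h])
  · ext x
    rw [mem_iUnion]
    constructor
    · intro hx
      refine ⟨φ ⟨_, mem_image_of_mem _ hx⟩, ?_⟩
      rw [hI]
      exact mem_connectedComponentIn hx
    · rintro ⟨i, hi⟩
      by_cases h : ∃ c, φ c = i
      · obtain ⟨c, rfl⟩ := h
        rw [hI] at hi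
        exact hsubU c c.2 hi
      · simp [hout i h] at hi
  · by_cases h : ∃ c, φ c = i
    · obtain ⟨c, rfl⟩ := h
      have hIc := hI c
      constructor
      · refine hend c c.2 _ (by rw [← hIc]; simp) fun ε hε => ?_
        rw [← hIc]
        set α := a (φ c)
        set β := b (φ c)
        have h1 : 0 < min ε (β - α) := lt_min hε (by linarith)
        have h2 := min_le_left ε (β - α)
        have h3 := min_le_right ε (β - α)
        refine ⟨α + min ε (β - α) / 2, ⟨by linarith, by linarith⟩, ?_⟩
        rw [abs_lt]
        constructor <;> linarith
      · refine hend c c.2 _ (by rw [← hIc]; simp) fun ε hε => ?_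
        rw [← hIc]
        set α := a (φ c)
        set β := b (φ c)
        have h1 : 0 < min ε (β - α) := lt_min hε (by linarith)
        have h2 := min_le_left ε (β - α)
        have h3 := min_le_right ε (β - α)
        refine ⟨β - min ε (β - α) / 2, ⟨by linarith, by linarith⟩, ?_⟩
        rw [abs_lt]
        constructor <;> linarith
    · simp [hout i h] at hi

/-- The `A_1` condition for a measure on the line, in integrated form. -/
def A1Measure (W : Measure ℝ) (A : ℝ≥0) : Prop :=
  ∀ a b c d : ℝ, Ioo c d ⊆ Ioo a b → ∀ F : ℝ → ℝ≥0∞, Measurable F →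
    W (Ioo a b) * ∫⁻ y in Ioo c d, F y ≤ A * ENNReal.ofReal (b - a) * ∫⁻ y in Ioo c d, F y ∂W

/-- Lebesgue measure is the case w = 1, so the unweighted estimates needed for the sparse
construction are instances of the weighted ones. -/
lemma a1Measure_volume : A1Measure volume 1 := by
  intro a b c d _ F _
  rw [Real.volume_Ioo, ENNReal.coe_one, one_mul]

/-- The set where the uncentered maximal function of `F` exceeds `l`. -/
def czSet (F : ℝ → ℝ≥0∞) (l : ℝ≥0∞) : Set ℝ :=
  {x | ∃ a b, a < x ∧ x < b ∧ l * ENNReal.ofReal (b - a) < ∫⁻ y in Ioo a b, F y}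

variable {F : ℝ → ℝ≥0∞} {l : ℝ≥0∞}

lemma isOpen_czSet : IsOpen (czSet F l) := by
  have : czSet F l = ⋃ (a : ℝ) (b : ℝ)
      (_ : l * ENNReal.ofReal (b - a) < ∫⁻ y in Ioo a b, F y), Ioo a b := by
    ext x
    simp only [czSet, mem_iUnion, mem_Ioo, exists_prop]
    constructor
    · rintro ⟨a, b, h1, h2, h3⟩
      exact ⟨a, b, h3, h1, h2⟩
    · rintro ⟨a, b, h3, h1, h2⟩
      exact ⟨a, b, h1, h2, h3⟩
  rw [this]
  exact isOpen_iUnion fun a => isOpen_iUnion fun b => isOpen_iUnion fun _ => isOpen_Ioo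

/-- The point may be an endpoint: enlarge the interval by ε on both sides and let ε tend to 0.
Applied at the endpoints of components, this bounds the averages over the Calderón–Zygmund intervals
by l, with no loss of a constant. -/
lemma lintegral_le_of_notMem_czSet (hl : l ≠ ∞) {x a b : ℝ} (hx : x ∉ czSet F l) (ha : a ≤ x)
    (hb : x ≤ b) : ∫⁻ y in Ioo a b, F y ≤ l * ENNReal.ofReal (b - a) := by
  have h : ∀ ε : ℝ, 0 < ε → ∫⁻ y in Ioo a b, F y ≤ l * ENNReal.ofReal (b - a + 2 * ε) := by
    intro ε hε
    have h1 : ¬ l * ENNReal.ofReal ((b + ε) - (a - ε)) < ∫⁻ y in Ioo (a - ε) (b + ε), F y :=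
      fun h => hx ⟨a - ε, b + ε, by linarith, by linarith, h⟩
    rw [not_lt, show (b + ε) - (a - ε) = b - a + 2 * ε by ring] at h1
    exact (lintegral_mono_set (Ioo_subset_Ioo (by linarith) (by linarith))).trans h1
  have hlim : Tendsto (fun ε : ℝ => l * ENNReal.ofReal (b - a + 2 * ε)) (𝓝[>] 0)
      (𝓝 (l * ENNReal.ofReal (b - a))) := by
    have h1 : Tendsto (fun ε : ℝ => b - a + 2 * ε) (𝓝[>] 0) (𝓝 (b - a)) := by
      have : ContinuousAt (fun ε : ℝ => b - a + 2 * ε) 0 := by fun_prop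
      have h2 := this.tendsto
      simp only [mul_zero, add_zero] at h2
      exact h2.mono_left nhdsWithin_le_nhds
    exact ENNReal.Tendsto.const_mul (ENNReal.tendsto_ofReal h1) (Or.inr hl)
  refine ge_of_tendsto hlim ?_
  filter_upwards [self_mem_nhdsWithin] with ε hε
  exact h ε hε

lemma ae_le_of_notMem_czSet (hF : Measurable F) (hFi : ∫⁻ y, F y ≠ ∞) (hl : l ≠ ∞) :
    ∀ᵐ x, x ∉ czSet F l → F x ≤ l := by
  have h := (Besicovitch.vitaliFamily (volume : Measure ℝ)).ae_tendsto_lintegral_div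
    hF.aemeasurable hFi
  filter_upwards [h] with x hx hxcz
  have h1 := hx.comp (Besicovitch.tendsto_filterAt volume x)
  refine le_of_tendsto h1 ?_
  filter_upwards [self_mem_nhdsWithin] with r hr
  have hr' : 0 < r := hr
  simp only [Function.comp]
  rw [Real.closedBall_eq_Icc, setLIntegral_congr Ioo_ae_eq_Icc.symm, Real.volume_Icc]
  refine ENNReal.div_le_of_le_mul ?_
  exact lintegral_le_of_notMem_czSet hl hxcz (by linarith) (by linarith)

/-- The weak type bound for the maximal function with respect to an `A_1` measure. -/
lemma mul_measure_czSet_le {W : Measure ℝ} {A : ℝ≥0} (hW : A1Measure W A) (hF : Measurable F)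
    (hFi : ∫⁻ y, F y ≠ ∞) (hl0 : l ≠ 0) (hl : l ≠ ∞) :
    l * W (czSet F l) ≤ 6 * A * ∫⁻ y, F y ∂W := by
  set t : Set (ℝ × ℝ) :=
    {p | p.1 < p.2 ∧ l * ENNReal.ofReal (p.2 - p.1) < ∫⁻ y in Ioo p.1 p.2, F y} with ht
  have hR : ∀ p ∈ t, (p.2 - p.1) / 2 ≤ ((∫⁻ y, F y) / l).toReal := by
    rintro p ⟨hp1, hp2⟩
    have h1 : l * ENNReal.ofReal (p.2 - p.1) ≤ ∫⁻ y, F y :=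
      hp2.le.trans (setLIntegral_le_lintegral _ _)
    have h2 : ENNReal.ofReal (p.2 - p.1) ≤ (∫⁻ y, F y) / l := by
      rw [ENNReal.le_div_iff_mul_le (Or.inl hl0) (Or.inl hl), mul_comm]
      exact h1
    rw [ENNReal.ofReal_le_iff_le_toReal (ENNReal.div_ne_top hFi hl0)] at h2
    linarith
  obtain ⟨u, hut, hdisj, hcov⟩ := Vitali.exists_disjoint_subfamily_covering_enlargement_closedBall t
    (fun p => (p.1 + p.2) / 2) (fun p => (p.2 - p.1) / 2) _ hR 5 (by norm_num)
  have hball : ∀ p : ℝ × ℝ, Metric.closedBall ((p.1 + p.2) / 2) ((p.2 - p.1) / 2) =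
      Icc p.1 p.2 := fun p => by
    rw [Real.closedBall_eq_Icc]
    congr 1 <;> ring
  simp_rw [hball] at hdisj hcov
  have hucount : u.Countable := by
    refine hdisj.countable_of_nonempty_interior fun p hp => ?_
    rw [interior_Icc, nonempty_Ioo]
    exact (hut hp).1
  -- The Vitali enlargement has radius 5/2 of the length; the radius 3 allows open intervals, and
  -- the total length 6 is the constant in the statement.
  set J := fun p : ℝ × ℝ => Ioo ((p.1 + p.2) / 2 - 3 * (p.2 - p.1))
    ((p.1 + p.2) / 2 + 3 * (p.2 - p.1)) with hJ
  have hsub : czSet F l ⊆ ⋃ p ∈ u, J p := by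
    rintro x ⟨a, b, h1, h2, h3⟩
    obtain ⟨p, hp, hsub⟩ := hcov (a, b) ⟨h1.trans h2, h3⟩
    have hx := hsub ⟨h1.le, h2.le⟩
    have hp' := (hut hp).1
    rw [Real.closedBall_eq_Icc] at hx
    refine mem_iUnion₂.2 ⟨p, hp, ?_, ?_⟩
    · linarith [hx.1]
    · linarith [hx.2]
  have hJle : ∀ p ∈ u, l * W (J p) ≤ 6 * A * ∫⁻ y in Ioo p.1 p.2, F y ∂W := fun p hp => by
    obtain ⟨hp1, hp2⟩ := hut hp
    have h1 := hW ((p.1 + p.2) / 2 - 3 * (p.2 - p.1)) ((p.1 + p.2) / 2 + 3 * (p.2 - p.1)) p.1 p.2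
      (Ioo_subset_Ioo (by linarith) (by linarith)) F hF
    have h2 : W (J p) * (l * ENNReal.ofReal (p.2 - p.1)) ≤
        A * ENNReal.ofReal (6 * (p.2 - p.1)) * ∫⁻ y in Ioo p.1 p.2, F y ∂W := by
      refine le_trans ?_ (h1.trans (le_of_eq ?_))
      · gcongr
      · congr 3
        ring
    rw [ENNReal.ofReal_mul (by norm_num), ENNReal.ofReal_ofNat] at h2
    have hpos : ENNReal.ofReal (p.2 - p.1) ≠ 0 := by
      rw [Ne, ENNReal.ofReal_eq_zero, not_le]
      linarith
    refine (ENNReal.mul_le_mul_iff_right hpos ENNReal.ofReal_ne_top).1 ?_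
    calc _ = W (J p) * (l * ENNReal.ofReal (p.2 - p.1)) := by ring
      _ ≤ _ := h2
      _ = _ := by ring
  have : Countable u := hucount
  calc l * W (czSet F l) ≤ l * ∑' p : u, W (J p) := by
        gcongr
        refine (measure_mono hsub).trans ?_
        rw [biUnion_eq_iUnion]
        exact measure_iUnion_le _
    _ = ∑' p : u, l * W (J p) := ENNReal.tsum_mul_left.symm
    _ ≤ ∑' p : u, 6 * A * ∫⁻ y in Ioo p.1.1 p.1.2, F y ∂W :=
        ENNReal.tsum_le_tsum fun p => hJle p p.2
    _ = 6 * A * ∫⁻ y in ⋃ p : u, Ioo p.1.1 p.1.2, F y ∂W := by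
        rw [ENNReal.tsum_mul_left, lintegral_iUnion fun p => measurableSet_Ioo]
        intro p p' hpp
        exact (hdisj p.2 p'.2 (fun h => hpp (Subtype.ext h))).mono Ioo_subset_Icc_self
          Ioo_subset_Icc_self
    _ ≤ _ := by
        gcongr
        exact Measure.restrict_le_self

/-- Integrals of `|x - c|^{-s}` with respect to measures of linear growth. -/
lemma exists_lintegral_rpow_le {s : ℝ} (hs : 1 < s) : ∃ D : ℝ≥0, ∀ (ν : Measure ℝ) (c ℓ : ℝ)
    (A : ℝ≥0∞), 0 < ℓ → (∀ R, ℓ ≤ R → ν (Ioo (c - R) (c + R)) ≤ A * ENNReal.ofReal R) →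
    ∫⁻ x in {x | ℓ ≤ |x - c|}, ENNReal.ofReal (|x - c| ^ (-s)) ∂ν ≤
      D * A * ENNReal.ofReal (ℓ ^ (1 - s)) := by
  set r := ENNReal.ofReal (2 ^ (1 - s)) with hr
  have hr1 : r < 1 := by
    rw [hr, ENNReal.ofReal_lt_one]
    exact Real.rpow_lt_one_of_one_lt_of_neg one_lt_two (by linarith)
  have hD : 2 * (1 - r)⁻¹ ≠ ∞ := by
    refine ENNReal.mul_ne_top ENNReal.ofNat_ne_top ?_
    rw [Ne, ENNReal.inv_eq_top, tsub_eq_zero_iff_le, not_le]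
    exact hr1
  refine ⟨(2 * (1 - r)⁻¹).toNNReal, fun ν c ℓ A hℓ hA => ?_⟩
  rw [ENNReal.coe_toNNReal hD]
  -- Dyadic annuli: linear growth of ν against the power -s leaves a geometric series of ratio
  -- 2^(1-s) < 1.
  set S := fun n : ℕ => {x : ℝ | 2 ^ n * ℓ ≤ |x - c| ∧ |x - c| < 2 ^ (n + 1) * ℓ} with hS
  have hcov : {x | ℓ ≤ |x - c|} ⊆ ⋃ n, S n := fun x hx => by
    have hx' : 1 ≤ |x - c| / ℓ := (one_le_div hℓ).2 hx
    obtain ⟨n, h1, h2⟩ := exists_nat_pow_near hx' one_lt_two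
    exact mem_iUnion.2 ⟨n, (le_div_iff₀ hℓ).1 h1, (div_lt_iff₀ hℓ).1 h2⟩
  have hSn : ∀ n, ∫⁻ x in S n, ENNReal.ofReal (|x - c| ^ (-s)) ∂ν ≤
      2 * A * ENNReal.ofReal (ℓ ^ (1 - s)) * r ^ n := fun n => by
    have hpos : 0 < 2 ^ n * ℓ := by positivity
    have hSm : MeasurableSet (S n) :=
      (by fun_prop : Measurable fun x : ℝ => |x - c|) measurableSet_Ico
    calc _ ≤ ∫⁻ _ in S n, ENNReal.ofReal ((2 ^ n * ℓ) ^ (-s)) ∂ν := by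
          refine setLIntegral_mono measurable_const fun x hx => ?_
          refine ENNReal.ofReal_le_ofReal ?_
          exact Real.rpow_le_rpow_of_nonpos hpos hx.1 (by linarith)
      _ = ENNReal.ofReal ((2 ^ n * ℓ) ^ (-s)) * ν (S n) := setLIntegral_const _ _
      _ ≤ ENNReal.ofReal ((2 ^ n * ℓ) ^ (-s)) * (A * ENNReal.ofReal (2 ^ (n + 1) * ℓ)) := by
          gcongr
          refine (measure_mono fun x hx => ?_).trans (hA (2 ^ (n + 1) * ℓ) ?_)
          · have := abs_lt.1 hx.2
            constructor <;> linarith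
          · exact le_mul_of_one_le_left hℓ.le (one_le_pow₀ one_le_two)
      _ = 2 * A * ENNReal.ofReal (ℓ ^ (1 - s)) * r ^ n := by
          rw [hr, ← ENNReal.ofReal_pow (by positivity)]
          have e : (2 ^ n * ℓ) ^ (-s) * (2 ^ (n + 1) * ℓ) = 2 * (ℓ ^ (1 - s) * (2 ^ (1 - s)) ^ n) := by
            have e1 : (2 ^ (n + 1) * ℓ : ℝ) = 2 * (2 ^ n * ℓ) ^ (1 : ℝ) := by
              rw [Real.rpow_one]
              ring
            rw [e1, mul_left_comm, ← Real.rpow_add hpos, neg_add_eq_sub,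
              Real.mul_rpow (by positivity) hℓ.le, ← Real.rpow_natCast, ← Real.rpow_mul zero_le_two,
              ← Real.rpow_natCast, ← Real.rpow_mul zero_le_two, mul_comm (n : ℝ)]
            ring
          calc _ = A * (ENNReal.ofReal ((2 ^ n * ℓ) ^ (-s)) * ENNReal.ofReal (2 ^ (n + 1) * ℓ)) := by
                ring
            _ = _ := by
                rw [← ENNReal.ofReal_mul (by positivity), e, ENNReal.ofReal_mul zero_le_two,
                  ENNReal.ofReal_mul (by positivity), ENNReal.ofReal_ofNat]
                ring
  calc _ ≤ ∫⁻ x in ⋃ n, S n, ENNReal.ofReal (|x - c| ^ (-s)) ∂ν := lintegral_mono_set hcov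
    _ ≤ ∑' n, ∫⁻ x in S n, ENNReal.ofReal (|x - c| ^ (-s)) ∂ν := lintegral_iUnion_le _ _
    _ ≤ ∑' n, 2 * A * ENNReal.ofReal (ℓ ^ (1 - s)) * r ^ n := ENNReal.tsum_le_tsum hSn
    _ = _ := by
        rw [ENNReal.tsum_mul_left, ENNReal.tsum_geometric]
        ring

end RealLine

end VqCZ

end

/-! ### The `ℓ^ρ`-valued operator. -/

noncomputable section

namespace VqCZ

/-- The `ℓ^ρ`-valued variation operator. -/
def vecOp (K : ℝ → ℝ → ℂ) (q ρ : ℝ) (f : ℕ → ℝ → ℂ) (x : ℝ) : ℝ≥0∞ :=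
  lpn ρ fun k => variationOp K q (f k) x

/-- The pointwise `ℓ^ρ` norm of a sequence of functions. -/
def vecNorm (ρ : ℝ) (f : ℕ → ℝ → ℂ) (x : ℝ) : ℝ≥0∞ := lpn ρ fun k => ‖f k x‖ₑ

/-- Boundedness of the scalar variation operator on `L^ρ(W)`. -/
def StrongBound (K : ℝ → ℝ → ℂ) (q ρ : ℝ) (W : Measure ℝ) : Prop :=
  ∃ B : ℝ≥0, ∀ f : ℝ → ℂ, Admissible f →
    ∫⁻ x, variationOp K q f x ^ ρ ∂W ≤ B * ∫⁻ x, ‖f x‖ₑ ^ ρ ∂W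

/-- The intervals `(a i, b i)` are the components of the level set of the maximal function. -/
structure IsCZ (F : ℝ → ℝ≥0∞) (l : ℝ≥0∞) (a b : ℕ → ℝ) : Prop where
  le : ∀ i, a i ≤ b i
  disj : Pairwise (Function.onFun Disjoint fun i => Ioo (a i) (b i))
  eq : czSet F l = ⋃ i, Ioo (a i) (b i)
  not_mem : ∀ i, a i < b i → a i ∉ czSet F l ∧ b i ∉ czSet F l

section Vector

open Filter Topology

variable {K : ℝ → ℝ → ℂ} {δ C q ρ : ℝ} {f g : ℕ → ℝ → ℂ}

lemma measurable_vecNorm (hf : ∀ k, Measurable (f k)) : Measurable (vecNorm ρ f) :=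
  measurable_lpn fun k => (hf k).enorm

lemma measurable_vecOp (hK : KernelBounds K δ C) (hf : ∀ k, Admissible (f k)) (hq : 0 < q) :
    Measurable (vecOp K q ρ f) :=
  measurable_lpn fun k => measurable_variationOp hK (hf k) hq

lemma vecOp_add_le (hK : KernelBounds K δ C) (hf : ∀ k, Admissible (f k))
    (hg : ∀ k, Admissible (g k)) (hq : 1 ≤ q) (hρ : 1 ≤ ρ) (x : ℝ) :
    vecOp K q ρ (fun k y => f k y + g k y) x ≤ vecOp K q ρ f x + vecOp K q ρ g x := by
  refine (lpn_mono (by linarith) fun k => ?_).trans (lpn_add_le hρ _ _)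
  exact variationOp_add_le hK (hf k) (hg k) hq x

lemma admissible_of_vecNorm (hρ : 0 < ρ) (hf : ∀ k, Measurable (f k))
    (h : ∫⁻ y, vecNorm ρ f y ≠ ∞) (k : ℕ) : Admissible (f k) :=
  Admissible.of_lintegral (hf k) (ne_top_of_le_ne_top h
    (lintegral_mono fun y => le_lpn hρ (fun k => ‖f k y‖ₑ) k))

lemma lpn_weighted_lintegral_le (hρ : 1 ≤ ρ) (hf : ∀ k, Measurable (f k)) {φ : ℝ → ℝ≥0∞}
    (hφ : Measurable φ) (μ : Measure ℝ) :
    lpn ρ (fun k => ∫⁻ y, φ y * ‖f k y‖ₑ ∂μ) ≤ ∫⁻ y, φ y * vecNorm ρ f y ∂μ := by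
  exact (lpn_lintegral_le hρ fun k => (hφ.mul (hf k).enorm).aemeasurable).trans
    (lintegral_mono fun y => (lpn_const_mul (by linarith) _ _).le)

lemma lpn_lintegral_enorm_le (hρ : 1 ≤ ρ) (hf : ∀ k, Measurable (f k)) (μ : Measure ℝ) :
    lpn ρ (fun k => ∫⁻ y, ‖f k y‖ₑ ∂μ) ≤ ∫⁻ y, vecNorm ρ f y ∂μ :=
  lpn_lintegral_le hρ fun k => (hf k).enorm.aemeasurable

/-- Makes the boundary terms of the scalar estimates vector-valued: the inner norm over intervals
and the outer norm over k are exchanged, then Minkowski moves the norm over k inside the integral.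
-/
lemma lpn_lpn_const_mul_le (hρ : 1 ≤ ρ) (hq : 1 ≤ q) (hf : ∀ k, Measurable (f k))
    (c : ℕ → ℝ≥0∞) (μ : ℕ → Measure ℝ) :
    lpn ρ (fun k => lpn q (fun i => c i * ∫⁻ y, ‖f k y‖ₑ ∂(μ i))) ≤
      lpn (min q ρ) (fun i => c i * ∫⁻ y, vecNorm ρ f y ∂(μ i)) := by
  refine (lpn_comm_le hρ hq _).trans (lpn_mono (lt_min (by linarith) (by linarith)) fun i => ?_)
  rw [lpn_const_mul (by linarith)]
  gcongr
  exact lpn_lintegral_enorm_le hρ hf _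

lemma vecOp_far_le (hK : KernelBounds K δ C) (hf : ∀ k, Admissible (f k)) (hq : 1 ≤ q)
    (hρ : 1 ≤ ρ) {x ξ h : ℝ} (hh : 0 < h) (hxξ : |x - ξ| ≤ h) :
    vecOp K q ρ (fun k => {y | 4 * h < |x - y|}.indicator (f k)) ξ ≤ vecOp K q ρ f x +
      (∫⁻ y in {y | 4 * h < |x - y|},
        ENNReal.ofReal (C * h ^ δ * |x - y| ^ (-(1 + δ))) * vecNorm ρ f y) +
      16 * lpn (min q ρ) (fun m : ℕ => ENNReal.ofReal (2 * C / ((m + 4) * h)) *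
        ∫⁻ y in {y | (m + 4) * h < |x - y| ∧ |x - y| ≤ (m + 5) * h}, vecNorm ρ f y) := by
  have hρ0 : 0 < ρ := by linarith
  refine (lpn_mono hρ0 fun k => variationOp_far_le hK (hf k) hq hh hxξ).trans ?_
  refine (lpn_add_le hρ _ _).trans (add_le_add ((lpn_add_le hρ _ _).trans
    (add_le_add le_rfl ?_)) ?_)
  · exact lpn_weighted_lintegral_le hρ (fun k => (hf k).1) (by fun_prop) _
  · rw [lpn_const_mul hρ0]
    gcongr
    exact lpn_lpn_const_mul_le hρ hq (fun k => (hf k).1) _ _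

lemma vecOp_le_of_mean_zero (hK : KernelBounds K δ C) (hg : ∀ k, Measurable (g k))
    (hgi : ∫⁻ y, vecNorm ρ g y ≠ ∞) (hq : 1 ≤ q) (hρ : 1 ≤ ρ)
    {a b : ℕ → ℝ} (hab : ∀ i, a i ≤ b i)
    (hdisj : Pairwise (Function.onFun Disjoint fun i => Ioo (a i) (b i)))
    (hsupp : ∀ k y, y ∉ ⋃ i, Ioo (a i) (b i) → g k y = 0)
    (hmean : ∀ k i, ∫ y in Ioo (a i) (b i), g k y = 0) {x : ℝ}
    (hx : ∀ i, x ∉ Ioo (a i - (b i - a i)) (b i + (b i - a i))) :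
    vecOp K q ρ g x ≤
      ∑' i, ENNReal.ofReal (C * (b i - a i) ^ δ * |x - (a i + b i) / 2| ^ (-(1 + δ))) *
        (∫⁻ y in Ioo (a i) (b i), vecNorm ρ g y) +
      4 * lpn (min q ρ) (fun i => ENNReal.ofReal (4 * C * |x - (a i + b i) / 2|⁻¹) *
        ∫⁻ y in Ioo (a i) (b i), vecNorm ρ g y) := by
  have hρ0 : 0 < ρ := by linarith
  refine (lpn_mono hρ0 fun k => variationOp_le_of_mean_zero hK (hg k) (ne_top_of_le_ne_top hgi
    (lintegral_mono fun y => le_lpn hρ0 (fun k => ‖g k y‖ₑ) k)) hq hab hdisj (hsupp k)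
    (hmean k) hx).trans ?_
  refine (lpn_add_le hρ _ _).trans (add_le_add ?_ ?_)
  · refine (lpn_tsum_le hρ _).trans (ENNReal.tsum_le_tsum fun i => ?_)
    rw [lpn_const_mul hρ0]
    gcongr
    exact lpn_lintegral_enorm_le hρ hg _
  · rw [lpn_const_mul hρ0]
    gcongr
    exact lpn_lpn_const_mul_le hρ hq hg _ _

end Vector

/-! ### Calderón–Zygmund intervals and the sums `czTheta` and `czEta`. -/

section CZ

open Filter Topology

variable {F : ℝ → ℝ≥0∞} {l : ℝ≥0∞} {a b : ℕ → ℝ} {W : Measure ℝ} {A : ℝ≥0}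

lemma exists_isCZ (hF : Measurable F) (hFi : ∫⁻ y, F y ≠ ∞) (hl0 : l ≠ 0) (hl : l ≠ ∞) :
    ∃ a b, IsCZ F l a b := by
  have h := mul_measure_czSet_le a1Measure_volume hF hFi hl0 hl
  have hv : volume (czSet F l) ≠ ∞ := by
    intro htop
    rw [htop, ENNReal.mul_top hl0, top_le_iff] at h
    exact ENNReal.mul_ne_top (by norm_num) hFi h
  obtain ⟨a, b, h1, h2, h3, h4⟩ := exists_components isOpen_czSet hv
  exact ⟨a, b, h1, h2, h3, h4⟩

namespace IsCZ

lemma lintegral_le (h : IsCZ F l a b) (hl : l ≠ ∞) (i : ℕ) :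
    ∫⁻ y in Ioo (a i) (b i), F y ≤ l * ENNReal.ofReal (b i - a i) := by
  rcases (h.le i).eq_or_lt with h1 | h1
  · simp [h1]
  · exact lintegral_le_of_notMem_czSet hl (h.not_mem i h1).1 le_rfl h1.le

lemma tsum_lintegral (h : IsCZ F l a b) :
    ∑' i, ∫⁻ y in Ioo (a i) (b i), F y ∂W = ∫⁻ y in czSet F l, F y ∂W := by
  rw [h.eq, lintegral_iUnion (fun i => measurableSet_Ioo) h.disj]

/-- The `A_1` condition tested on the constant 1 shows that tripling an interval multiplies its
measure by at most 3A; the weak type bound for the maximal function contributes the factor 6A. -/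
lemma mul_measure_enlarged_le (h : IsCZ F l a b) (hW : A1Measure W A) (hF : Measurable F)
    (hFi : ∫⁻ y, F y ≠ ∞) (hl0 : l ≠ 0) (hl : l ≠ ∞) :
    l * W (⋃ i, Ioo (a i - (b i - a i)) (b i + (b i - a i))) ≤
      18 * A ^ 2 * ∫⁻ y, F y ∂W := by
  have h1 : ∀ i, W (Ioo (a i - (b i - a i)) (b i + (b i - a i))) ≤
      3 * A * W (Ioo (a i) (b i)) := fun i => by
    rcases (h.le i).eq_or_lt with h2 | h2
    · simp [h2]
    have h3 := hW (a i - (b i - a i)) (b i + (b i - a i)) (a i) (b i)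
      (Ioo_subset_Ioo (by linarith) (by linarith)) (fun _ => 1) measurable_const
    simp only [lintegral_const, one_mul, Measure.restrict_apply_univ, Real.volume_Ioo] at h3
    rw [show b i + (b i - a i) - (a i - (b i - a i)) = 3 * (b i - a i) by ring,
      ENNReal.ofReal_mul (by norm_num), ENNReal.ofReal_ofNat] at h3
    have hpos : ENNReal.ofReal (b i - a i) ≠ 0 := by
      rw [Ne, ENNReal.ofReal_eq_zero, not_le]
      linarith
    refine (ENNReal.mul_le_mul_iff_left hpos ENNReal.ofReal_ne_top).1 (h3.trans (le_of_eq ?_))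
    ring
  calc _ ≤ l * ∑' i, 3 * A * W (Ioo (a i) (b i)) := by
        gcongr
        exact (measure_iUnion_le _).trans (ENNReal.tsum_le_tsum h1)
    _ = 3 * A * (l * W (czSet F l)) := by
        rw [ENNReal.tsum_mul_left, h.eq, measure_iUnion h.disj fun i => measurableSet_Ioo]
        ring
    _ ≤ 3 * A * (6 * A * ∫⁻ y, F y ∂W) := by
        gcongr (3 * A * ?_)
        exact mul_measure_czSet_le hW hF hFi hl0 hl
    _ = _ := by ring

/-- Integrals of powers of the distance from a component outside of its neighbourhood. -/
lemma exists_tail_le {s : ℝ} (hs : 1 < s) (hW : A1Measure W A) : ∃ D : ℝ≥0,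
    ∀ (F : ℝ → ℝ≥0∞) (l : ℝ≥0∞) (a b : ℕ → ℝ), IsCZ F l a b → Measurable F →
    l ≠ ∞ → ∀ i, (∫⁻ y in Ioo (a i) (b i), F y) *
      ∫⁻ x in (Ioo (a i - (b i - a i)) (b i + (b i - a i)))ᶜ,
        ENNReal.ofReal (|x - (a i + b i) / 2| ^ (-s)) ∂W ≤
      D * (∫⁻ y in Ioo (a i) (b i), F y ∂W) * ENNReal.ofReal ((b i - a i) ^ (1 - s)) := by
  obtain ⟨D, hD⟩ := exists_lintegral_rpow_le hs
  refine ⟨D * (2 * A), fun F l a b h hF hl i => ?_⟩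
  rcases (h.le i).eq_or_lt with h2 | h2
  · simp [h2]
  set β := ∫⁻ y in Ioo (a i) (b i), F y with hβ
  rcases eq_or_ne β 0 with h0 | h0
  · rw [h0, zero_mul]
    exact zero_le
  have hβt : β ≠ ∞ := ne_top_of_le_ne_top (ENNReal.mul_ne_top hl ENNReal.ofReal_ne_top)
    (h.lintegral_le hl i)
  set β' := ∫⁻ y in Ioo (a i) (b i), F y ∂W
  -- The `A_1` condition is read as linear growth of `W` around the interval, with growth constant
  -- 2Aβ'/β. This choice turns the Lebesgue mass β on the left into the weighted mass β' on the
  -- right.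
  have h3 := hD W ((a i + b i) / 2) (b i - a i) (2 * A * β' / β) (by linarith) fun R hR => by
    have h4 := hW ((a i + b i) / 2 - R) ((a i + b i) / 2 + R) (a i) (b i)
      (Ioo_subset_Ioo (by linarith) (by linarith)) F hF
    rw [show (a i + b i) / 2 + R - ((a i + b i) / 2 - R) = 2 * R by ring,
      ENNReal.ofReal_mul zero_le_two, ENNReal.ofReal_ofNat] at h4
    rw [ENNReal.mul_div_right_comm, ← ENNReal.mul_div_right_comm, mul_comm,
      ← mul_div_assoc, ENNReal.le_div_iff_mul_le (Or.inl h0) (Or.inl hβt)]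
    refine h4.trans (le_of_eq ?_)
    ring
  have hsub : (Ioo (a i - (b i - a i)) (b i + (b i - a i)))ᶜ ⊆
      {x | b i - a i ≤ |x - (a i + b i) / 2|} := fun x hx => by
    simp only [mem_compl_iff, mem_Ioo, not_and_or, not_lt] at hx
    change b i - a i ≤ |x - (a i + b i) / 2|
    rcases hx with hx | hx
    · exact le_abs.2 (Or.inr (by linarith))
    · exact le_abs.2 (Or.inl (by linarith))
  calc _ ≤ β * (D * (2 * A * β' / β) * ENNReal.ofReal ((b i - a i) ^ (1 - s))) := by
        gcongr
        exact (lintegral_mono_set hsub).trans h3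
    _ = D * (2 * A) * (β / β) * β' * ENNReal.ofReal ((b i - a i) ^ (1 - s)) := by
        simp only [div_eq_mul_inv]
        ring
    _ = _ := by
        rw [ENNReal.div_self h0 hβt, mul_one]
        push_cast
        ring

end IsCZ

/-- The sums controlling the oscillation of the kernel. -/
def czTheta (F : ℝ → ℝ≥0∞) (δ : ℝ) (a b : ℕ → ℝ) (x : ℝ) : ℝ≥0∞ :=
  ∑' i, ENNReal.ofReal ((b i - a i) ^ δ * |x - (a i + b i) / 2| ^ (-(1 + δ))) *
    ∫⁻ y in Ioo (a i) (b i), F y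

/-- The sums controlling the boundary terms. -/
def czEta (F : ℝ → ℝ≥0∞) (r : ℝ) (a b : ℕ → ℝ) (x : ℝ) : ℝ≥0∞ :=
  ∑' i, (ENNReal.ofReal (|x - (a i + b i) / 2|⁻¹) * ∫⁻ y in Ioo (a i) (b i), F y) ^ r

/-- The union of the enlarged intervals. -/
def czStar (a b : ℕ → ℝ) : Set ℝ := ⋃ i, Ioo (a i - (b i - a i)) (b i + (b i - a i))

lemma czStar_compl_subset (i : ℕ) :
    (czStar a b)ᶜ ⊆ (Ioo (a i - (b i - a i)) (b i + (b i - a i)))ᶜ :=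
  compl_subset_compl.2 (subset_iUnion (fun i => Ioo (a i - (b i - a i)) (b i + (b i - a i))) i)

/-- Chebyshev, then the tail estimate with exponent 1 + δ term by term; the powers of the interval
lengths cancel. -/
lemma exists_mul_measure_czTheta_le {δ : ℝ} (hδ : 0 < δ) (hW : A1Measure W A) : ∃ D : ℝ≥0,
    ∀ (F : ℝ → ℝ≥0∞) (l : ℝ≥0∞) (a b : ℕ → ℝ), IsCZ F l a b → Measurable F → l ≠ ∞ →
    l * W ({x | l < czTheta F δ a b x} \ czStar a b) ≤ D * ∫⁻ y, F y ∂W := by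
  obtain ⟨D, hD⟩ := IsCZ.exists_tail_le (s := 1 + δ) (by linarith) hW
  refine ⟨D, fun F l a b h hF hl => ?_⟩
  have hm : Measurable (czTheta F δ a b) := by
    refine Measurable.tsum fun i => ?_
    fun_prop
  have hS : MeasurableSet {x | l < czTheta F δ a b x} := measurableSet_lt measurable_const hm
  calc _ = ∫⁻ _ in {x | l < czTheta F δ a b x} \ czStar a b, l ∂W := by
        rw [setLIntegral_const]
    _ ≤ ∫⁻ x in {x | l < czTheta F δ a b x} \ czStar a b, czTheta F δ a b x ∂W :=
        setLIntegral_mono hm fun x hx => (show l < _ from hx.1).le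
    _ ≤ ∫⁻ x in (czStar a b)ᶜ, czTheta F δ a b x ∂W := lintegral_mono_set fun x hx => hx.2
    _ = ∑' i, ∫⁻ x in (czStar a b)ᶜ, ENNReal.ofReal ((b i - a i) ^ δ *
          |x - (a i + b i) / 2| ^ (-(1 + δ))) * (∫⁻ y in Ioo (a i) (b i), F y) ∂W := by
        unfold czTheta
        rw [lintegral_tsum]
        intro i
        fun_prop
    _ ≤ ∑' i, D * ∫⁻ y in Ioo (a i) (b i), F y ∂W := by
        refine ENNReal.tsum_le_tsum fun i => ?_
        rcases (h.le i).eq_or_lt with h2 | h2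
        · simp [h2]
        have hℓ : 0 < b i - a i := by linarith
        have h1 := hD F l a b h hF hl i
        simp_rw [ENNReal.ofReal_mul (Real.rpow_nonneg hℓ.le δ), mul_assoc]
        rw [lintegral_const_mul' _ _ ENNReal.ofReal_ne_top, lintegral_mul_const _ (by fun_prop)]
        calc _ ≤ ENNReal.ofReal ((b i - a i) ^ δ) * (D * (∫⁻ y in Ioo (a i) (b i), F y ∂W) *
              ENNReal.ofReal ((b i - a i) ^ (1 - (1 + δ)))) := by
              refine mul_le_mul' le_rfl ((mul_comm _ _).le.trans (le_trans ?_ h1))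
              exact mul_le_mul' le_rfl (lintegral_mono_set (czStar_compl_subset i))
          _ = D * (∫⁻ y in Ioo (a i) (b i), F y ∂W) * (ENNReal.ofReal ((b i - a i) ^ δ) *
              ENNReal.ofReal ((b i - a i) ^ (1 - (1 + δ)))) := by ring
          _ = _ := by
              rw [← ENNReal.ofReal_mul (by positivity), ← Real.rpow_add hℓ]
              simp
    _ ≤ _ := by
        rw [ENNReal.tsum_mul_left, h.tsum_lintegral]
        gcongr
        exact Measure.restrict_le_self

/-- Chebyshev at height l^r. Of the factor β^r one power enters the tail estimate, and β ≤
l·(length) converts the remaining r - 1 powers into l^(r-1), which cancels against the height. -/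
lemma exists_mul_measure_czEta_le {r : ℝ} (hr : 1 < r) (hW : A1Measure W A) : ∃ D : ℝ≥0,
    ∀ (F : ℝ → ℝ≥0∞) (l : ℝ≥0∞) (a b : ℕ → ℝ), IsCZ F l a b → Measurable F → l ≠ 0 → l ≠ ∞ →
    l * W ({x | l ^ r < czEta F r a b x} \ czStar a b) ≤ D * ∫⁻ y, F y ∂W := by
  obtain ⟨D, hD⟩ := IsCZ.exists_tail_le hr hW
  refine ⟨D, fun F l a b h hF hl0 hl => ?_⟩
  have hm : Measurable (czEta F r a b) := by
    refine Measurable.tsum fun i => ?_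
    fun_prop
  set S := {x | l ^ r < czEta F r a b x} \ czStar a b
  have hr0 : 0 < r := by linarith
  have key : l ^ r * W S ≤ l ^ (r - 1) * (D * ∫⁻ y, F y ∂W) := by
    calc _ = ∫⁻ _ in S, l ^ r ∂W := by rw [setLIntegral_const]
      _ ≤ ∫⁻ x in S, czEta F r a b x ∂W :=
          setLIntegral_mono hm fun x hx => (show l ^ r < _ from hx.1).le
      _ ≤ ∫⁻ x in (czStar a b)ᶜ, czEta F r a b x ∂W := lintegral_mono_set fun x hx => hx.2
      _ = ∑' i, ∫⁻ x in (czStar a b)ᶜ, (ENNReal.ofReal (|x - (a i + b i) / 2|⁻¹) *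
            ∫⁻ y in Ioo (a i) (b i), F y) ^ r ∂W := by
          unfold czEta
          rw [lintegral_tsum]
          intro i
          fun_prop
      _ ≤ ∑' i, l ^ (r - 1) * (D * ∫⁻ y in Ioo (a i) (b i), F y ∂W) := by
          refine ENNReal.tsum_le_tsum fun i => ?_
          rcases (h.le i).eq_or_lt with h2 | h2
          · simp [h2, hr0]
          have hℓ : 0 < b i - a i := by linarith
          have h1 := hD F l a b h hF hl i
          have hβl := h.lintegral_le hl i
          set β := ∫⁻ y in Ioo (a i) (b i), F y with hβ
          have hβt : β ≠ ∞ := ne_top_of_le_ne_top (ENNReal.mul_ne_top hl ENNReal.ofReal_ne_top) hβl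
          have e1 : ∀ x : ℝ, (ENNReal.ofReal (|x - (a i + b i) / 2|⁻¹) * β) ^ r ≤
              β ^ (r - 1) * (β * ENNReal.ofReal (|x - (a i + b i) / 2| ^ (-r))) := fun x => by
            rw [ENNReal.mul_rpow_of_nonneg _ _ hr0.le,
              ENNReal.ofReal_rpow_of_nonneg (by positivity) hr0.le, ← mul_assoc]
            nth_rewrite 3 [← ENNReal.rpow_one β]
            rw [← ENNReal.rpow_add_of_nonneg _ _ (by linarith) zero_le_one, sub_add_cancel,
              Real.inv_rpow (abs_nonneg _), ← Real.rpow_neg (abs_nonneg _), mul_comm]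
          calc _ ≤ ∫⁻ x in (czStar a b)ᶜ,
                β ^ (r - 1) * (β * ENNReal.ofReal (|x - (a i + b i) / 2| ^ (-r))) ∂W :=
                lintegral_mono fun x => e1 x
            _ = β ^ (r - 1) * (β * ∫⁻ x in (czStar a b)ᶜ,
                  ENNReal.ofReal (|x - (a i + b i) / 2| ^ (-r)) ∂W) := by
                rw [lintegral_const_mul' _ _ (ENNReal.rpow_ne_top_of_nonneg (by linarith) hβt),
                  lintegral_const_mul' _ _ hβt]
            _ ≤ (l * ENNReal.ofReal (b i - a i)) ^ (r - 1) *
                  (D * (∫⁻ y in Ioo (a i) (b i), F y ∂W) *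
                  ENNReal.ofReal ((b i - a i) ^ (1 - r))) := by
                refine mul_le_mul' ?_ ?_
                · exact ENNReal.rpow_le_rpow hβl (by linarith)
                · refine le_trans ?_ h1
                  exact mul_le_mul' le_rfl (lintegral_mono_set (czStar_compl_subset i))
            _ = l ^ (r - 1) * (D * ∫⁻ y in Ioo (a i) (b i), F y ∂W) *
                  (ENNReal.ofReal ((b i - a i) ^ (r - 1)) *
                  ENNReal.ofReal ((b i - a i) ^ (1 - r))) := by
                rw [ENNReal.mul_rpow_of_nonneg _ _ (by linarith),
                  ENNReal.ofReal_rpow_of_nonneg hℓ.le (by linarith)]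
                ring
            _ = _ := by
                rw [← ENNReal.ofReal_mul (by positivity), ← Real.rpow_add hℓ]
                simp
      _ ≤ _ := by
          rw [ENNReal.tsum_mul_left, ENNReal.tsum_mul_left, h.tsum_lintegral]
          gcongr
          exact Measure.restrict_le_self
  have e : l ^ r = l ^ (r - 1) * l := by
    nth_rewrite 3 [← ENNReal.rpow_one l]
    rw [← ENNReal.rpow_add _ _ hl0 hl, sub_add_cancel]
  rw [e, mul_assoc] at key
  exact (ENNReal.mul_le_mul_iff_right (ENNReal.rpow_pos (pos_iff_ne_zero.2 hl0) hl).ne'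
    (ENNReal.rpow_ne_top_of_nonneg (by linarith) hl)).1 key

end CZ

end VqCZ

end

/-! ### The Calderón–Zygmund decomposition and the weak type bound. -/

noncomputable section

namespace VqCZ

/-- The average of `f` over `(a, b)`. -/
def ioAvg (f : ℝ → ℂ) (a b : ℝ) : ℂ := (b - a)⁻¹ • ∫ y in Ioo a b, f y

/-- The good part of the Calderón–Zygmund decomposition. -/
def czGood (a b : ℕ → ℝ) (f : ℝ → ℂ) (y : ℝ) : ℂ :=
  (⋃ i, Ioo (a i) (b i))ᶜ.indicator f y +
    ∑' i, (Ioo (a i) (b i)).indicator (fun _ => ioAvg f (a i) (b i)) y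

section Decomposition

open Filter Topology

variable {K : ℝ → ℝ → ℂ} {δ C q ρ : ℝ} {f : ℕ → ℝ → ℂ} {l : ℝ≥0∞} {a b : ℕ → ℝ}
  {W : Measure ℝ} {A : ℝ≥0}

lemma measurable_czGood {f : ℝ → ℂ} (hf : Measurable f) : Measurable (czGood a b f) := by
  refine Measurable.add (hf.indicator ?_) (Measurable.tsum fun i => ?_)
  · exact (MeasurableSet.iUnion fun i => measurableSet_Ioo).compl
  · exact measurable_const.indicator measurableSet_Ioo

lemma czGood_of_mem {f : ℝ → ℂ}
    (hdisj : Pairwise (Function.onFun Disjoint fun i => Ioo (a i) (b i))) {i : ℕ} {y : ℝ}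
    (hy : y ∈ Ioo (a i) (b i)) : czGood a b f y = ioAvg f (a i) (b i) := by
  rw [czGood, indicator_of_notMem, zero_add, tsum_eq_single i, indicator_of_mem hy]
  · intro j hj
    exact indicator_of_notMem (fun h => Set.disjoint_left.1 (hdisj hj) h hy) _
  · exact fun h => h (mem_iUnion.2 ⟨i, hy⟩)

lemma czGood_of_notMem {f : ℝ → ℂ} {y : ℝ} (hy : y ∉ ⋃ i, Ioo (a i) (b i)) :
    czGood a b f y = f y := by
  rw [czGood, indicator_of_mem hy]
  have : ∀ i, (Ioo (a i) (b i)).indicator (fun _ => ioAvg f (a i) (b i)) y = 0 := fun i =>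
    indicator_of_notMem (fun h => hy (mem_iUnion.2 ⟨i, h⟩)) _
  simp [this]

lemma lpn_ioAvg_le (hρ : 1 ≤ ρ) (hf : ∀ k, Measurable (f k)) {α β : ℝ} (h : α < β) :
    lpn ρ (fun k => ‖ioAvg (f k) α β‖ₑ) ≤
      (ENNReal.ofReal (β - α))⁻¹ * ∫⁻ y in Ioo α β, vecNorm ρ f y := by
  have hρ0 : 0 < ρ := by linarith
  have hpos : 0 < β - α := by linarith
  have h1 : ∀ k, ‖ioAvg (f k) α β‖ₑ ≤
      (ENNReal.ofReal (β - α))⁻¹ * ∫⁻ y in Ioo α β, ‖f k y‖ₑ := fun k => by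
    rw [ioAvg, enorm_smul, Real.enorm_of_nonneg (by positivity), ENNReal.ofReal_inv_of_pos hpos]
    gcongr
    exact enorm_integral_le_lintegral_enorm _
  refine (lpn_mono hρ0 h1).trans ?_
  rw [lpn_const_mul hρ0]
  gcongr
  exact lpn_lintegral_enorm_le hρ hf _

/-- On a component Minkowski bounds the norm of the averages by the average of the norm, which is at
most l. Elsewhere Lebesgue differentiation applies. -/
lemma vecNorm_czGood_le (hρ : 1 ≤ ρ) (hf : ∀ k, Measurable (f k)) (hl : l ≠ ∞)
    (hcz : IsCZ (vecNorm ρ f) l a b) (hF : ∫⁻ y, vecNorm ρ f y ≠ ∞) :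
    ∀ᵐ y, vecNorm ρ (fun k => czGood a b (f k)) y ≤ l := by
  filter_upwards [ae_le_of_notMem_czSet (measurable_vecNorm hf) hF hl] with y hy
  by_cases h : y ∈ czSet (vecNorm ρ f) l
  · rw [hcz.eq] at h
    obtain ⟨i, hi⟩ := mem_iUnion.1 h
    have hab : a i < b i := hi.1.trans hi.2
    have h1 : vecNorm ρ (fun k => czGood a b (f k)) y =
        lpn ρ (fun k => ‖ioAvg (f k) (a i) (b i)‖ₑ) := by
      simp only [vecNorm, czGood_of_mem hcz.disj hi]
    rw [h1]
    refine (lpn_ioAvg_le hρ hf hab).trans ?_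
    rw [mul_comm, ← div_eq_mul_inv]
    exact ENNReal.div_le_of_le_mul (hcz.lintegral_le hl i)
  · have h' := h
    rw [hcz.eq] at h
    have h1 : vecNorm ρ (fun k => czGood a b (f k)) y = vecNorm ρ f y := by
      simp only [vecNorm, czGood_of_notMem h]
    rw [h1]
    exact hy h'

/-- Averaging over a component increases the `W`-mass by at most the factor A, by the `A_1`
condition with both intervals equal to that component. -/
lemma lintegral_vecNorm_czGood_le (hρ : 1 ≤ ρ) (hf : ∀ k, Measurable (f k))
    (hcz : IsCZ (vecNorm ρ f) l a b) (hW : A1Measure W A) :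
    ∫⁻ y, vecNorm ρ (fun k => czGood a b (f k)) y ∂W ≤ (1 + A) * ∫⁻ y, vecNorm ρ f y ∂W := by
  set Ω := ⋃ i, Ioo (a i) (b i) with hΩ
  have hΩm : MeasurableSet Ω := MeasurableSet.iUnion fun i => measurableSet_Ioo
  rw [← lintegral_add_compl _ hΩm, add_comm, add_mul, one_mul]
  refine add_le_add ?_ ?_
  · refine le_trans (le_of_eq (setLIntegral_congr_fun hΩm.compl fun y hy => ?_))
      (setLIntegral_le_lintegral Ωᶜ _)
    simp only [vecNorm, czGood_of_notMem hy]
  · rw [hΩ, lintegral_iUnion (fun i => measurableSet_Ioo) hcz.disj]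
    calc _ ≤ ∑' i, A * ∫⁻ y in Ioo (a i) (b i), vecNorm ρ f y ∂W := by
          refine ENNReal.tsum_le_tsum fun i => ?_
          rcases (hcz.le i).eq_or_lt with h | h
          · simp [h]
          have hpos : ENNReal.ofReal (b i - a i) ≠ 0 := by
            rw [Ne, ENNReal.ofReal_eq_zero, not_le]
            linarith
          have h1 := hW (a i) (b i) (a i) (b i) le_rfl _ (measurable_vecNorm (ρ := ρ) hf)
          calc _ ≤ ∫⁻ _ in Ioo (a i) (b i), (ENNReal.ofReal (b i - a i))⁻¹ *
                (∫⁻ y in Ioo (a i) (b i), vecNorm ρ f y) ∂W := by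
                refine setLIntegral_mono measurable_const fun y hy => ?_
                simp only [vecNorm, czGood_of_mem hcz.disj hy]
                exact lpn_ioAvg_le hρ hf h
            _ = (ENNReal.ofReal (b i - a i))⁻¹ * (W (Ioo (a i) (b i)) *
                ∫⁻ y in Ioo (a i) (b i), vecNorm ρ f y) := by
                rw [setLIntegral_const]
                ring
            _ ≤ (ENNReal.ofReal (b i - a i))⁻¹ * (A * ENNReal.ofReal (b i - a i) *
                ∫⁻ y in Ioo (a i) (b i), vecNorm ρ f y ∂W) := by
                gcongr
            _ = ((ENNReal.ofReal (b i - a i))⁻¹ * ENNReal.ofReal (b i - a i)) * (A *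
                ∫⁻ y in Ioo (a i) (b i), vecNorm ρ f y ∂W) := by ring
            _ = _ := by rw [ENNReal.inv_mul_cancel hpos ENNReal.ofReal_ne_top, one_mul]
      _ ≤ _ := by
          rw [ENNReal.tsum_mul_left, hcz.tsum_lintegral]
          gcongr
          exact Measure.restrict_le_self

lemma lintegral_vecNorm_czBad_le (hρ : 1 ≤ ρ) (hf : ∀ k, Measurable (f k))
    (hcz : IsCZ (vecNorm ρ f) l a b) (i : ℕ) :
    ∫⁻ y in Ioo (a i) (b i), vecNorm ρ (fun k y => f k y - czGood a b (f k) y) y ≤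
      2 * ∫⁻ y in Ioo (a i) (b i), vecNorm ρ f y := by
  rcases (hcz.le i).eq_or_lt with h | h
  · simp [h]
  have hpos : ENNReal.ofReal (b i - a i) ≠ 0 := by
    rw [Ne, ENNReal.ofReal_eq_zero, not_le]
    linarith
  calc _ ≤ ∫⁻ y in Ioo (a i) (b i), (vecNorm ρ f y + (ENNReal.ofReal (b i - a i))⁻¹ *
        ∫⁻ y in Ioo (a i) (b i), vecNorm ρ f y) := by
        refine setLIntegral_mono ((measurable_vecNorm hf).add measurable_const) fun y hy => ?_
        refine le_trans (lpn_mono (by linarith) fun k => enorm_sub_le)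
          ((lpn_add_le hρ _ _).trans (add_le_add le_rfl ?_))
        simp only [czGood_of_mem hcz.disj hy]
        exact lpn_ioAvg_le hρ hf h
    _ = _ := by
        rw [lintegral_add_left (measurable_vecNorm hf), setLIntegral_const, Real.volume_Ioo,
          mul_right_comm, ENNReal.inv_mul_cancel hpos ENNReal.ofReal_ne_top, one_mul, two_mul]

lemma integral_czBad_eq_zero {f : ℝ → ℂ} (hf : Integrable f) (hab : ∀ i, a i ≤ b i)
    (hdisj : Pairwise (Function.onFun Disjoint fun i => Ioo (a i) (b i))) (i : ℕ) :
    ∫ y in Ioo (a i) (b i), (f y - czGood a b f y) = 0 := by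
  rcases (hab i).eq_or_lt with h | h
  · simp [h]
  have h1 : ∫ y in Ioo (a i) (b i), (f y - czGood a b f y) =
      ∫ y in Ioo (a i) (b i), (f y - ioAvg f (a i) (b i)) :=
    setIntegral_congr_fun measurableSet_Ioo fun y hy => by
      simp only [czGood_of_mem hdisj hy]
  rw [h1, integral_sub hf.integrableOn (by simp), setIntegral_const,
    Real.volume_real_Ioo_of_le h.le, ioAvg, smul_smul, mul_inv_cancel₀ (by linarith), one_smul,
    sub_self]

/-- Because inner and outer exponents are both ρ, Tonelli reduces the vector-valued bound to the
scalar one for each k. The bound by l then trades the ρ-th power for l^(ρ-1) times the first. -/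
lemma mul_measure_vecOp_le_of_bounded (hK : KernelBounds K δ C) (hq : 1 < q) (hρ : 1 < ρ)
    {B : ℝ≥0} (hB : ∀ f : ℝ → ℂ, Admissible f →
      ∫⁻ x, variationOp K q f x ^ ρ ∂W ≤ B * ∫⁻ x, ‖f x‖ₑ ^ ρ ∂W)
    (hl0 : l ≠ 0) (hl : l ≠ ∞) (hf : ∀ k, Admissible (f k))
    (hfl : ∀ᵐ y ∂W, vecNorm ρ f y ≤ l) :
    l * W {x | l < vecOp K q ρ f x} ≤ B * ∫⁻ y, vecNorm ρ f y ∂W := by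
  have hρ0 : 0 < ρ := by linarith
  have hpow : ∀ u : ℝ≥0∞, u ^ ρ = u ^ (ρ - 1) * u := fun u => by
    nth_rewrite 3 [← ENNReal.rpow_one u]
    rw [← ENNReal.rpow_add_of_nonneg _ _ (by linarith) zero_le_one, sub_add_cancel]
  have hm := measurable_vecOp (ρ := ρ) hK hf (by linarith : 0 < q)
  have key : l ^ ρ * W {x | l < vecOp K q ρ f x} ≤
      l ^ (ρ - 1) * (B * ∫⁻ y, vecNorm ρ f y ∂W) := by
    calc _ = ∫⁻ _ in {x | l < vecOp K q ρ f x}, l ^ ρ ∂W := by rw [setLIntegral_const]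
      _ ≤ ∫⁻ x in {x | l < vecOp K q ρ f x}, vecOp K q ρ f x ^ ρ ∂W := by
          refine setLIntegral_mono (hm.pow_const _) fun x hx => ?_
          exact ENNReal.rpow_le_rpow (le_of_lt hx) hρ0.le
      _ ≤ ∫⁻ x, vecOp K q ρ f x ^ ρ ∂W := setLIntegral_le_lintegral _ _
      _ = ∑' k, ∫⁻ x, variationOp K q (f k) x ^ ρ ∂W := by
          simp_rw [vecOp, lpn_rpow hρ0]
          exact lintegral_tsum fun k =>
            ((measurable_variationOp hK (hf k) (by linarith)).pow_const _).aemeasurable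
      _ ≤ ∑' k, B * ∫⁻ x, ‖f k x‖ₑ ^ ρ ∂W := ENNReal.tsum_le_tsum fun k => hB _ (hf k)
      _ = B * ∫⁻ x, vecNorm ρ f x ^ ρ ∂W := by
          simp_rw [vecNorm, lpn_rpow hρ0]
          rw [ENNReal.tsum_mul_left, lintegral_tsum fun k =>
            ((hf k).1.enorm.pow_const _).aemeasurable]
      _ ≤ B * ∫⁻ x, l ^ (ρ - 1) * vecNorm ρ f x ∂W := by
          refine mul_le_mul' le_rfl (lintegral_mono_ae ?_)
          filter_upwards [hfl] with y hy
          rw [hpow]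
          exact mul_le_mul' (ENNReal.rpow_le_rpow hy (by linarith)) le_rfl
      _ = _ := by
          rw [lintegral_const_mul' _ _ (ENNReal.rpow_ne_top_of_nonneg (by linarith) hl)]
          ring
  rw [hpow, mul_assoc] at key
  exact (ENNReal.mul_le_mul_iff_right (ENNReal.rpow_pos (pos_iff_ne_zero.2 hl0) hl).ne'
    (ENNReal.rpow_ne_top_of_nonneg (by linarith) hl)).1 key

lemma vecOp_czBad_le (hK : KernelBounds K δ C) (hq : 1 < q) (hρ : 1 < ρ)
    (hf : ∀ k, Measurable (f k)) (hF : ∫⁻ y, vecNorm ρ f y ≠ ∞)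
    (hcz : IsCZ (vecNorm ρ f) l a b) {x : ℝ} (hx : x ∉ czStar a b) :
    vecOp K q ρ (fun k y => f k y - czGood a b (f k) y) x ≤
      ENNReal.ofReal (2 * C) * czTheta (vecNorm ρ f) δ a b x +
      ENNReal.ofReal (32 * C) * czEta (vecNorm ρ f) (min q ρ) a b x ^ (1 / min q ρ) := by
  have hC := hK.2.1
  have hr : 1 < min q ρ := lt_min hq hρ
  have hbad : ∫⁻ y, vecNorm ρ (fun k y => f k y - czGood a b (f k) y) y ≠ ∞ := by
    have h1 := lintegral_vecNorm_czGood_le hρ.le hf hcz a1Measure_volume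
    refine ne_top_of_le_ne_top (ENNReal.add_ne_top.2 ⟨hF,
      ne_top_of_le_ne_top (ENNReal.mul_ne_top (by simp) hF) h1⟩) ?_
    rw [← lintegral_add_left (measurable_vecNorm hf)]
    exact lintegral_mono fun y => (lpn_mono (by linarith) fun k => enorm_sub_le).trans
      (lpn_add_le hρ.le _ _)
  have hfi : ∀ k, Integrable (f k) := fun k => ⟨(hf k).aestronglyMeasurable,
    lt_top_iff_ne_top.2 (ne_top_of_le_ne_top hF (lintegral_mono fun y =>
      le_lpn (by linarith) (fun k => ‖f k y‖ₑ) k))⟩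
  refine (vecOp_le_of_mean_zero hK (fun k => (hf k).sub (measurable_czGood (hf k))) hbad hq.le
    hρ.le hcz.le hcz.disj (fun k y hy => by simp [czGood_of_notMem hy])
    (fun k i => integral_czBad_eq_zero (hfi k) hcz.le hcz.disj i)
    (fun i hi => hx (mem_iUnion.2 ⟨i, hi⟩))).trans (add_le_add ?_ ?_)
  · rw [czTheta, ← ENNReal.tsum_mul_left]
    refine ENNReal.tsum_le_tsum fun i => ?_
    refine (mul_le_mul' le_rfl (lintegral_vecNorm_czBad_le hρ.le hf hcz i)).trans (le_of_eq ?_)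
    rw [mul_assoc C, ENNReal.ofReal_mul hC.le, ENNReal.ofReal_mul zero_le_two,
      ENNReal.ofReal_ofNat]
    ring
  · have h1 : czEta (vecNorm ρ f) (min q ρ) a b x ^ (1 / min q ρ) = lpn (min q ρ) (fun i =>
        ENNReal.ofReal (|x - (a i + b i) / 2|⁻¹) * ∫⁻ y in Ioo (a i) (b i), vecNorm ρ f y) := rfl
    rw [h1, show 32 * C = 4 * (8 * C) by ring, ENNReal.ofReal_mul (by norm_num), mul_assoc,
      ENNReal.ofReal_ofNat, ← lpn_const_mul (p := min q ρ) (by linarith) (ENNReal.ofReal (8 * C))]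
    refine mul_le_mul' le_rfl (lpn_mono (by linarith) fun i => ?_)
    refine (mul_le_mul' le_rfl (lintegral_vecNorm_czBad_le hρ.le hf hcz i)).trans (le_of_eq ?_)
    rw [show 4 * C * |x - (a i + b i) / 2|⁻¹ = (4 * C) * |x - (a i + b i) / 2|⁻¹ by ring,
      ENNReal.ofReal_mul (by positivity), show 8 * C = 2 * (4 * C) by ring,
      ENNReal.ofReal_mul zero_le_two, ENNReal.ofReal_ofNat]
    ring

/-- The weighted weak type `(1,1)` estimate for the `ℓ^ρ`-valued variation operator. -/
theorem exists_weak_type (hK : KernelBounds K δ C) (hq : 1 < q) (hρ : 1 < ρ)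
    (hWac : W ≪ volume) (hW : A1Measure W A) (hB : StrongBound K q ρ W) :
    ∃ D : ℝ≥0, ∀ f : ℕ → ℝ → ℂ, (∀ k, Measurable (f k)) → ∫⁻ y, vecNorm ρ f y ≠ ∞ →
      ∀ l : ℝ≥0∞, l ≠ 0 → l ≠ ∞ →
        l * W {x | l < vecOp K q ρ f x} ≤ D * ∫⁻ y, vecNorm ρ f y ∂W := by
  obtain ⟨B, hB⟩ := hB
  have hr : 1 < min q ρ := lt_min hq hρ
  obtain ⟨D₁, hD₁⟩ := exists_mul_measure_czTheta_le hK.1 hW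
  obtain ⟨D₂, hD₂⟩ := exists_mul_measure_czEta_le hr hW
  -- At level l' = M·l the three summands account for the good part, `czTheta` and the root of
  -- `czEta`, each at most l off the exceptional sets.
  set M : ℝ≥0 := 1 + Real.toNNReal (2 * C) + Real.toNNReal (32 * C) with hM
  have hM0 : (M : ℝ≥0∞) ≠ 0 := by
    rw [Ne, ENNReal.coe_eq_zero, hM]
    positivity
  refine ⟨M * (B * (1 + A) + 18 * A ^ 2 + D₁ + D₂), fun f hf hF l' hl'0 hl' => ?_⟩
  set l := l' / M with hldef
  have hl0 : l ≠ 0 := ENNReal.div_ne_zero.2 ⟨hl'0, ENNReal.coe_ne_top⟩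
  have hl : l ≠ ∞ := ENNReal.div_ne_top hl' hM0
  have hl'eq : l' = M * l := by
    rw [hldef, ENNReal.mul_div_cancel hM0 ENNReal.coe_ne_top]
  set F := vecNorm ρ f with hFdef
  have hFm : Measurable F := measurable_vecNorm hf
  obtain ⟨a, b, hcz⟩ := exists_isCZ hFm hF hl0 hl
  set g := fun k => czGood a b (f k) with hg
  set h := fun k y => f k y - czGood a b (f k) y with hh
  have hgF : ∫⁻ y, vecNorm ρ g y ≠ ∞ := ne_top_of_le_ne_top (ENNReal.mul_ne_top (by simp) hF)
    (lintegral_vecNorm_czGood_le hρ.le hf hcz a1Measure_volume)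
  have hga : ∀ k, Admissible (g k) :=
    admissible_of_vecNorm (by linarith) (fun k => measurable_czGood (hf k)) hgF
  have hfa : ∀ k, Admissible (f k) := admissible_of_vecNorm (by linarith) hf hF
  have hha : ∀ k, Admissible (h k) := fun k => by
    have h1 := (hfa k).add ((hga k).of_le (g := fun y => -g k y) (hga k).1.neg (by simp))
    simpa [hh, hg, sub_eq_add_neg] using h1
  have hsub : {x | l' < vecOp K q ρ f x} ⊆ ({x | l < vecOp K q ρ g x} ∪ czStar a b) ∪
      ({x | l < czTheta F δ a b x} \ czStar a b) ∪
      ({x | l ^ (min q ρ) < czEta F (min q ρ) a b x} \ czStar a b) := by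
    intro x hx
    by_contra hnot
    simp only [mem_union, Set.mem_sdiff, mem_ofPred_eq, not_or, not_and, not_not, not_lt] at hnot
    obtain ⟨⟨⟨h1, h2⟩, h3⟩, h4⟩ := hnot
    have h3' : czTheta F δ a b x ≤ l := by
      by_contra hc
      exact h2 (h3 (not_le.1 hc))
    have h4' : czEta F (min q ρ) a b x ≤ l ^ (min q ρ) := by
      by_contra hc
      exact h2 (h4 (not_le.1 hc))
    have h5 : vecOp K q ρ f x ≤ vecOp K q ρ g x + vecOp K q ρ h x := by
      have := vecOp_add_le hK hga hha hq.le hρ.le x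
      simpa [hg, hh] using this
    have h6 := vecOp_czBad_le hK hq hρ hf hF hcz h2
    have h7 : czEta F (min q ρ) a b x ^ (1 / min q ρ) ≤ l := by
      rw [← ENNReal.rpow_le_rpow_iff (by linarith : 0 < min q ρ), ← ENNReal.rpow_mul,
        one_div_mul_cancel (by linarith), ENNReal.rpow_one]
      exact h4'
    refine absurd (show l' < vecOp K q ρ f x from hx) (not_lt.2 ?_)
    calc vecOp K q ρ f x ≤ l + (ENNReal.ofReal (2 * C) * l + ENNReal.ofReal (32 * C) * l) :=
          h5.trans (add_le_add h1 (h6.trans (add_le_add (mul_le_mul' le_rfl h3')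
            (mul_le_mul' le_rfl h7))))
      _ = l' := by
          rw [hl'eq, hM]
          push_cast
          simp only [ENNReal.ofReal]
          ring
  have hg1 : l * W {x | l < vecOp K q ρ g x} ≤ B * ((1 + A) * ∫⁻ y, F y ∂W) := by
    refine (mul_measure_vecOp_le_of_bounded hK hq hρ hB hl0 hl hga
      (hWac.ae_le (vecNorm_czGood_le hρ.le hf hl hcz hF))).trans ?_
    exact mul_le_mul' le_rfl (lintegral_vecNorm_czGood_le hρ.le hf hcz hW)
  calc _ ≤ l' * (W {x | l < vecOp K q ρ g x} + W (czStar a b) +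
        W ({x | l < czTheta F δ a b x} \ czStar a b) +
        W ({x | l ^ (min q ρ) < czEta F (min q ρ) a b x} \ czStar a b)) := by
        refine mul_le_mul' le_rfl ((measure_mono hsub).trans ?_)
        refine (measure_union_le _ _).trans (add_le_add ?_ le_rfl)
        refine (measure_union_le _ _).trans (add_le_add ?_ le_rfl)
        exact measure_union_le _ _
    _ = M * (l * W {x | l < vecOp K q ρ g x} + l * W (czStar a b) +
        l * W ({x | l < czTheta F δ a b x} \ czStar a b) +
        l * W ({x | l ^ (min q ρ) < czEta F (min q ρ) a b x} \ czStar a b)) := by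
        rw [hl'eq]
        ring
    _ ≤ M * (B * ((1 + A) * ∫⁻ y, F y ∂W) + 18 * A ^ 2 * (∫⁻ y, F y ∂W) + D₁ * (∫⁻ y, F y ∂W) +
        D₂ * ∫⁻ y, F y ∂W) := by
        refine mul_le_mul' le_rfl (add_le_add (add_le_add (add_le_add hg1 ?_) ?_) ?_)
        · exact hcz.mul_measure_enlarged_le hW hFm hF hl0 hl
        · exact hD₁ F l a b hcz hFm hl
        · exact hD₂ F l a b hcz hFm hl0 hl
    _ = _ := by
        push_cast
        ring

end Decomposition

end VqCZ

end

/-! ### Transfer from an endpoint to an interval. -/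

noncomputable section

namespace VqCZ

/-- Restriction of a sequence of functions to a set. -/
def vecRestrict (f : ℕ → ℝ → ℂ) (s : Set ℝ) : ℕ → ℝ → ℂ := fun k => s.indicator (f k)

/-- The concentric interval of eleven times the length. -/
def dil (a b : ℝ) : Set ℝ := Ioo (a - 5 * (b - a)) (b + 5 * (b - a))

section SparseStep

open Filter Topology

variable {K : ℝ → ℝ → ℂ} {δ C q ρ : ℝ} {f : ℕ → ℝ → ℂ} {F : ℝ → ℝ≥0∞} {l : ℝ≥0∞} {a b : ℕ → ℝ}

lemma vecNorm_vecRestrict (hρ : 0 < ρ) (s : Set ℝ) :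
    vecNorm ρ (vecRestrict f s) = s.indicator (vecNorm ρ f) := by
  funext x
  by_cases hx : x ∈ s
  · simp [vecNorm, vecRestrict, hx]
  · simp [vecNorm, vecRestrict, hx, lpn_zero hρ]

lemma vecOp_congr_ae {g : ℕ → ℝ → ℂ} (h : ∀ k, f k =ᵐ[volume] g k) (x : ℝ) :
    vecOp K q ρ f x = vecOp K q ρ g x := by
  unfold vecOp
  congr 1
  funext k
  exact variationOp_congr_ae (h k) x

/-- If u is outside the level set the maximal function bounds the integral. Otherwise only the
component containing u can carry excess mass in (u, v), since its right endpoint is again outside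
the level set. -/
lemma IsCZ.lintegral_Ioo_le (hcz : IsCZ F l a b) (hl : l ≠ ∞) {u v : ℝ} (huv : u ≤ v) :
    ∫⁻ y in Ioo u v, F y ≤ l * ENNReal.ofReal (v - u) +
      ∑' i, (Ioo (a i) (b i)).indicator (fun _ => ∫⁻ y in Ioo (a i) (b i) ∩ Ioo u v, F y) u := by
  by_cases hu : u ∈ czSet F l
  swap
  · exact (lintegral_le_of_notMem_czSet hl hu le_rfl huv).trans le_self_add
  rw [hcz.eq] at hu
  obtain ⟨i, hi⟩ := mem_iUnion.1 hu
  have hab : a i < b i := hi.1.trans hi.2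
  have h1 : ∫⁻ y in Ioo (a i) (b i) ∩ Ioo u v, F y ≤ ∑' i, (Ioo (a i) (b i)).indicator
      (fun _ => ∫⁻ y in Ioo (a i) (b i) ∩ Ioo u v, F y) u := by
    refine le_trans (le_of_eq ?_) (ENNReal.le_tsum i)
    rw [indicator_of_mem hi]
  rcases le_or_gt v (b i) with hv | hv
  · have h2 : Ioo u v ⊆ Ioo (a i) (b i) ∩ Ioo u v := fun y hy =>
      ⟨⟨hi.1.trans hy.1, hy.2.trans_le hv⟩, hy⟩
    exact ((lintegral_mono_set h2).trans h1).trans le_add_self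
  · have h2 : Ioo u v ⊆ Ico (b i) v ∪ (Ioo (a i) (b i) ∩ Ioo u v) := fun y hy => by
      rcases le_or_gt (b i) y with h | h
      · exact Or.inl ⟨h, hy.2⟩
      · exact Or.inr ⟨⟨hi.1.trans hy.1, h⟩, hy⟩
    refine (lintegral_mono_set h2).trans ((lintegral_union_le _ _ _).trans (add_le_add ?_ h1))
    rw [setLIntegral_congr Ioo_ae_eq_Ico.symm]
    refine (lintegral_le_of_notMem_czSet hl (hcz.not_mem i hab).2 le_rfl hv.le).trans ?_
    gcongr
    exact hi.2.le

/-- A shell of width h has regular mass of order l·h, giving the `ℓ^r` sequence l/(m+4), plus the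
mass inside the components that contain an inner or outer end of the shell. At most two components
occur per shell, so `tsum_tsum_rpow_le` reduces the excess to `czEta`. -/
lemma exists_lpn_shell_le {r : ℝ} (hr : 1 < r) : ∃ D : ℝ≥0, ∀ (F : ℝ → ℝ≥0∞) (l : ℝ≥0∞)
    (a b : ℕ → ℝ), IsCZ F l a b → Measurable F → l ≠ ∞ → ∀ x, x ∉ czStar a b →
    czEta F r a b x ≤ l ^ r → ∀ h : ℝ, 0 < h →
      lpn r (fun m : ℕ => ENNReal.ofReal (1 / ((m + 4) * h)) *
        ∫⁻ y in {y | (m + 4) * h < |x - y| ∧ |x - y| ≤ (m + 5) * h}, F y) ≤ D * l := by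
  have hr0 : 0 < r := by linarith
  have hS : lpn r (fun m : ℕ => ENNReal.ofReal (1 / ((m : ℝ) + 4))) ≠ ∞ := by
    refine (ENNReal.rpow_lt_top_of_nonneg (by positivity) ?_).ne
    have h1 : Summable fun m : ℕ => (1 / ((m : ℝ) + 4)) ^ r := by
      have h2 := (summable_nat_add_iff 4).2 (Real.summable_one_div_nat_rpow.2 hr)
      refine h2.congr fun m => ?_
      rw [Real.div_rpow zero_le_one (by positivity), Real.one_rpow]
      push_cast
      rfl
    have h3 : ∀ m : ℕ, ENNReal.ofReal (1 / ((m : ℝ) + 4)) ^ r =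
        ENNReal.ofReal ((1 / ((m : ℝ) + 4)) ^ r) := fun m =>
      ENNReal.ofReal_rpow_of_nonneg (by positivity) hr0.le
    simp_rw [h3]
    exact h1.tsum_ofReal_ne_top
  set S := lpn r (fun m : ℕ => ENNReal.ofReal (1 / ((m : ℝ) + 4))) with hSdef
  refine ⟨2 * S.toNNReal + 8, fun F l a b hcz hF hl x hx hη h hh => ?_⟩
  set Sh := fun m : ℕ => {y : ℝ | (m + 4) * h < |x - y| ∧ |x - y| ≤ (m + 5) * h} with hSh
  have hShm : ∀ m, MeasurableSet (Sh m) := fun m =>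
    (by fun_prop : Measurable fun y => |x - y|) measurableSet_Ioc
  have hShdisj : Pairwise (Function.onFun Disjoint Sh) := fun m m' hne => by
    rw [Function.onFun, Set.disjoint_left]
    rintro y ⟨h1, h2⟩ ⟨h3, h4⟩
    have q1 : (m : ℝ) + 4 < m' + 5 := lt_of_mul_lt_mul_right (h1.trans_le h4) hh.le
    have q2 : (m' : ℝ) + 4 < m + 5 := lt_of_mul_lt_mul_right (h3.trans_le h2) hh.le
    have q3 : m < m' + 1 := by exact_mod_cast (by linarith : (m : ℝ) < m' + 1)
    have q4 : m' < m + 1 := by exact_mod_cast (by linarith : (m' : ℝ) < m + 1)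
    omega
  set X := fun (m : ℕ) (i : ℕ) => ENNReal.ofReal (1 / ((m + 4) * h)) *
    {i | x - (m + 5) * h ∈ Ioo (a i) (b i) ∨ x + (m + 4) * h ∈ Ioo (a i) (b i)}.indicator
      (fun i => ∫⁻ y in Ioo (a i) (b i) ∩ Sh m, F y) i with hX
  have hshell : ∀ m : ℕ, ENNReal.ofReal (1 / ((m + 4) * h)) * ∫⁻ y in Sh m, F y ≤
      2 * l * ENNReal.ofReal (1 / ((m : ℝ) + 4)) + 2 * ∑' i, X m i := fun m => by
    have hm : 0 < ((m : ℝ) + 4) * h := by positivity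
    have hhalf : ∀ u v : ℝ, u ≤ v → v - u = h → Ioo u v ⊆ Sh m →
        (∀ i, u ∈ Ioo (a i) (b i) → i ∈ {i | x - (m + 5) * h ∈ Ioo (a i) (b i) ∨
          x + (m + 4) * h ∈ Ioo (a i) (b i)}) →
        ENNReal.ofReal (1 / ((m + 4) * h)) * ∫⁻ y in Ioo u v, F y ≤
          l * ENNReal.ofReal (1 / ((m : ℝ) + 4)) + ∑' i, X m i := by
      intro u v huv hvu hsub hact
      refine (mul_le_mul' le_rfl (hcz.lintegral_Ioo_le hl huv)).trans ?_
      rw [mul_add, ← ENNReal.tsum_mul_left, hvu]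
      refine add_le_add (le_of_eq ?_) (ENNReal.tsum_le_tsum fun i => mul_le_mul' le_rfl ?_)
      · rw [mul_left_comm, ← ENNReal.ofReal_mul (by positivity)]
        congr 2
        field_simp
      · by_cases hi : u ∈ Ioo (a i) (b i)
        · rw [indicator_of_mem hi, indicator_of_mem (hact i hi)]
          exact lintegral_mono_set (inter_subset_inter_right _ hsub)
        · rw [indicator_of_notMem hi]
          exact zero_le
    have hcov : Sh m ⊆ Ico (x - (m + 5) * h) (x - (m + 4) * h) ∪
        Ioc (x + (m + 4) * h) (x + (m + 5) * h) := by
      rintro y ⟨h1, h2⟩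
      rcases le_total 0 (x - y) with h0 | h0
      · rw [abs_of_nonneg h0] at h1 h2
        exact Or.inl ⟨by linarith, by linarith⟩
      · rw [abs_of_nonpos h0] at h1 h2
        exact Or.inr ⟨by linarith, by linarith⟩
    calc _ ≤ ENNReal.ofReal (1 / ((m + 4) * h)) *
          ((∫⁻ y in Ioo (x - (m + 5) * h) (x - (m + 4) * h), F y) +
            ∫⁻ y in Ioo (x + (m + 4) * h) (x + (m + 5) * h), F y) := by
          refine mul_le_mul' le_rfl ((lintegral_mono_set hcov).trans
            ((lintegral_union_le _ _ _).trans (le_of_eq ?_)))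
          rw [setLIntegral_congr Ioo_ae_eq_Ico.symm, setLIntegral_congr Ioo_ae_eq_Ioc.symm]
      _ ≤ (l * ENNReal.ofReal (1 / ((m : ℝ) + 4)) + ∑' i, X m i) +
          (l * ENNReal.ofReal (1 / ((m : ℝ) + 4)) + ∑' i, X m i) := by
          rw [mul_add]
          refine add_le_add (hhalf _ _ (by linarith) (by ring) ?_ fun i hi => Or.inl hi)
            (hhalf _ _ (by linarith) (by ring) ?_ fun i hi => Or.inr hi)
          · intro y hy
            have h1 : 0 ≤ x - y := by linarith [hy.2]
            change _ < |x - y| ∧ |x - y| ≤ _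
            rw [abs_of_nonneg h1]
            exact ⟨by linarith [hy.2], by linarith [hy.1]⟩
          · intro y hy
            have h1 : x - y ≤ 0 := by linarith [hy.1]
            change _ < |x - y| ∧ |x - y| ≤ _
            rw [abs_of_nonpos h1]
            exact ⟨by linarith [hy.1], by linarith [hy.2]⟩
      _ = _ := by ring
  -- For y in the component and in the m-th shell, the distance from x to the centre is at most
  -- 3/2·|x - y| ≤ 3/2·(m+5)h, which is less than 2(m+4)h.
  have hcol : ∀ i, ∑' m, X m i ≤ 2 * (ENNReal.ofReal (|x - (a i + b i) / 2|⁻¹) *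
      ∫⁻ y in Ioo (a i) (b i), F y) := fun i => by
    calc _ ≤ ∑' m, ∫⁻ y in Ioo (a i) (b i) ∩ Sh m,
          2 * ENNReal.ofReal (|x - (a i + b i) / 2|⁻¹) * F y := by
          refine ENNReal.tsum_le_tsum fun m => ?_
          refine (mul_le_mul' le_rfl (indicator_le_self _ _ _)).trans ?_
          rw [← lintegral_const_mul _ hF]
          refine setLIntegral_mono (by fun_prop) fun y hy => ?_
          gcongr
          rw [← ENNReal.ofReal_ofNat, ← ENNReal.ofReal_mul zero_le_two]
          refine ENNReal.ofReal_le_ofReal ?_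
          have h1 : x ∉ Ioo (a i - (b i - a i)) (b i + (b i - a i)) := fun hxi =>
            hx (mem_iUnion.2 ⟨i, hxi⟩)
          obtain ⟨hy1, hy2, hy3⟩ := hy
          have hpos : 0 < ((m : ℝ) + 4) * h := by positivity
          have hmh : h ≤ ((m : ℝ) + 4) * h / 4 := by
            have : 0 ≤ (m : ℝ) * h := by positivity
            linarith
          have h4 : |x - (a i + b i) / 2| ≤ |x - y| + |(a i + b i) / 2 - y| := by
            have : x - (a i + b i) / 2 = (x - y) - ((a i + b i) / 2 - y) := by ring
            rw [this]
            exact abs_sub _ _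
          have h5 : |(a i + b i) / 2 - y| ≤ (b i - a i) / 2 :=
            abs_le.2 ⟨by linarith [hy1.2], by linarith [hy1.1]⟩
          have h6 : 3 / 2 * (b i - a i) ≤ |x - (a i + b i) / 2| := by
            simp only [mem_Ioo, not_and_or, not_lt] at h1
            refine le_abs.2 ?_
            rcases h1 with h | h
            · right; linarith
            · left; linarith
          have hlen : 0 < b i - a i := by linarith [hy1.1, hy1.2]
          rw [← div_eq_mul_inv, div_le_div_iff₀ hpos (by linarith)]
          linarith
      _ = ∫⁻ y in ⋃ m, Ioo (a i) (b i) ∩ Sh m,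
          2 * ENNReal.ofReal (|x - (a i + b i) / 2|⁻¹) * F y := by
          rw [lintegral_iUnion (fun m => measurableSet_Ioo.inter (hShm m))]
          exact fun m m' hne => (hShdisj hne).mono inter_subset_right inter_subset_right
      _ ≤ ∫⁻ y in Ioo (a i) (b i), 2 * ENNReal.ofReal (|x - (a i + b i) / 2|⁻¹) * F y :=
          lintegral_mono_set (iUnion_subset fun m => inter_subset_left)
      _ = _ := by
          rw [lintegral_const_mul _ hF, mul_assoc]
  have hrow : lpn r (fun m => ∑' i, X m i) ≤ 4 * l := by
    rw [lpn_le_iff hr0]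
    calc _ ≤ (2 : ℕ) ^ r * ∑' i, (∑' m, X m i) ^ r := by
          refine tsum_tsum_rpow_le hr.le 2 X fun m => ?_
          obtain ⟨s, hs, hs'⟩ := exists_finset_of_points hcz.disj
            {x - (m + 5) * h, x + (m + 4) * h}
          refine ⟨s, hs.trans Finset.card_le_two, fun i hi => ?_⟩
          have h1 := hs' i hi (x - (m + 5) * h) (by simp)
          have h2 := hs' i hi (x + (m + 4) * h) (by simp)
          simp only [hX]
          rw [indicator_of_notMem, mul_zero]
          rintro (h3 | h3)
          exacts [h1 h3, h2 h3]
      _ ≤ (2 : ℕ) ^ r * ∑' i, (2 * (ENNReal.ofReal (|x - (a i + b i) / 2|⁻¹) *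
            ∫⁻ y in Ioo (a i) (b i), F y)) ^ r := by
          gcongr with i
          exact hcol i
      _ = (2 : ℕ) ^ r * (2 ^ r * czEta F r a b x) := by
          simp_rw [czEta, ENNReal.mul_rpow_of_nonneg _ _ hr0.le, ENNReal.tsum_mul_left]
      _ ≤ (2 : ℕ) ^ r * (2 ^ r * l ^ r) := by gcongr
      _ = (4 * l) ^ r := by
          rw [← ENNReal.mul_rpow_of_nonneg _ _ hr0.le, ← ENNReal.mul_rpow_of_nonneg _ _ hr0.le,
            ← mul_assoc]
          norm_num
  calc _ ≤ lpn r (fun m : ℕ => 2 * l * ENNReal.ofReal (1 / ((m : ℝ) + 4)) + 2 * ∑' i, X m i) :=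
        lpn_mono hr0 hshell
    _ ≤ 2 * l * S + 2 * (4 * l) := by
        refine (lpn_add_le hr.le _ _).trans (add_le_add ?_ ?_)
        · rw [lpn_const_mul hr0]
        · rw [lpn_const_mul hr0]
          gcongr
    _ = _ := by
        push_cast
        rw [ENNReal.coe_toNNReal hS]
        ring

lemma czSet_subset_czStar (hcz : IsCZ F l a b) : czSet F l ⊆ czStar a b := by
  rw [hcz.eq]
  exact iUnion_mono fun i => Ioo_subset_Ioo (by linarith [hcz.le i]) (by linarith [hcz.le i])

/-- The far part of a function has a controlled image near a point where all maximal quantities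
are controlled. -/
lemma exists_vecOp_compl_le (hK : KernelBounds K δ C) (hq : 1 < q) (hρ : 1 < ρ) : ∃ D : ℝ≥0,
    ∀ (f : ℕ → ℝ → ℂ) (l : ℝ≥0∞) (a b : ℕ → ℝ), (∀ k, Measurable (f k)) →
    ∫⁻ y, vecNorm ρ f y ≠ ∞ → l ≠ ∞ → IsCZ (vecNorm ρ f) l a b →
    ∀ x, x ∉ czStar a b → czEta (vecNorm ρ f) (min q ρ) a b x ≤ l ^ min q ρ →
    vecOp K q ρ f x ≤ l → ∀ c d ξ : ℝ, x = c ∨ x = d → ξ ∈ Ioo c d →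
      vecOp K q ρ (vecRestrict f (dil c d)ᶜ) ξ ≤ D * l := by
  obtain ⟨hδ, hC, -⟩ := id hK
  have hr : 1 < min q ρ := lt_min hq hρ
  have hρ0 : 0 < ρ := by linarith
  obtain ⟨D₁, hD₁⟩ := exists_lintegral_rpow_le (s := 1 + δ) (by linarith)
  obtain ⟨D₂, hD₂⟩ := exists_lpn_shell_le hr
  refine ⟨1 + C.toNNReal * D₁ * 2 + 16 * ((2 * C).toNNReal * D₂) + (4 * C).toNNReal,
    fun f l a b hf hFi hl hcz x hx hη hT c d ξ hxcd hξ => ?_⟩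
  set F := vecNorm ρ f with hFdef
  have hF : Measurable F := measurable_vecNorm hf
  set h := d - c with hhdef
  have hh : 0 < h := by linarith [hξ.1, hξ.2]
  have hxξ : |x - ξ| ≤ h := by
    rcases hxcd with rfl | rfl
    · rw [abs_of_nonpos (by linarith [hξ.1])]
      linarith [hξ.2]
    · rw [abs_of_nonneg (by linarith [hξ.2])]
      linarith [hξ.1]
  have hxΩ : x ∉ czSet F l := fun h => hx (czSet_subset_czStar hcz h)
  have hfa : ∀ k, Admissible (f k) := admissible_of_vecNorm hρ0 hf hFi
  set Far := {y : ℝ | 4 * h < |x - y|} with hFar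
  have hFarm : MeasurableSet Far := measurableSet_far x _
  have hdilm : MeasurableSet (dil c d) := measurableSet_Ioo
  -- The comparison estimate applies to the complement of a ball around x, not of the dilate. The
  -- difference of the two regions lies in the dilate, at distance at least 3h from ξ, where the
  -- size bound for K suffices.
  set g := fun k y => -((Far ∩ dil c d).indicator (f k) y) with hg
  have hga : ∀ k, Admissible (g k) := fun k =>
    (hfa k).of_le ((hf k).indicator (hFarm.inter hdilm)).neg fun y => by
      rw [hg, norm_neg]
      exact norm_indicator_le_norm_self _ _
  have hsplit : vecRestrict f (dil c d)ᶜ = fun k y => Far.indicator (f k) y + g k y := by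
    funext k y
    have hsub : y ∉ dil c d → y ∈ Far := fun hy => by
      simp only [dil, mem_Ioo, not_and_or, not_lt] at hy
      change 4 * h < |x - y|
      rw [lt_abs]
      rcases hxcd with rfl | rfl <;> rcases hy with hy | hy
      · left; linarith
      · right; linarith
      · left; linarith
      · right; linarith
    by_cases h1 : y ∈ dil c d <;> by_cases h2 : y ∈ Far
    · simp [vecRestrict, hg, h1, h2]
    · simp [vecRestrict, hg, h1, h2]
    · simp [vecRestrict, hg, h1, h2]
    · exact absurd (hsub h1) h2
  have hfar := vecOp_far_le hK hfa hq.le hρ.le hh hxξ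
  have hterm2 : ∫⁻ y in Far, ENNReal.ofReal (C * h ^ δ * |x - y| ^ (-(1 + δ))) * F y ≤
      C.toNNReal * D₁ * 2 * l := by
    -- Since x is outside the level set, the measure F dy itself has linear growth around x with
    -- constant 2l.
    have h1 := hD₁ (volume.withDensity F) x h (2 * l) hh fun R hR => by
      rw [withDensity_apply _ measurableSet_Ioo]
      refine (lintegral_le_of_notMem_czSet hl hxΩ (by linarith) (by linarith)).trans (le_of_eq ?_)
      rw [show x + R - (x - R) = 2 * R by ring, ENNReal.ofReal_mul zero_le_two,
        ENNReal.ofReal_ofNat]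
      ring
    calc _ ≤ ∫⁻ y in {y | h ≤ |y - x|}, ENNReal.ofReal (C * h ^ δ) *
          (F y * ENNReal.ofReal (|y - x| ^ (-(1 + δ)))) := by
          refine (lintegral_mono_set fun y hy => ?_).trans (lintegral_mono fun y => le_of_eq ?_)
          · change h ≤ |y - x|
            rw [abs_sub_comm]
            have : 4 * h < |x - y| := hy
            linarith
          · rw [ENNReal.ofReal_mul (by positivity), abs_sub_comm x y]
            ring
      _ = ENNReal.ofReal (C * h ^ δ) * ∫⁻ y in {y | h ≤ |y - x|},
          ENNReal.ofReal (|y - x| ^ (-(1 + δ))) ∂(volume.withDensity F) := by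
          have hms : MeasurableSet {y : ℝ | h ≤ |y - x|} :=
            measurableSet_le measurable_const (by fun_prop)
          rw [lintegral_const_mul _ (by fun_prop), restrict_withDensity hms,
            lintegral_withDensity_eq_lintegral_mul _ hF (by fun_prop)]
          rfl
      _ ≤ ENNReal.ofReal (C * h ^ δ) * (D₁ * (2 * l) * ENNReal.ofReal (h ^ (1 - (1 + δ)))) :=
          mul_le_mul' le_rfl h1
      _ = ENNReal.ofReal (C * h ^ δ) * ENNReal.ofReal (h ^ (1 - (1 + δ))) * D₁ * 2 * l := by ring
      _ = _ := by
          rw [← ENNReal.ofReal_mul (by positivity), mul_assoc C, ← Real.rpow_add hh]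
          simp [ENNReal.ofReal]
  have hterm3 : lpn (min q ρ) (fun m : ℕ => ENNReal.ofReal (2 * C / ((m + 4) * h)) *
      ∫⁻ y in {y | (m + 4) * h < |x - y| ∧ |x - y| ≤ (m + 5) * h}, F y) ≤
      (2 * C).toNNReal * D₂ * l := by
    have h1 := hD₂ F l a b hcz hF hl x hx hη h hh
    have h2 : ∀ m : ℕ, ENNReal.ofReal (2 * C / ((m + 4) * h)) =
        ENNReal.ofReal (2 * C) * ENNReal.ofReal (1 / ((m + 4) * h)) := fun m => by
      rw [← ENNReal.ofReal_mul (by positivity)]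
      congr 1
      ring
    simp_rw [h2, mul_assoc (ENNReal.ofReal (2 * C))]
    rw [lpn_const_mul (by linarith), mul_assoc]
    exact mul_le_mul' le_rfl h1
  have hgT : vecOp K q ρ g ξ ≤ (4 * C).toNNReal * l := by
    have h1 : ∀ k, variationOp K q (g k) ξ ≤
        ∫⁻ y in Far ∩ dil c d, ENNReal.ofReal (C / (3 * h)) * ‖f k y‖ₑ := fun k => by
      refine (variationOp_le_lintegral hK (hga k) hq.le ξ).trans ?_
      refine (setLIntegral_le_lintegral _ _).trans ?_
      rw [← lintegral_indicator (hFarm.inter hdilm)]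
      refine lintegral_mono fun y => ?_
      by_cases hy : y ∈ Far ∩ dil c d
      · simp only [hg, indicator_of_mem hy, enorm_neg]
        gcongr
        have h2 : 4 * h < |x - y| := hy.1
        have h3 : |x - y| ≤ |x - ξ| + |ξ - y| := abs_sub_le _ _ _
        have h4 : 3 * h ≤ |ξ - y| := by linarith
        refine (hK.enorm_le fun h => by rw [h, sub_self, abs_zero] at h4; linarith).trans ?_
        gcongr
      · simp [hg, indicator_of_notMem hy]
    refine (lpn_mono hρ0 h1).trans ((lpn_weighted_lintegral_le hρ.le hf measurable_const _).trans ?_)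
    rw [lintegral_const_mul _ hF]
    calc _ ≤ ENNReal.ofReal (C / (3 * h)) * (l * ENNReal.ofReal (12 * h)) := by
          refine mul_le_mul' le_rfl ?_
          refine (lintegral_mono_set (t := Ioo (x - 6 * h) (x + 6 * h)) fun y hy => ?_).trans ?_
          · obtain ⟨h1, h2⟩ := hy.2
            rcases hxcd with rfl | rfl <;> constructor <;> linarith
          · refine (lintegral_le_of_notMem_czSet hl hxΩ (by linarith) (by linarith)).trans
              (le_of_eq ?_)
            congr 2
            ring
      _ = _ := by
          rw [mul_left_comm, ← ENNReal.ofReal_mul (by positivity), mul_comm]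
          have : C / (3 * h) * (12 * h) = 4 * C := by
            field_simp
            ring
          rw [this]
          rfl
  rw [hsplit]
  refine (vecOp_add_le hK (fun k => (hfa k).indicator hFarm) hga hq.le hρ.le ξ).trans ?_
  calc _ ≤ (l + C.toNNReal * D₁ * 2 * l + 16 * ((2 * C).toNNReal * D₂ * l)) +
        (4 * C).toNNReal * l :=
        add_le_add (hfar.trans (add_le_add (add_le_add hT hterm2) (mul_le_mul' le_rfl hterm3))) hgT
    _ = _ := by
        push_cast
        ring

end SparseStep

end VqCZ

end

/-! ### Sparse domination. -/

noncomputable section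

namespace VqCZ

section Sparse

open Filter Topology

variable {K : ℝ → ℝ → ℂ} {δ C q ρ : ℝ}

lemma dil_mono {a b c d : ℝ} (hcd : c < d) (h : Ioo c d ⊆ Ioo a b) : dil c d ⊆ dil a b := by
  obtain ⟨h1, h2⟩ := (Ioo_subset_Ioo_iff hcd).1 h
  exact Ioo_subset_Ioo (by linarith) (by linarith)

/-- The children are the components, within the interval, of an open set covering the points where
the operator, the maximal function or `czEta` is too large. The hypothesis `a ≤ b` comes after the
existential quantifier so that `choose` produces functions of all pairs of endpoints. -/
lemma exists_sparse_step (hK : KernelBounds K δ C) (hq : 1 < q) (hρ : 1 < ρ)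
    (hB : StrongBound K q ρ volume) : ∃ D : ℝ≥0, ∀ f : ℕ → ℝ → ℂ, (∀ k, Measurable (f k)) →
    ∫⁻ y, vecNorm ρ f y ≠ ∞ → ∀ a b : ℝ, ∃ c d : ℕ → ℝ, a ≤ b →
      (∀ n, c n ≤ d n) ∧ (∀ n, Ioo (c n) (d n) ⊆ Ioo a b) ∧
      Pairwise (Function.onFun Disjoint fun n => Ioo (c n) (d n)) ∧
      volume (⋃ n, Ioo (c n) (d n)) ≤ ENNReal.ofReal (b - a) / 2 ∧
      (∀ x ∈ Ioo a b, x ∉ ⋃ n, Ioo (c n) (d n) → vecOp K q ρ (vecRestrict f (dil a b)) x ≤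
        D * ((∫⁻ y in dil a b, vecNorm ρ f y) / ENNReal.ofReal (b - a))) ∧
      (∀ n, ∀ x ∈ Ioo (c n) (d n), vecOp K q ρ (vecRestrict f (dil a b)) x ≤
        D * ((∫⁻ y in dil a b, vecNorm ρ f y) / ENNReal.ofReal (b - a)) +
          vecOp K q ρ (vecRestrict f (dil (c n) (d n))) x) := by
  have hρ0 : 0 < ρ := by linarith
  have hr : 1 < min q ρ := lt_min hq hρ
  obtain ⟨D₁, hD₁⟩ := exists_weak_type hK hq hρ Measure.AbsolutelyContinuous.rfl a1Measure_volume hB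
  obtain ⟨D₂, hD₂⟩ := exists_mul_measure_czEta_le hr a1Measure_volume
  obtain ⟨D₃, hD₃⟩ := exists_vecOp_compl_le hK hq hρ
  set D' : ℝ≥0 := D₁ + 18 + D₂ with hD'
  -- At level M times the average, an exceptional set filling half of the interval would force M ≤
  -- 2D' by the weak type bounds.
  set M : ℝ≥0 := 2 * D' + 1 with hM
  refine ⟨M * (D₃ + 1), fun f₀ hf₀ hF₀ a b => ?_⟩
  by_cases hab : a ≤ b
  swap
  · exact ⟨0, 0, fun h => absurd h hab⟩
  set avg := (∫⁻ y in dil a b, vecNorm ρ f₀ y) / ENNReal.ofReal (b - a) with havg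
  set f := vecRestrict f₀ (dil a b) with hf
  have hdilm : ∀ c d : ℝ, MeasurableSet (dil c d) := fun c d => measurableSet_Ioo
  have hfm : ∀ k, Measurable (f k) := fun k => (hf₀ k).indicator (hdilm a b)
  have hFeq : ∫⁻ y, vecNorm ρ f y = ∫⁻ y in dil a b, vecNorm ρ f₀ y := by
    rw [hf, vecNorm_vecRestrict hρ0, lintegral_indicator (hdilm a b)]
  have hFi : ∫⁻ y, vecNorm ρ f y ≠ ∞ := by
    rw [hFeq]
    exact ne_top_of_le_ne_top hF₀ (setLIntegral_le_lintegral _ _)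
  rcases hab.eq_or_lt with rfl | hlt
  · exact ⟨fun _ => a, fun _ => a, fun _ => ⟨fun _ => le_rfl, by simp, fun i j _ => by simp,
      by simp, by simp, by simp⟩⟩
  have hL0 : ENNReal.ofReal (b - a) ≠ 0 := by
    rw [Ne, ENNReal.ofReal_eq_zero, not_le]
    linarith
  by_cases h0 : avg = 0
  · have hz : ∫⁻ y, vecNorm ρ f y = 0 := by
      rw [hFeq]
      exact (ENNReal.div_eq_zero_iff.1 h0).resolve_right ENNReal.ofReal_ne_top
    rw [lintegral_eq_zero_iff (measurable_vecNorm hfm)] at hz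
    have hT : ∀ x, vecOp K q ρ f x = 0 := fun x => by
      have h1 : ∀ k, f k =ᵐ[volume] fun _ => 0 := fun k => by
        filter_upwards [hz] with y hy
        have := le_lpn hρ0 (fun k => ‖f k y‖ₑ) k
        have h2 : lpn ρ (fun k => ‖f k y‖ₑ) = 0 := hy
        rw [h2] at this
        simpa using this
      rw [vecOp_congr_ae (g := fun _ _ => 0) h1]
      simp only [vecOp, variationOp_zero (by linarith : 0 < q)]
      exact lpn_zero hρ0
    refine ⟨fun _ => a, fun _ => a, fun _ => ⟨fun _ => le_rfl, by simp, fun i j _ => by simp,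
      by simp, fun x _ _ => ?_, by simp⟩⟩
    rw [hT]
    exact zero_le
  set l : ℝ≥0∞ := M * avg with hl
  have hM0 : (M : ℝ≥0∞) ≠ 0 := by
    rw [Ne, ENNReal.coe_eq_zero, hM]
    positivity
  have havgt : avg ≠ ∞ := ENNReal.div_ne_top (by rwa [← hFeq]) hL0
  have hl0 : l ≠ 0 := mul_ne_zero hM0 h0
  have hlt' : l ≠ ∞ := ENNReal.mul_ne_top ENNReal.coe_ne_top havgt
  have hFm : Measurable (vecNorm ρ f) := measurable_vecNorm hfm
  obtain ⟨α, β, hcz⟩ := exists_isCZ hFm hFi hl0 hlt'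
  set E := {x | l < vecOp K q ρ f x} ∪ czStar α β ∪
    ({x | l ^ min q ρ < czEta (vecNorm ρ f) (min q ρ) α β x} \ czStar α β) with hE
  have hEvol : l * volume E ≤ D' * ∫⁻ y, vecNorm ρ f y := by
    have e1 := hD₁ f hfm hFi l hl0 hlt'
    have e2 := hcz.mul_measure_enlarged_le a1Measure_volume hFm hFi hl0 hlt'
    have e3 := hD₂ _ l α β hcz hFm hl0 hlt'
    simp only [ENNReal.coe_one, one_pow, mul_one] at e2
    calc _ ≤ l * (volume {x | l < vecOp K q ρ f x} + volume (czStar α β) +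
          volume ({x | l ^ min q ρ < czEta (vecNorm ρ f) (min q ρ) α β x} \ czStar α β)) := by
          refine mul_le_mul' le_rfl ((measure_union_le _ _).trans (add_le_add ?_ le_rfl))
          exact measure_union_le _ _
      _ ≤ D₁ * (∫⁻ y, vecNorm ρ f y) + 18 * (∫⁻ y, vecNorm ρ f y) +
          D₂ * (∫⁻ y, vecNorm ρ f y) := by
          rw [mul_add, mul_add]
          exact add_le_add (add_le_add e1 e2) e3
      _ = _ := by
          rw [hD']
          push_cast
          ring
  have hElt : volume E < ENNReal.ofReal (b - a) / 2 := by
    by_contra hcon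
    rw [not_lt] at hcon
    have e1 : avg * ENNReal.ofReal (b - a) = ∫⁻ y, vecNorm ρ f y := by
      rw [havg, hFeq, ENNReal.div_mul_cancel hL0 ENNReal.ofReal_ne_top]
    have e2 : avg * ENNReal.ofReal (b - a) * M ≤ avg * ENNReal.ofReal (b - a) * (2 * D') := by
      calc _ = 2 * (l * (ENNReal.ofReal (b - a) / 2)) := by
            rw [hl, mul_left_comm, ENNReal.mul_div_cancel (by norm_num) (by norm_num)]
            ring
        _ ≤ 2 * (l * volume E) := by gcongr
        _ ≤ 2 * (D' * ∫⁻ y, vecNorm ρ f y) := by gcongr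
        _ = _ := by
            rw [← e1]
            ring
    rw [ENNReal.mul_le_mul_iff_right (mul_ne_zero h0 hL0)
      (ENNReal.mul_ne_top havgt ENNReal.ofReal_ne_top)] at e2
    have e3 : M ≤ 2 * D' := by exact_mod_cast e2
    rw [hM] at e3
    exact absurd e3 (not_le.2 (lt_add_one _))
  obtain ⟨U, hEU, hUo, hUlt⟩ := Set.exists_isOpen_lt_of_lt E _ hElt
  have hUI : volume (U ∩ Ioo a b) < ENNReal.ofReal (b - a) / 2 :=
    (measure_mono inter_subset_left).trans_lt hUlt
  obtain ⟨c, d, hcd, hdisj, heq, hend⟩ := exists_components (hUo.inter isOpen_Ioo)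
    (ne_top_of_lt hUI)
  have hsub : ∀ n, Ioo (c n) (d n) ⊆ Ioo a b := fun n y hy => by
    have : y ∈ U ∩ Ioo a b := by
      rw [heq]
      exact mem_iUnion.2 ⟨n, hy⟩
    exact this.2
  have hgood : ∀ x ∉ U, vecOp K q ρ f x ≤ l ∧ x ∉ czStar α β ∧
      czEta (vecNorm ρ f) (min q ρ) α β x ≤ l ^ min q ρ := fun x hx => by
    have hxE : x ∉ E := fun h => hx (hEU h)
    simp only [hE, mem_union, Set.mem_sdiff, mem_ofPred_eq, not_or, not_and, not_not,
      not_lt] at hxE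
    refine ⟨hxE.1.1, hxE.1.2, ?_⟩
    by_contra hcon
    exact hxE.1.2 (hxE.2 (not_le.1 hcon))
  refine ⟨c, d, fun _ => ⟨hcd, hsub, hdisj, ?_, ?_, ?_⟩⟩
  · rw [← heq]
    exact hUI.le
  · intro x hx hxn
    rw [← heq] at hxn
    have hxU : x ∉ U := fun h => hxn ⟨h, hx⟩
    refine (hgood x hxU).1.trans ?_
    push_cast
    rw [hl, mul_add, mul_one, add_mul]
    exact le_add_self
  · intro n ξ hξ
    have hlt2 : c n < d n := hξ.1.trans hξ.2
    obtain ⟨hac, hdb⟩ := (Ioo_subset_Ioo_iff hlt2).1 (hsub n)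
    -- If both endpoints were in `U`, neither could lie in (a, b), so the child would be all of (a,
    -- b), against the measure bound for `U`.
    have hx : ∃ x, (x = c n ∨ x = d n) ∧ x ∉ U := by
      by_contra hcon
      push Not at hcon
      have hcU := hcon (c n) (Or.inl rfl)
      have hdU := hcon (d n) (Or.inr rfl)
      have h1 : c n ∉ Ioo a b := fun h => (hend n hlt2).1 ⟨hcU, h⟩
      have h2 : d n ∉ Ioo a b := fun h => (hend n hlt2).2 ⟨hdU, h⟩
      have h3 : c n = a := by
        by_contra hne
        exact h1 ⟨lt_of_le_of_ne hac (Ne.symm hne), by linarith⟩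
      have h4 : d n = b := by
        by_contra hne
        exact h2 ⟨by linarith, lt_of_le_of_ne hdb hne⟩
      have h5 : Ioo a b ⊆ U ∩ Ioo a b := by
        rw [heq]
        refine subset_trans ?_ (subset_iUnion _ n)
        rw [h3, h4]
      have h6 := (measure_mono (μ := volume) h5).trans_lt hUI
      rw [Real.volume_Ioo] at h6
      exact absurd h6 (not_lt.2 ENNReal.half_le_self)
    obtain ⟨x, hxcd, hxU⟩ := hx
    obtain ⟨g1, g2, g3⟩ := hgood x hxU
    have h1 := hD₃ f l α β hfm hFi hlt' hcz x g2 g3 g1 (c n) (d n) ξ hxcd hξ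
    have hfa : ∀ k, Admissible (f k) := admissible_of_vecNorm hρ0 hfm hFi
    have h2 : f = fun k y => vecRestrict f (dil (c n) (d n))ᶜ k y +
        vecRestrict f₀ (dil (c n) (d n)) k y := by
      funext k y
      have h3 : y ∈ dil (c n) (d n) → y ∈ dil a b := fun h => dil_mono hlt2 (hsub n) h
      by_cases hy : y ∈ dil (c n) (d n)
      · simp [vecRestrict, hf, hy, h3 hy]
      · simp [vecRestrict, hy]
    have h4 : ∀ k, Admissible (vecRestrict f₀ (dil (c n) (d n)) k) := fun k =>
      (admissible_of_vecNorm hρ0 hf₀ hF₀ k).indicator (hdilm _ _)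
    have h5 := vecOp_add_le hK (fun k => (hfa k).indicator (hdilm (c n) (d n)).compl) h4 hq.le
      hρ.le ξ
    have h6 : vecOp K q ρ f ξ = vecOp K q ρ (fun k y => vecRestrict f (dil (c n) (d n))ᶜ k y +
        vecRestrict f₀ (dil (c n) (d n)) k y) ξ := by rw [← h2]
    rw [h6]
    refine h5.trans (add_le_add (h1.trans ?_) le_rfl)
    push_cast
    rw [hl, mul_add, mul_one, add_mul, mul_left_comm, ← mul_assoc]
    exact le_self_add

/-- Pointwise domination of the `ℓ^ρ`-valued variation operator by a sparse operator. -/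
theorem exists_sparse_domination (hK : KernelBounds K δ C) (hq : 1 < q) (hρ : 1 < ρ)
    (hB : StrongBound K q ρ volume) : ∃ D : ℝ≥0, ∀ f : ℕ → ℝ → ℂ, (∀ k, Measurable (f k)) →
    ∫⁻ y, vecNorm ρ f y ≠ ∞ → ∀ a b : ℝ, a ≤ b →
      ∃ (α β : List ℕ → ℝ) (E : List ℕ → Set ℝ), (∀ L, α L ≤ β L) ∧
        (∀ L, E L ⊆ Ioo (α L) (β L)) ∧ (∀ L, MeasurableSet (E L)) ∧
        Pairwise (Function.onFun Disjoint E) ∧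
        (∀ L, ENNReal.ofReal (β L - α L) ≤ 2 * volume (E L)) ∧
        ∀ᵐ x, x ∈ Ioo a b → vecOp K q ρ (vecRestrict f (dil a b)) x ≤ D * ∑' L,
          (Ioo (α L) (β L)).indicator (fun _ =>
            (∫⁻ y in dil (α L) (β L), vecNorm ρ f y) / ENNReal.ofReal (β L - α L)) x := by
  classical
  obtain ⟨D, hD⟩ := exists_sparse_step hK hq hρ hB
  refine ⟨D, fun f hf hF a₀ b₀ hab₀ => ?_⟩
  choose c d hcd using hD f hf hF
  -- The head of the list is the most recent choice, so the parent of `n :: L` is `L`, and ancestors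
  -- are the suffixes.
  set node : List ℕ → ℝ × ℝ := fun L =>
    L.foldr (fun n p => (c p.1 p.2 n, d p.1 p.2 n)) (a₀, b₀) with hnode
  set Q : List ℕ → Set ℝ := fun L => Ioo (node L).1 (node L).2 with hQ
  have hnode_cons : ∀ n L, node (n :: L) =
    (c (node L).1 (node L).2 n, d (node L).1 (node L).2 n) := fun n L => rfl
  have hle : ∀ L, (node L).1 ≤ (node L).2 := by
    intro L
    induction L with
    | nil => exact hab₀
    | cons n L ih => exact (hcd _ _ ih).1 n
  have hsub : ∀ n L, Q (n :: L) ⊆ Q L := fun n L => (hcd _ _ (hle L)).2.1 n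
  have hdisj : ∀ L, Pairwise (Function.onFun Disjoint fun n => Q (n :: L)) := fun L =>
    (hcd _ _ (hle L)).2.2.1
  have hvol : ∀ L, volume (⋃ n, Q (n :: L)) ≤ volume (Q L) / 2 := fun L => by
    have := (hcd _ _ (hle L)).2.2.2.1
    rwa [← Real.volume_Ioo] at this
  have hQm : ∀ L, MeasurableSet (Q L) := fun L => measurableSet_Ioo
  set E : List ℕ → Set ℝ := fun L => Q L \ ⋃ n, Q (n :: L) with hE
  -- Intervals of one generation are disjoint as indexed families, so a point has at most one
  -- address of each length.
  have huniq : ∀ L L' : List ℕ, L.length = L'.length → ∀ x, x ∈ Q L → x ∈ Q L' → L = L' := by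
    intro L
    induction L with
    | nil =>
      intro L' h x _ _
      exact (List.length_eq_zero_iff.1 h.symm).symm
    | cons n L ih =>
      rintro (_ | ⟨n', L'⟩) h x hx hx'
      · simp at h
      have h1 : L = L' := ih L' (by simpa using h) x (hsub _ _ hx) (hsub _ _ hx')
      subst h1
      congr 1
      by_contra hne
      exact Set.disjoint_left.1 (hdisj L hne) hx hx'
  have hanc : ∀ L M : List ℕ, ∀ x, x ∈ Q (M ++ L) → x ∈ Q L := by
    intro L M x
    induction M with
    | nil => exact id
    | cons n M ih => exact fun h => ih (hsub _ _ h)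
  have hEdisj' : ∀ L L' : List ℕ, L.length < L'.length → Disjoint (E L) (E L') := by
    intro L L' hlen
    rw [Set.disjoint_left]
    intro x hx hx'
    have hsplit : L' = L'.take (L'.length - L.length - 1) ++ L'.drop (L'.length - L.length - 1) :=
      (List.take_append_drop _ _).symm
    have hxd : x ∈ Q (L'.drop (L'.length - L.length - 1)) :=
      hanc _ (L'.take (L'.length - L.length - 1)) x (by rw [← hsplit]; exact hx'.1)
    have hdl : (L'.drop (L'.length - L.length - 1)).length = L.length + 1 := by
      rw [List.length_drop]
      omega
    obtain ⟨m, L₀, hmL⟩ := List.exists_cons_of_length_eq_add_one hdl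
    rw [hmL] at hxd hdl
    have h1 : L₀ = L := huniq L₀ L (by simpa using hdl) x (hsub _ _ hxd) hx.1
    subst h1
    exact hx.2 (mem_iUnion.2 ⟨m, hxd⟩)
  have hEdisj : Pairwise (Function.onFun Disjoint E) := by
    intro L L' hne
    rcases lt_trichotomy L.length L'.length with h | h | h
    · exact hEdisj' L L' h
    · rw [Function.onFun, Set.disjoint_left]
      exact fun x hx hx' => hne (huniq L L' h x hx.1 hx'.1)
    · exact (hEdisj' L' L h).symm
  have hhalf : ∀ L, ENNReal.ofReal ((node L).2 - (node L).1) ≤ 2 * volume (E L) := fun L => by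
    rw [← Real.volume_Ioo]
    have h1 : volume (Q L) ≤ volume (E L) + volume (Q L) / 2 := by
      refine (measure_mono (?_ : Q L ⊆ E L ∪ ⋃ n, Q (n :: L))).trans
        ((measure_union_le _ _).trans (add_le_add le_rfl (hvol L)))
      intro x hx
      by_cases h : x ∈ ⋃ n, Q (n :: L)
      · exact Or.inr h
      · exact Or.inl ⟨hx, h⟩
    have hfin : volume (Q L) / 2 ≠ ∞ := by
      refine ENNReal.div_ne_top ?_ (by norm_num)
      rw [hQ, Real.volume_Ioo]
      exact ENNReal.ofReal_ne_top
    have h2 : volume (Q L) / 2 ≤ volume (E L) := by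
      refine (ENNReal.add_le_add_iff_right hfin).1 ?_
      rwa [ENNReal.add_halves]
    change volume (Q L) ≤ _
    calc volume (Q L) = 2 * (volume (Q L) / 2) :=
          (ENNReal.mul_div_cancel (by norm_num) (by norm_num)).symm
      _ ≤ _ := by gcongr
  set avg : List ℕ → ℝ≥0∞ := fun L => (∫⁻ y in dil (node L).1 (node L).2, vecNorm ρ f y) /
    ENNReal.ofReal ((node L).2 - (node L).1) with havg
  -- Unrolling the step along the ancestors of `L` costs one average for each strict ancestor and
  -- leaves the operator localised to `L`.
  have hchain : ∀ L x, x ∈ Q L → ∃ S : Finset (List ℕ),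
      (∀ M ∈ S, M.length < L.length ∧ x ∈ Q M) ∧
      vecOp K q ρ (vecRestrict f (dil a₀ b₀)) x ≤ D * ∑ M ∈ S, avg M +
        vecOp K q ρ (vecRestrict f (dil (node L).1 (node L).2)) x := by
    intro L x
    induction L with
    | nil => exact fun _ => ⟨∅, by simp, by simp [hnode]⟩
    | cons n L ih =>
      intro hx
      obtain ⟨S, hS, hle'⟩ := ih (hsub _ _ hx)
      have hnot : L ∉ S := fun h => (hS L h).1.false
      refine ⟨insert L S, ?_, ?_⟩
      · intro M hM
        rw [Finset.mem_insert] at hM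
        rcases hM with rfl | hM
        · exact ⟨by simp, hsub _ _ hx⟩
        · exact ⟨(hS M hM).1.trans (by simp), (hS M hM).2⟩
      · rw [Finset.sum_insert hnot, mul_add, add_assoc, add_left_comm]
        refine hle'.trans (add_le_add le_rfl ?_)
        exact (hcd _ _ (hle L)).2.2.2.2.2 n x hx
  set Bad : Set ℝ := {x | x ∈ Q [] ∧ ∀ L, x ∉ E L} with hBad
  -- A point in no `E L` belongs to every generation, and the measure of the generations at least
  -- halves each time.
  have hBad0 : volume Bad = 0 := by
    set Ω : ℕ → Set ℝ := fun n => ⋃ L : {L : List ℕ // L.length = n}, Q L with hΩ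
    have h1 : ∀ n, Bad ⊆ Ω n := by
      intro n x hx
      induction n with
      | zero => exact mem_iUnion.2 ⟨⟨[], rfl⟩, hx.1⟩
      | succ n ih =>
        obtain ⟨⟨L, hL⟩, hxL⟩ := mem_iUnion.1 ih
        have h2 : x ∈ ⋃ n, Q (n :: L) := by
          by_contra h
          exact hx.2 L ⟨hxL, h⟩
        obtain ⟨m, hm⟩ := mem_iUnion.1 h2
        exact mem_iUnion.2 ⟨⟨m :: L, by simp [hL]⟩, hm⟩
    have h2 : ∀ n, volume (Ω n) ≤ 2⁻¹ ^ n * volume (Q []) := by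
      intro n
      induction n with
      | zero =>
        rw [pow_zero, one_mul]
        refine measure_mono (iUnion_subset ?_)
        rintro ⟨L, hL⟩
        obtain rfl := List.length_eq_zero_iff.1 hL
        exact subset_rfl
      | succ n ih =>
        have h3 : Ω (n + 1) ⊆ ⋃ L : {L : List ℕ // L.length = n}, ⋃ m, Q (m :: L.1) := by
          refine iUnion_subset ?_
          rintro ⟨L, hL⟩
          obtain ⟨m, L', rfl⟩ := List.exists_cons_of_length_eq_add_one hL
          exact fun x hx => mem_iUnion.2 ⟨⟨L', by simpa using hL⟩, mem_iUnion.2 ⟨m, hx⟩⟩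
        calc volume (Ω (n + 1)) ≤ ∑' L : {L : List ℕ // L.length = n}, volume (Q L.1) / 2 :=
              (measure_mono h3).trans ((measure_iUnion_le _).trans
                (ENNReal.tsum_le_tsum fun L => hvol L.1))
          _ = 2⁻¹ * volume (Ω n) := by
              simp_rw [div_eq_mul_inv]
              have hm : volume (Ω n) = ∑' L : {L : List ℕ // L.length = n}, volume (Q L.1) := by
                refine measure_iUnion ?_ fun L => hQm L.1
                intro L L' hne
                rw [Function.onFun, Set.disjoint_left]
                exact fun x hx hx' => hne (Subtype.ext
                  (huniq L L' (L.2.trans L'.2.symm) x hx hx'))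
              rw [ENNReal.tsum_mul_right, mul_comm, hm]
          _ ≤ 2⁻¹ * (2⁻¹ ^ n * volume (Q [])) := by gcongr
          _ = _ := by ring
    have hlim : Tendsto (fun n : ℕ => (2⁻¹ : ℝ≥0∞) ^ n * volume (Q [])) atTop (𝓝 0) := by
      have h3 := ENNReal.tendsto_pow_atTop_nhds_zero_of_lt_one (r := (2⁻¹ : ℝ≥0∞)) (by simp)
      have h4 : volume (Q []) ≠ ∞ := by
        rw [hQ, Real.volume_Ioo]
        exact ENNReal.ofReal_ne_top
      simpa using ENNReal.Tendsto.mul_const h3 (Or.inr h4)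
    exact le_antisymm (ge_of_tendsto' hlim fun n => (measure_mono (h1 n)).trans (h2 n)) zero_le
  refine ⟨fun L => (node L).1, fun L => (node L).2, E, hle, fun L => sdiff_subset,
    fun L => (hQm L).diff (MeasurableSet.iUnion fun n => hQm _), hEdisj, hhalf, ?_⟩
  have hae : ∀ᵐ x, x ∉ Bad := by
    rw [ae_iff]
    simpa using hBad0
  filter_upwards [hae] with x hxB hx
  have hex : ∃ L, x ∈ E L := by
    by_contra h
    push Not at h
    exact hxB ⟨hx, h⟩
  obtain ⟨L, hL⟩ := hex
  obtain ⟨S, hS, hSle⟩ := hchain L x hL.1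
  have h1 := (hcd _ _ (hle L)).2.2.2.2.1 x hL.1 hL.2
  have hnot : L ∉ S := fun h => (hS L h).1.false
  calc _ ≤ D * ∑ M ∈ S, avg M + D * avg L := hSle.trans (add_le_add le_rfl h1)
    _ = D * ∑ M ∈ insert L S, (Q M).indicator (fun _ => avg M) x := by
        rw [Finset.sum_insert hnot, indicator_of_mem hL.1, mul_add, add_comm]
        congr 2
        exact Finset.sum_congr rfl fun M hM => (indicator_of_mem (hS M hM).2 (fun _ => avg M)).symm
    _ ≤ _ := by
        gcongr
        exact ENNReal.sum_le_tsum _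

end Sparse

end VqCZ

end

/-! ### The Carleson embedding theorem. -/

noncomputable section

namespace VqCZ

section Carleson

open Finset in
/-- A maximal inequality for finitely many intervals with respect to a doubling measure. -/
lemma mul_measure_biUnion_le {ι : Type*} {μ : Measure ℝ} {c : ℝ≥0∞}
    (hμ : ∀ m r : ℝ, 0 < r → μ (Metric.closedBall m (5 * r)) ≤ c * μ (Metric.closedBall m r))
    (hfin : ∀ m r : ℝ, μ (Metric.closedBall m r) ≠ ∞)
    {φ : ℝ → ℝ≥0∞} (hφ : Measurable φ) (S : Finset ι) (m r : ι → ℝ) (hr : ∀ i ∈ S, 0 < r i)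
    {t : ℝ≥0∞} (ht : t ≠ ∞) (hS : ∀ i ∈ S, t * μ (Metric.closedBall (m i) (r i)) ≤
      ∫⁻ y in Metric.closedBall (m i) (r i), φ y ∂μ) :
    t * μ (⋃ i ∈ S, Metric.closedBall (m i) (r i)) ≤ 2 * c * ∫⁻ y in {y | t / 2 < φ y}, φ y ∂μ := by
  obtain ⟨R, hR⟩ : ∃ R, ∀ i ∈ (S : Set ι), r i ≤ R := by
    obtain ⟨R, hR⟩ := (S.image r).bddAbove
    exact ⟨R, fun i hi => hR (mem_coe.2 (mem_image_of_mem r hi))⟩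
  obtain ⟨u, huS, hud, hu⟩ :=
    Vitali.exists_disjoint_subfamily_covering_enlargement_closedBall (S : Set ι) m r R hR 5
      (by norm_num)
  have hufin : u.Finite := S.finite_toSet.subset huS
  set U := hufin.toFinset with hU
  have hUS : ∀ i ∈ U, i ∈ S := fun i hi => huS (hufin.mem_toFinset.1 hi)
  have hcov : (⋃ i ∈ S, Metric.closedBall (m i) (r i)) ⊆
      ⋃ i ∈ U, Metric.closedBall (m i) (5 * r i) := by
    refine iUnion₂_subset fun i hi => ?_
    obtain ⟨b, hb, hsub⟩ := hu i hi
    exact hsub.trans (subset_biUnion_of_mem (u := fun i => Metric.closedBall (m i) (5 * r i))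
      (hufin.mem_toFinset.2 hb))
  have hone : ∀ i ∈ U, t * μ (Metric.closedBall (m i) (r i)) ≤
      2 * ∫⁻ y in Metric.closedBall (m i) (r i) ∩ {y | t / 2 < φ y}, φ y ∂μ := by
    intro i hi
    set B := Metric.closedBall (m i) (r i) with hB
    have hBm : MeasurableSet B := Metric.isClosed_closedBall.measurableSet
    have hm : MeasurableSet {y | t / 2 < φ y} := measurableSet_lt measurable_const hφ
    -- The part of φ below t/2 accounts for at most half of t·μ(B) and is absorbed. Retaining only
    -- {φ > t/2} makes the later integration over t converge.
    have h1 : ∫⁻ y in B, φ y ∂μ ≤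
        (∫⁻ y in B ∩ {y | t / 2 < φ y}, φ y ∂μ) + t / 2 * μ B := by
      rw [← lintegral_inter_add_sdiff φ B hm]
      refine add_le_add le_rfl ?_
      calc _ ≤ ∫⁻ _ in B \ {y | t / 2 < φ y}, t / 2 ∂μ :=
            setLIntegral_mono measurable_const fun y hy => not_lt.1 hy.2
        _ ≤ t / 2 * μ B := by
            rw [setLIntegral_const]
            exact mul_le_mul' le_rfl (measure_mono sdiff_subset)
    have h2 : t / 2 * μ B ≤ ∫⁻ y in B ∩ {y | t / 2 < φ y}, φ y ∂μ := by
      have hf : t / 2 * μ B ≠ ∞ :=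
        ENNReal.mul_ne_top (ENNReal.div_lt_top ht two_ne_zero).ne (hfin _ _)
      refine (ENNReal.add_le_add_iff_right hf).1 ?_
      calc _ = t * μ B := by rw [← add_mul, ENNReal.add_halves]
        _ ≤ _ := (hS i (hUS i hi)).trans h1
    calc t * μ B = 2 * (t / 2 * μ B) := by
          rw [← mul_assoc, ENNReal.mul_div_cancel two_ne_zero ENNReal.ofNat_ne_top]
      _ ≤ _ := by gcongr
  calc _ ≤ t * ∑ i ∈ U, μ (Metric.closedBall (m i) (5 * r i)) := by
        gcongr
        exact (measure_mono hcov).trans (measure_biUnion_finset_le _ _)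
    _ ≤ t * ∑ i ∈ U, c * μ (Metric.closedBall (m i) (r i)) := by
        gcongr with i hi
        exact hμ _ _ (hr i (hUS i hi))
    _ = c * ∑ i ∈ U, t * μ (Metric.closedBall (m i) (r i)) := by
        rw [← mul_sum, ← mul_sum]
        ring
    _ ≤ c * ∑ i ∈ U, 2 * ∫⁻ y in Metric.closedBall (m i) (r i) ∩ {y | t / 2 < φ y}, φ y ∂μ := by
        exact mul_le_mul' le_rfl (sum_le_sum hone)
    _ = 2 * c * ∫⁻ y in ⋃ i ∈ U, Metric.closedBall (m i) (r i) ∩ {y | t / 2 < φ y}, φ y ∂μ := by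
        rw [lintegral_biUnion_finset, ← mul_sum]
        · ring
        · intro i hi j hj hne
          exact (hud (hufin.mem_toFinset.1 hi) (hufin.mem_toFinset.1 hj) hne).mono
            inter_subset_left inter_subset_left
        · exact fun i _ => Metric.isClosed_closedBall.measurableSet.inter
            (measurableSet_lt measurable_const hφ)
    _ ≤ _ := by
        refine mul_le_mul' le_rfl (lintegral_mono_set ?_)
        exact iUnion₂_subset fun i _ => inter_subset_right

/-- The layer cake formula for a point mass; the value ∞ is reached by comparison with all finite
values. -/
lemma rpow_eq_lintegral {s : ℝ} (hs : 0 < s) (x : ℝ≥0∞) :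
    x ^ s = ENNReal.ofReal s * ∫⁻ t in Ioi (0 : ℝ),
      {t | ENNReal.ofReal t < x}.indicator (fun t => ENNReal.ofReal (t ^ (s - 1))) t := by
  have hfin : ∀ y : ℝ≥0, (y : ℝ≥0∞) ^ s = ENNReal.ofReal s * ∫⁻ t in Ioi (0 : ℝ),
      {t | ENNReal.ofReal t < y}.indicator (fun t => ENNReal.ofReal (t ^ (s - 1))) t := by
    intro y
    have h := lintegral_rpow_eq_lintegral_meas_lt_mul (Measure.dirac (0 : ℝ))
      (f := fun _ => (y : ℝ)) (Filter.Eventually.of_forall fun _ => y.2) aemeasurable_const hs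
    rw [lintegral_const, measure_univ, mul_one, ← ENNReal.ofReal_rpow_of_nonneg y.coe_nonneg hs.le,
      ENNReal.ofReal_coe_nnreal] at h
    rw [h]
    congr 1
    refine setLIntegral_congr_fun measurableSet_Ioi fun t ht => ?_
    have e : (ENNReal.ofReal t < y) ↔ t < y := by
      rw [← ENNReal.ofReal_coe_nnreal, ENNReal.ofReal_lt_ofReal_iff_of_nonneg (le_of_lt ht)]
    by_cases hty : t < y
    · simp [indicator, e, hty]
    · simp [indicator, e, hty]
  induction x with
  | coe y => exact hfin y
  | top =>
    rw [ENNReal.top_rpow_of_pos hs]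
    refine (ENNReal.eq_top_of_forall_nnreal_le fun y => ?_).symm
    have h1 : (y : ℝ≥0∞) = ((y ^ s⁻¹ : ℝ≥0) : ℝ≥0∞) ^ s := by
      rw [← ENNReal.coe_rpow_of_nonneg _ hs.le, NNReal.rpow_inv_rpow hs.ne']
    rw [h1, hfin]
    refine mul_le_mul' le_rfl (lintegral_mono fun t => ?_)
    refine indicator_le_indicator_of_subset (fun t ht => ?_) (fun _ => zero_le) _
    exact ENNReal.ofReal_lt_top

/-- The Carleson embedding theorem for finitely many intervals containing disjoint sets. -/
lemma sum_average_rpow_le {ι : Type*} {μ : Measure ℝ} [SFinite μ] {c : ℝ≥0∞} {p : ℝ} (hp : 1 < p)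
    (hμ : ∀ m r : ℝ, 0 < r → μ (Metric.closedBall m (5 * r)) ≤ c * μ (Metric.closedBall m r))
    (hfin : ∀ m r : ℝ, μ (Metric.closedBall m r) ≠ ∞)
    {φ : ℝ → ℝ≥0∞} (hφ : Measurable φ) (S : Finset ι) (m r : ι → ℝ) (hr : ∀ i ∈ S, 0 < r i)
    (E : ι → Set ℝ) (hE : ∀ i, E i ⊆ Metric.closedBall (m i) (r i)) (hEm : ∀ i, MeasurableSet (E i))
    (hEd : Pairwise (Function.onFun Disjoint E)) :
    ∑ i ∈ S, ((∫⁻ y in Metric.closedBall (m i) (r i), φ y ∂μ) /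
        μ (Metric.closedBall (m i) (r i))) ^ p * μ (E i) ≤
      ENNReal.ofReal p * (2 * c) * ((ENNReal.ofReal (p - 1))⁻¹ * 2 ^ (p - 1)) *
        ∫⁻ y, φ y ^ p ∂μ := by
  classical
  have hp0 : 0 < p := by linarith
  set x : ι → ℝ≥0∞ := fun i => (∫⁻ y in Metric.closedBall (m i) (r i), φ y ∂μ) /
        μ (Metric.closedBall (m i) (r i)) with hx
  have hmeas : ∀ i, Measurable ({t | ENNReal.ofReal t < x i}.indicator
      fun t => ENNReal.ofReal (t ^ (p - 1))) := fun i =>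
    (by fun_prop : Measurable fun t : ℝ => ENNReal.ofReal (t ^ (p - 1))).indicator
      (measurableSet_lt ENNReal.measurable_ofReal measurable_const)
  -- Disjointness of the sets `E i` bounds the sum of their measures over intervals of average above
  -- t by the measure of the union of these intervals, to which the maximal inequality applies.
  have hlevel : ∀ t : ℝ, 0 < t →
      ∑ i ∈ S, {t | ENNReal.ofReal t < x i}.indicator (fun t => ENNReal.ofReal (t ^ (p - 1))) t *
        μ (E i) ≤ 2 * c * ∫⁻ y, φ y * {t | ENNReal.ofReal t < 2 * φ y}.indicator
          (fun t => ENNReal.ofReal (t ^ (p - 1 - 1))) t ∂μ := by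
    intro t ht
    set T := S.filter fun i => ENNReal.ofReal t < x i with hT
    have h1 := mul_measure_biUnion_le hμ hfin hφ T m r
      (fun i hi => hr i (Finset.mem_filter.1 hi).1) (t := ENNReal.ofReal t) ENNReal.ofReal_ne_top
      (fun i hi => ENNReal.mul_le_of_le_div (Finset.mem_filter.1 hi).2.le)
    have h2 : ∑ i ∈ T, μ (E i) ≤ μ (⋃ i ∈ T, Metric.closedBall (m i) (r i)) := by
      rw [← measure_biUnion_finset (fun i _ j _ hne => hEd hne) fun i _ => hEm i]
      exact measure_mono (iUnion₂_mono fun i _ => hE i)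
    have e1 : t ^ (p - 1) = t ^ (p - 1 - 1) * t := by
      rw [← Real.rpow_add_one ht.ne']
      ring_nf
    calc _ = ∑ i ∈ T, ENNReal.ofReal (t ^ (p - 1)) * μ (E i) := by
          rw [hT, Finset.sum_filter]
          refine Finset.sum_congr rfl fun i _ => ?_
          simp only [indicator, mem_ofPred_eq]
          split_ifs <;> simp
      _ = ENNReal.ofReal (t ^ (p - 1 - 1)) * (ENNReal.ofReal t * ∑ i ∈ T, μ (E i)) := by
          rw [← Finset.mul_sum, e1, ENNReal.ofReal_mul (by positivity), mul_assoc]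
      _ ≤ ENNReal.ofReal (t ^ (p - 1 - 1)) *
          (2 * c * ∫⁻ y in {y | ENNReal.ofReal t / 2 < φ y}, φ y ∂μ) :=
          mul_le_mul' le_rfl ((mul_le_mul' le_rfl h2).trans h1)
      _ = _ := by
          rw [mul_left_comm]
          congr 1
          rw [← lintegral_const_mul _ hφ,
            ← lintegral_indicator (measurableSet_lt measurable_const hφ)]
          refine lintegral_congr fun y => ?_
          have e2 : ENNReal.ofReal t / 2 < φ y ↔ ENNReal.ofReal t < 2 * φ y := by
            rw [ENNReal.div_lt_iff (by simp) (by simp), mul_comm]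
          simp only [indicator, mem_ofPred_eq, e2]
          split_ifs <;> simp [mul_comm]
  have hjoint : Measurable (Function.uncurry fun (t : ℝ) (y : ℝ) =>
      φ y * {t | ENNReal.ofReal t < 2 * φ y}.indicator
          (fun t => ENNReal.ofReal (t ^ (p - 1 - 1))) t) := by
    have : (Function.uncurry fun (t : ℝ) (y : ℝ) => φ y * {t | ENNReal.ofReal t < 2 * φ y}.indicator
          (fun t => ENNReal.ofReal (t ^ (p - 1 - 1))) t) = fun z : ℝ × ℝ => φ z.2 *
          {z : ℝ × ℝ | ENNReal.ofReal z.1 < 2 * φ z.2}.indicator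
          (fun z => ENNReal.ofReal (z.1 ^ (p - 1 - 1))) z := by
      ext z
      simp [Function.uncurry, indicator]
    rw [this]
    refine (hφ.comp measurable_snd).mul (Measurable.indicator (by fun_prop) ?_)
    exact measurableSet_lt (by fun_prop) (by fun_prop)
  calc _ = ∑ i ∈ S, ENNReal.ofReal p * ∫⁻ t in Ioi (0 : ℝ), {t | ENNReal.ofReal t < x i}.indicator
          (fun t => ENNReal.ofReal (t ^ (p - 1))) t * μ (E i) := by
        refine Finset.sum_congr rfl fun i _ => ?_
        rw [rpow_eq_lintegral hp0, mul_assoc, lintegral_mul_const _ (hmeas i)]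
    _ = ENNReal.ofReal p * ∫⁻ t in Ioi (0 : ℝ), ∑ i ∈ S, {t | ENNReal.ofReal t < x i}.indicator
          (fun t => ENNReal.ofReal (t ^ (p - 1))) t * μ (E i) := by
        rw [← Finset.mul_sum, lintegral_finsetSum _ fun i _ => (hmeas i).mul_const _]
    _ ≤ ENNReal.ofReal p * ∫⁻ t in Ioi (0 : ℝ), 2 * c * ∫⁻ y, φ y *
          {t | ENNReal.ofReal t < 2 * φ y}.indicator
          (fun t => ENNReal.ofReal (t ^ (p - 1 - 1))) t ∂μ := by
        gcongr 1
        exact setLIntegral_mono' measurableSet_Ioi hlevel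
    -- Tonelli: the inner integral of t^(p-2) over 0 < t < 2φ(y) equals (2φ(y))^(p-1)/(p-1).
    _ = ENNReal.ofReal p * (2 * c) * ∫⁻ y, (∫⁻ t in Ioi (0 : ℝ), φ y *
          {t | ENNReal.ofReal t < 2 * φ y}.indicator
          (fun t => ENNReal.ofReal (t ^ (p - 1 - 1))) t) ∂μ := by
        have h := hjoint.lintegral_prod_right' (ν := μ)
        simp only [Function.uncurry_apply_pair] at h
        rw [lintegral_const_mul _ h, ← mul_assoc, lintegral_lintegral_swap hjoint.aemeasurable]
    _ = ENNReal.ofReal p * (2 * c) * ∫⁻ y, (ENNReal.ofReal (p - 1))⁻¹ * 2 ^ (p - 1) *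
          φ y ^ p ∂μ := by
        congr 1
        refine lintegral_congr fun y => ?_
        have h0 : ENNReal.ofReal (p - 1) ≠ 0 := by simpa using hp
        have h1 := rpow_eq_lintegral (sub_pos.2 hp) (2 * φ y)
        have h2 : ∫⁻ t in Ioi (0 : ℝ), {t | ENNReal.ofReal t < 2 * φ y}.indicator
            (fun t => ENNReal.ofReal (t ^ (p - 1 - 1))) t =
            (ENNReal.ofReal (p - 1))⁻¹ * (2 * φ y) ^ (p - 1) := by
          rw [h1, ← mul_assoc, ENNReal.inv_mul_cancel h0 ENNReal.ofReal_ne_top, one_mul]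
        rw [lintegral_const_mul _ (Measurable.indicator (by fun_prop)
          (measurableSet_lt ENNReal.measurable_ofReal measurable_const)), h2,
          ENNReal.mul_rpow_of_nonneg _ _ (sub_pos.2 hp).le]
        have e : φ y ^ p = φ y * φ y ^ (p - 1) := by
          conv_rhs => rw [← ENNReal.rpow_one (φ y), ← ENNReal.rpow_mul,
            ← ENNReal.rpow_add_of_nonneg _ _ zero_le_one (by linarith)]
          ring_nf
        rw [e]
        ring
    _ = _ := by
        rw [lintegral_const_mul _ (hφ.pow_const p)]
        ring

end Carleson

end VqCZ

end

/-! ### Densities of `A_p` weights. -/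

noncomputable section

namespace VqCZ

/-- Finite positive measurable densities satisfying the `A_p` condition. -/
structure ApDensity (p : ℝ) (v : ℝ → ℝ≥0∞) (C : ℝ≥0) : Prop where
  measurable : Measurable v
  ne_zero : ∀ x, v x ≠ 0
  ne_top : ∀ x, v x ≠ ∞
  lintegral_ne_top : ∀ a b : ℝ, ∫⁻ x in Icc a b, v x ≠ ∞
  mul_le : ∀ a b : ℝ, a < b → (∫⁻ x in Icc a b, v x) *
    (∫⁻ x in Icc a b, v x ^ (-(1 / (p - 1)))) ^ (p - 1) ≤ C * ENNReal.ofReal (b - a) ^ p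

section Density

variable {p : ℝ} {v : ℝ → ℝ≥0∞} {C : ℝ≥0}

/-- A null set is modified, with the value 1 there, so that v is measurable, positive and finite
everywhere; its negative powers can then be multiplied and cancelled pointwise. -/
lemma exists_density {w : ℝ → ℝ} (hw : IsWeight w) : ∃ v : ℝ → ℝ≥0∞, Measurable v ∧
    (∀ x, v x ≠ 0) ∧ (∀ x, v x ≠ ∞) ∧ (fun x => ENNReal.ofReal (w x)) =ᵐ[volume] v ∧
    ∀ a b : ℝ, ∫⁻ x in Icc a b, v x ≠ ∞ := by
  have hm := hw.1.aestronglyMeasurable.aemeasurable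
  set u := hm.mk w
  have hu : Measurable u := hm.measurable_mk
  have hae : (fun x => ENNReal.ofReal (w x)) =ᵐ[volume]
      fun x => if 0 < u x then ENNReal.ofReal (u x) else 1 := by
    filter_upwards [hm.ae_eq_mk, hw.2] with x h1 h2
    change w x = u x at h1
    rw [← h1, if_pos h2]
  refine ⟨fun x => if 0 < u x then ENNReal.ofReal (u x) else 1, ?_, fun x => ?_, fun x => ?_,
    hae, fun a b => ?_⟩
  · exact Measurable.ite (measurableSet_lt measurable_const hu) hu.ennreal_ofReal measurable_const
  · dsimp only
    split_ifs with h
    · simpa using h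
    · exact one_ne_zero
  · dsimp only
    split_ifs with h
    · exact ENNReal.ofReal_ne_top
    · exact ENNReal.one_ne_top
  · rw [← lintegral_congr_ae (ae_restrict_of_ae hae)]
    exact ((hw.1.integrableOn_isCompact isCompact_Icc).lintegral_lt_top).ne

lemma IsApWeight.exists_apDensity {w : ℝ → ℝ} (hw : IsApWeight p w) :
    ∃ v C, ApDensity p v C ∧ weightMeasure w = volume.withDensity v := by
  obtain ⟨v, hv, h0, ht, hae, hfin⟩ := exists_density hw.1
  obtain ⟨C, hC⟩ := hw.2
  refine ⟨v, C, ⟨hv, h0, ht, hfin, fun a b hab => ?_⟩, withDensity_congr_ae hae⟩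
  have h1 : (fun x => ENNReal.ofReal (w x) ^ (-(1 / (p - 1)))) =ᵐ[volume]
      fun x => v x ^ (-(1 / (p - 1))) := by
    filter_upwards [hae] with x hx
    rw [hx]
  rw [← lintegral_congr_ae (ae_restrict_of_ae hae), ← lintegral_congr_ae (ae_restrict_of_ae h1)]
  exact hC a b hab

namespace ApDensity

lemma lintegral_ne_zero (hv : ApDensity p v C) {E : Set ℝ} (hE : volume E ≠ 0) :
    ∫⁻ x in E, v x ≠ 0 := by
  rw [Ne, lintegral_eq_zero_iff hv.measurable]
  intro h
  have h2 : ∀ᵐ x ∂volume.restrict E, False := by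
    filter_upwards [h] with x hx
    exact hv.ne_zero x hx
  rw [ae_iff] at h2
  simp at h2
  exact hE h2

/-- The dual density of an `A_p` density is an `A_{p'}` density. -/
lemma dual (hp : 1 < p) (hv : ApDensity p v C) :
    ApDensity (p / (p - 1)) (fun x => v x ^ (-(1 / (p - 1)))) (C ^ (1 / (p - 1))) := by
  have hp1 : 0 < p - 1 := sub_pos.2 hp
  have e1 : p / (p - 1) - 1 = 1 / (p - 1) := by
    field_simp
    ring
  have e2 : ∀ x, (v x ^ (-(1 / (p - 1)))) ^ (-(1 / (p / (p - 1) - 1))) = v x := fun x => by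
    rw [← ENNReal.rpow_mul, e1]
    convert ENNReal.rpow_one (v x)
    field_simp
  have hle : ∀ a b : ℝ, a < b → (∫⁻ x in Icc a b, v x ^ (-(1 / (p - 1)))) *
      (∫⁻ x in Icc a b, v x) ^ (1 / (p - 1)) ≤
        (C ^ (1 / (p - 1)) : ℝ≥0) * ENNReal.ofReal (b - a) ^ (p / (p - 1)) := by
    intro a b hab
    have h := ENNReal.rpow_le_rpow (hv.mul_le a b hab) (one_div_pos.2 hp1).le
    rw [ENNReal.mul_rpow_of_nonneg _ _ (one_div_pos.2 hp1).le,
      ENNReal.mul_rpow_of_nonneg _ _ (one_div_pos.2 hp1).le, ← ENNReal.rpow_mul,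
      ← ENNReal.rpow_mul, mul_one_div_cancel hp1.ne', ENNReal.rpow_one, mul_comm,
      mul_one_div, ← ENNReal.coe_rpow_of_nonneg _ (one_div_pos.2 hp1).le] at h
    exact h
  refine ⟨hv.measurable.pow_const _, fun x => ?_, fun x => ?_, fun a b => ?_, fun a b hab => ?_⟩
  · exact (ENNReal.rpow_pos (pos_iff_ne_zero.2 (hv.ne_zero x)) (hv.ne_top x)).ne'
  · rw [ENNReal.rpow_neg]
    exact ENNReal.inv_ne_top.2
      (ENNReal.rpow_pos (pos_iff_ne_zero.2 (hv.ne_zero x)) (hv.ne_top x)).ne'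
  · rcases lt_or_ge a b with hab | hab
    -- The `A_p` inequality itself forces the dual integral to be finite, because the integral of v
    -- over a nondegenerate interval is positive.
    · intro htop
      have h := hle a b hab
      rw [htop, ENNReal.top_mul] at h
      · refine ENNReal.mul_ne_top ENNReal.coe_ne_top ?_ (top_le_iff.1 h)
        exact ENNReal.rpow_ne_top_of_nonneg (by positivity) ENNReal.ofReal_ne_top
      · refine (ENNReal.rpow_pos (pos_iff_ne_zero.2 (hv.lintegral_ne_zero ?_))
          (hv.lintegral_ne_top a b)).ne'
        simpa using hab
    · have : volume (Icc a b) = 0 := by simpa using hab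
      rw [setLIntegral_measure_zero _ _ this]
      exact ENNReal.zero_ne_top
  · simp_rw [e2, e1]
    exact hle a b hab

/-- Hölder applied to 1 = v^(1/p)·v^(-1/p). It is a converse to the `A_p` inequality, and combining
the two compares the measure of an interval with that of a large subset. -/
lemma volume_rpow_le (hp : 1 < p) (hv : ApDensity p v C) (E : Set ℝ) :
    volume E ^ p ≤ (∫⁻ x in E, v x) * (∫⁻ x in E, v x ^ (-(1 / (p - 1)))) ^ (p - 1) := by
  have hp1 : 0 < p - 1 := sub_pos.2 hp
  have hp0 : 0 < p := by linarith
  have hpq : p.HolderConjugate (p / (p - 1)) := Real.HolderConjugate.conjExponent hp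
  have h := ENNReal.lintegral_mul_le_Lp_mul_Lq (volume.restrict E) hpq
    (hv.measurable.pow_const (1 / p)).aemeasurable
    (hv.measurable.pow_const (-(1 / p))).aemeasurable
  have e1 : ∀ x, (v x ^ (1 / p)) ^ p = v x := fun x => by
    rw [← ENNReal.rpow_mul, one_div_mul_cancel hp0.ne', ENNReal.rpow_one]
  have e2 : ∀ x, (v x ^ (-(1 / p))) ^ (p / (p - 1)) = v x ^ (-(1 / (p - 1))) := fun x => by
    rw [← ENNReal.rpow_mul]
    congr 1
    field_simp
  have e3 : ∀ x, (fun x => v x ^ (1 / p) * v x ^ (-(1 / p))) x = 1 := fun x => by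
    simp only
    rw [← ENNReal.rpow_add _ _ (hv.ne_zero x) (hv.ne_top x), add_neg_cancel, ENNReal.rpow_zero]
  simp only [Pi.mul_apply, e1, e2] at h
  rw [lintegral_congr e3, lintegral_const, one_mul, Measure.restrict_apply_univ] at h
  have h2 := ENNReal.rpow_le_rpow h hp0.le
  rw [ENNReal.mul_rpow_of_nonneg _ _ hp0.le, ← ENNReal.rpow_mul, ← ENNReal.rpow_mul,
    one_div_mul_cancel hp0.ne', ENNReal.rpow_one] at h2
  convert h2 using 3
  field_simp

/-- An `A_p` density does not concentrate on small parts of an interval. -/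
lemma setLIntegral_Icc_le (hp : 1 < p) (hv : ApDensity p v C) {a b : ℝ} (hab : a < b) {E : Set ℝ}
    (hE : E ⊆ Icc a b) {k : ℝ≥0} (hk : ENNReal.ofReal (b - a) ≤ k * volume E) :
    ∫⁻ x in Icc a b, v x ≤ C * k ^ p * ∫⁻ x in E, v x := by
  have hp1 : 0 < p - 1 := sub_pos.2 hp
  have hp0 : 0 < p := by linarith
  have hv' := hv.dual hp
  set s := (∫⁻ x in Icc a b, v x ^ (-(1 / (p - 1)))) ^ (p - 1) with hs
  have hs0 : s ≠ 0 := by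
    refine (ENNReal.rpow_pos (pos_iff_ne_zero.2 (hv'.lintegral_ne_zero ?_))
      (hv'.lintegral_ne_top a b)).ne'
    simpa using hab
  have hst : s ≠ ∞ := ENNReal.rpow_ne_top_of_nonneg hp1.le (hv'.lintegral_ne_top a b)
  refine (ENNReal.mul_le_mul_iff_left hs0 hst).1 ?_
  calc _ ≤ C * ENNReal.ofReal (b - a) ^ p := hv.mul_le a b hab
    _ ≤ C * (k * volume E) ^ p := by gcongr
    _ = C * k ^ p * volume E ^ p := by
        rw [ENNReal.mul_rpow_of_nonneg _ _ hp0.le, mul_assoc]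
    _ ≤ C * k ^ p * ((∫⁻ x in E, v x) * (∫⁻ x in E, v x ^ (-(1 / (p - 1)))) ^ (p - 1)) := by
        gcongr
        exact hv.volume_rpow_le hp E
    _ ≤ C * k ^ p * ((∫⁻ x in E, v x) * s) := by
        rw [hs]
        gcongr
    _ = _ := by ring

lemma withDensity_closedBall_le (hp : 1 < p) (hv : ApDensity p v C) (m r : ℝ) (hr : 0 < r) :
    volume.withDensity v (Metric.closedBall m (5 * r)) ≤
      C * 5 ^ p * volume.withDensity v (Metric.closedBall m r) := by
  rw [withDensity_apply _ Metric.isClosed_closedBall.measurableSet,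
    withDensity_apply _ Metric.isClosed_closedBall.measurableSet, Real.closedBall_eq_Icc]
  have h : Metric.closedBall m r ⊆ Icc (m - 5 * r) (m + 5 * r) := by
    rw [Real.closedBall_eq_Icc]
    exact Icc_subset_Icc (by linarith) (by linarith)
  have := hv.setLIntegral_Icc_le hp (by linarith) h (k := 5) (by
    rw [Real.volume_closedBall, ENNReal.coe_ofNat, ← ENNReal.ofReal_ofNat,
      ← ENNReal.ofReal_mul (by norm_num)]
    exact ENNReal.ofReal_le_ofReal (by linarith))
  simpa using this

lemma withDensity_closedBall_ne_top (hv : ApDensity p v C) (m r : ℝ) :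
    volume.withDensity v (Metric.closedBall m r) ≠ ∞ := by
  rw [withDensity_apply _ Metric.isClosed_closedBall.measurableSet, Real.closedBall_eq_Icc]
  exact hv.lintegral_ne_top _ _

end ApDensity

end Density

end VqCZ

end

/-! ### The bilinear sparse form. -/

noncomputable section

namespace VqCZ

section SparseForm

variable {p : ℝ} {v : ℝ → ℝ≥0∞} {C : ℝ≥0}

/-- Write V and S for the integrals of v and of its dual density over the interval, and p' for the
conjugate exponent. Then VS = V^(1/p')·S^(1/p)·(V·S^(p-1))^(1/p): the last factor is bounded by the
length through `A_p`, and in the first two the interval is replaced by E. -/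
lemma ApDensity.mul_dual_le (hp : 1 < p) (hv : ApDensity p v C) (k : ℝ≥0) : ∃ D : ℝ≥0,
    ∀ a b : ℝ, a < b → ∀ E ⊆ Icc a b, ENNReal.ofReal (b - a) ≤ k * volume E →
      (∫⁻ x in Icc a b, v x) * (∫⁻ x in Icc a b, v x ^ (-(1 / (p - 1)))) ≤
        D * ENNReal.ofReal (b - a) * (∫⁻ x in E, v x) ^ (1 / (p / (p - 1))) *
          (∫⁻ x in E, v x ^ (-(1 / (p - 1)))) ^ (1 / p) := by
  have hp1 : 0 < p - 1 := sub_pos.2 hp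
  have hp0 : 0 < p := by linarith
  have hpp : 0 < p / (p - 1) := div_pos hp0 hp1
  have hpp1 : 1 < p / (p - 1) := (one_lt_div hp1).2 (by linarith)
  have hi : 0 ≤ 1 / p := by positivity
  have hi' : 0 ≤ 1 / (p / (p - 1)) := by positivity
  have hv' := hv.dual hp
  refine ⟨(C * k ^ p) ^ (1 / (p / (p - 1))) *
    (C ^ (1 / (p - 1)) * k ^ (p / (p - 1))) ^ (1 / p) * C ^ (1 / p), fun a b hab E hE hk => ?_⟩
  set V := ∫⁻ x in Icc a b, v x with hV
  set S := ∫⁻ x in Icc a b, v x ^ (-(1 / (p - 1))) with hS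
  set VE := ∫⁻ x in E, v x
  set SE := ∫⁻ x in E, v x ^ (-(1 / (p - 1)))
  have h1 : V ≤ (C * k ^ p : ℝ≥0) * VE := by
    rw [ENNReal.coe_mul, ENNReal.coe_rpow_of_nonneg _ hp0.le]
    exact hv.setLIntegral_Icc_le hp hab hE hk
  have h2 : S ≤ (C ^ (1 / (p - 1)) * k ^ (p / (p - 1)) : ℝ≥0) * SE := by
    rw [ENNReal.coe_mul, ENNReal.coe_rpow_of_nonneg k hpp.le]
    exact hv'.setLIntegral_Icc_le hpp1 hab hE hk
  have h3 : (V * S ^ (p - 1)) ^ (1 / p) ≤ (C ^ (1 / p) : ℝ≥0) * ENNReal.ofReal (b - a) := by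
    refine (ENNReal.rpow_le_rpow (hv.mul_le a b hab) hi).trans_eq ?_
    rw [ENNReal.mul_rpow_of_nonneg _ _ hi, ← ENNReal.rpow_mul, mul_one_div_cancel hp0.ne',
      ENNReal.rpow_one, ENNReal.coe_rpow_of_nonneg _ hi]
  have e : V * S = V ^ (1 / (p / (p - 1))) * S ^ (1 / p) * (V * S ^ (p - 1)) ^ (1 / p) := by
    rw [ENNReal.mul_rpow_of_nonneg _ _ hi, ← ENNReal.rpow_mul]
    calc V * S = V ^ (1 / (p / (p - 1)) + 1 / p) * S ^ (1 / p + (p - 1) * (1 / p)) := by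
          have e1 : 1 / (p / (p - 1)) + 1 / p = 1 := by
            field_simp
            ring
          have e2 : 1 / p + (p - 1) * (1 / p) = 1 := by
            field_simp
            ring
          rw [e1, e2, ENNReal.rpow_one, ENNReal.rpow_one]
      _ = _ := by
          rw [ENNReal.rpow_add_of_nonneg _ _ hi' hi,
            ENNReal.rpow_add_of_nonneg _ _ hi (by positivity)]
          ring
  rw [e]
  calc _ ≤ ((C * k ^ p : ℝ≥0) * VE) ^ (1 / (p / (p - 1))) *
        ((C ^ (1 / (p - 1)) * k ^ (p / (p - 1)) : ℝ≥0) * SE) ^ (1 / p) *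
        ((C ^ (1 / p) : ℝ≥0) * ENNReal.ofReal (b - a)) := by
        gcongr
    _ = _ := by
        rw [ENNReal.mul_rpow_of_nonneg _ _ hi, ENNReal.mul_rpow_of_nonneg _ _ hi',
          ENNReal.coe_mul (_ * _), ENNReal.coe_mul ((C * k ^ p) ^ (1 / (p / (p - 1)))),
          ENNReal.coe_rpow_of_nonneg _ hi', ENNReal.coe_rpow_of_nonneg (_ * _) hi]
        ring

/-- The weighted bound for the bilinear form of a sparse family of intervals. -/
lemma ApDensity.exists_sum_mul_le (hp : 1 < p) (hv : ApDensity p v C) (k : ℝ≥0) : ∃ D : ℝ≥0,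
    ∀ (ι : Type) (S : Finset ι) (a b : ι → ℝ) (E : ι → Set ℝ), (∀ i ∈ S, a i < b i) →
      (∀ i, E i ⊆ Icc (a i) (b i)) → (∀ i, MeasurableSet (E i)) →
      Pairwise (Function.onFun Disjoint E) →
      (∀ i ∈ S, ENNReal.ofReal (b i - a i) ≤ k * volume (E i)) →
      ∀ F G : ℝ → ℝ≥0∞, Measurable F → Measurable G →
      ∑ i ∈ S, (∫⁻ x in Icc (a i) (b i), F x) / ENNReal.ofReal (b i - a i) *
        (∫⁻ x in Icc (a i) (b i), G x ∂volume.withDensity v) ≤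
      D * (∫⁻ x, F x ^ p ∂volume.withDensity v) ^ (1 / p) *
        (∫⁻ x, G x ^ (p / (p - 1)) ∂volume.withDensity v) ^ (1 / (p / (p - 1))) := by
  have hp1 : 0 < p - 1 := sub_pos.2 hp
  have hp0 : 0 < p := by linarith
  have hpp : 0 < p / (p - 1) := div_pos hp0 hp1
  have hpp1 : 1 < p / (p - 1) := (one_lt_div hp1).2 (by linarith)
  have hi : 0 ≤ 1 / p := by positivity
  have hi' : 0 ≤ 1 / (p / (p - 1)) := by positivity
  have hpq : p.HolderConjugate (p / (p - 1)) := Real.HolderConjugate.conjExponent hp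
  have hv' := hv.dual hp
  obtain ⟨D₀, hD₀⟩ := hv.mul_dual_le hp k
  set u : ℝ → ℝ≥0∞ := fun x => v x ^ (-(1 / (p - 1))) with hu
  set A₁ : ℝ≥0∞ := ENNReal.ofReal p * (2 * ((C ^ (1 / (p - 1)) : ℝ≥0) * 5 ^ (p / (p - 1)))) *
    ((ENNReal.ofReal (p - 1))⁻¹ * 2 ^ (p - 1)) with hA₁
  set A₂ : ℝ≥0∞ := ENNReal.ofReal (p / (p - 1)) * (2 * (C * 5 ^ p)) *
    ((ENNReal.ofReal (p / (p - 1) - 1))⁻¹ * 2 ^ (p / (p - 1) - 1)) with hA₂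
  have hfin : ∀ {s : ℝ} (c : ℝ≥0) {t : ℝ}, 1 < s → 0 ≤ t → ENNReal.ofReal s * (2 * (c * 5 ^ t)) *
      ((ENNReal.ofReal (s - 1))⁻¹ * 2 ^ (s - 1)) ≠ ∞ := by
    intro s c t hs ht
    refine ENNReal.mul_ne_top (ENNReal.mul_ne_top ENNReal.ofReal_ne_top (ENNReal.mul_ne_top (by simp)
      (ENNReal.mul_ne_top ENNReal.coe_ne_top (ENNReal.rpow_ne_top_of_nonneg ht (by simp)))))
      (ENNReal.mul_ne_top ?_ (ENNReal.rpow_ne_top_of_nonneg (by linarith) (by simp)))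
    simpa using hs
  have hA₁t : A₁ ≠ ∞ := hfin _ hp hpp.le
  have hA₂t : A₂ ≠ ∞ := hfin _ hpp1 hp0.le
  have hDt : D₀ * A₁ ^ (1 / p) * A₂ ^ (1 / (p / (p - 1))) ≠ ∞ :=
    ENNReal.mul_ne_top (ENNReal.mul_ne_top ENNReal.coe_ne_top
      (ENNReal.rpow_ne_top_of_nonneg hi hA₁t)) (ENNReal.rpow_ne_top_of_nonneg hi' hA₂t)
  refine ⟨(D₀ * A₁ ^ (1 / p) * A₂ ^ (1 / (p / (p - 1)))).toNNReal,
    fun ι S a b E hab hE hEm hEd hk F G hF hG => ?_⟩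
  rw [ENNReal.coe_toNNReal hDt]
  set W := volume.withDensity v with hW
  set σ := volume.withDensity u with hσ
  have hWI : ∀ {s : Set ℝ}, MeasurableSet s → W s = ∫⁻ x in s, v x := fun hs =>
    withDensity_apply _ hs
  have hσI : ∀ {s : Set ℝ}, MeasurableSet s → σ s = ∫⁻ x in s, u x := fun hs =>
    withDensity_apply _ hs
  -- Dividing by the dual density turns Lebesgue integrals of F into σ-integrals of φ, while the
  -- L^p(σ) norm of φ equals the L^p(W) norm of F.
  set φ : ℝ → ℝ≥0∞ := fun x => F x * (u x)⁻¹ with hφ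
  have hφm : Measurable φ := hF.mul hv'.measurable.inv
  have hFφ : ∀ x, F x = u x * φ x := fun x => by
    rw [hφ, mul_comm, mul_assoc, ENNReal.inv_mul_cancel (hv'.ne_zero x) (hv'.ne_top x), mul_one]
  have hIF : ∀ s : Set ℝ, MeasurableSet s → ∫⁻ x in s, F x = ∫⁻ x in s, φ x ∂σ := fun s hs => by
    rw [setLIntegral_withDensity_eq_setLIntegral_mul _ hv'.measurable hφm hs]
    exact lintegral_congr hFφ
  have hnorm : ∫⁻ x, φ x ^ p ∂σ = ∫⁻ x, F x ^ p ∂W := by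
    rw [lintegral_withDensity_eq_lintegral_mul _ hv'.measurable (hφm.pow_const p),
      lintegral_withDensity_eq_lintegral_mul _ hv.measurable (hF.pow_const p)]
    refine lintegral_congr fun x => ?_
    simp only [Pi.mul_apply, hφ, hu]
    rw [ENNReal.mul_rpow_of_nonneg _ _ hp0.le, ← ENNReal.rpow_neg_one, ← ENNReal.rpow_mul,
      ← ENNReal.rpow_mul, mul_left_comm, ← ENNReal.rpow_add _ _ (hv.ne_zero x) (hv.ne_top x),
      mul_comm]
    congr 1
    convert ENNReal.rpow_one (v x)
    field_simp
    ring
  set m : ι → ℝ := fun i => (a i + b i) / 2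
  set r : ι → ℝ := fun i => (b i - a i) / 2
  have hball : ∀ i, Icc (a i) (b i) = Metric.closedBall (m i) (r i) := fun i => Real.Icc_eq_closedBall _ _
  have hr : ∀ i ∈ S, 0 < r i := fun i hi => half_pos (sub_pos.2 (hab i hi))
  have hEb : ∀ i, E i ⊆ Metric.closedBall (m i) (r i) := fun i => hball i ▸ hE i
  have hcar₁ := sum_average_rpow_le hp (hv'.withDensity_closedBall_le hpp1)
    hv'.withDensity_closedBall_ne_top hφm S m r hr E hEb hEm hEd
  have hcar₂ := sum_average_rpow_le hpp1 (hv.withDensity_closedBall_le hp)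
    hv.withDensity_closedBall_ne_top hG S m r hr E hEb hEm hEd
  simp only [← hball] at hcar₁ hcar₂
  set X : ι → ℝ≥0∞ := fun i => (∫⁻ y in Icc (a i) (b i), φ y ∂σ) / σ (Icc (a i) (b i)) with hX
  set Y : ι → ℝ≥0∞ := fun i => (∫⁻ y in Icc (a i) (b i), G y ∂W) / W (Icc (a i) (b i)) with hY
  have hvol : ∀ i ∈ S, volume (Icc (a i) (b i)) ≠ 0 := fun i hi => by simpa using hab i hi
  -- The product of masses W(I)σ(I) is exchanged for σ(E)^(1/p)·W(E)^(1/p'), which prepares Hölder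
  -- for sums and the two Carleson embeddings.
  have hterm : ∀ i ∈ S, (∫⁻ x in Icc (a i) (b i), F x) / ENNReal.ofReal (b i - a i) *
        (∫⁻ x in Icc (a i) (b i), G x ∂W) ≤
      D₀ * ((X i * σ (E i) ^ (1 / p)) * (Y i * W (E i) ^ (1 / (p / (p - 1))))) := by
    intro i hi
    have hl0 : ENNReal.ofReal (b i - a i) ≠ 0 := by simpa using hab i hi
    have hW0 : W (Icc (a i) (b i)) ≠ 0 := by
      rw [hWI measurableSet_Icc]
      exact hv.lintegral_ne_zero (hvol i hi)
    have hWt : W (Icc (a i) (b i)) ≠ ∞ := by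
      rw [hWI measurableSet_Icc]
      exact hv.lintegral_ne_top _ _
    have hσ0 : σ (Icc (a i) (b i)) ≠ 0 := by
      rw [hσI measurableSet_Icc]
      exact hv'.lintegral_ne_zero (hvol i hi)
    have hσt : σ (Icc (a i) (b i)) ≠ ∞ := by
      rw [hσI measurableSet_Icc]
      exact hv'.lintegral_ne_top _ _
    have h := hD₀ (a i) (b i) (hab i hi) (E i) (hE i) (hk i hi)
    rw [← hWI measurableSet_Icc, ← hσI measurableSet_Icc, ← hWI (hEm i), ← hσI (hEm i)] at h
    calc _ = X i * Y i * (W (Icc (a i) (b i)) * σ (Icc (a i) (b i))) *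
          (ENNReal.ofReal (b i - a i))⁻¹ := by
          rw [hIF _ measurableSet_Icc]
          have eX : ∫⁻ y in Icc (a i) (b i), φ y ∂σ = X i * σ (Icc (a i) (b i)) :=
            (ENNReal.div_mul_cancel' (fun h => absurd h hσ0) fun h => absurd h hσt).symm
          have eY : ∫⁻ y in Icc (a i) (b i), G y ∂W = Y i * W (Icc (a i) (b i)) :=
            (ENNReal.div_mul_cancel' (fun h => absurd h hW0) fun h => absurd h hWt).symm
          rw [eX, eY, div_eq_mul_inv]
          ring
      _ ≤ X i * Y i * (D₀ * ENNReal.ofReal (b i - a i) * W (E i) ^ (1 / (p / (p - 1))) *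
          σ (E i) ^ (1 / p)) * (ENNReal.ofReal (b i - a i))⁻¹ := by
          gcongr
      _ = D₀ * ((X i * σ (E i) ^ (1 / p)) * (Y i * W (E i) ^ (1 / (p / (p - 1))))) *
          (ENNReal.ofReal (b i - a i) * (ENNReal.ofReal (b i - a i))⁻¹) := by ring
      _ = _ := by rw [ENNReal.mul_inv_cancel hl0 ENNReal.ofReal_ne_top, mul_one]
  calc _ ≤ ∑ i ∈ S, D₀ * ((X i * σ (E i) ^ (1 / p)) * (Y i * W (E i) ^ (1 / (p / (p - 1))))) :=
        Finset.sum_le_sum hterm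
    _ ≤ D₀ * ((∑ i ∈ S, (X i * σ (E i) ^ (1 / p)) ^ p) ^ (1 / p) *
        (∑ i ∈ S, (Y i * W (E i) ^ (1 / (p / (p - 1)))) ^ (p / (p - 1))) ^ (1 / (p / (p - 1)))) := by
        rw [← Finset.mul_sum]
        exact mul_le_mul' le_rfl (ENNReal.inner_le_Lp_mul_Lq S _ _ hpq)
    _ = D₀ * ((∑ i ∈ S, X i ^ p * σ (E i)) ^ (1 / p) *
        (∑ i ∈ S, Y i ^ (p / (p - 1)) * W (E i)) ^ (1 / (p / (p - 1)))) := by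
        simp only [ENNReal.mul_rpow_of_nonneg _ _ hp0.le, ENNReal.mul_rpow_of_nonneg _ _ hpp.le,
          ← ENNReal.rpow_mul, one_div_mul_cancel hp0.ne', one_div_mul_cancel hpp.ne',
          ENNReal.rpow_one]
    _ ≤ D₀ * ((A₁ * ∫⁻ x, F x ^ p ∂W) ^ (1 / p) *
        (A₂ * ∫⁻ x, G x ^ (p / (p - 1)) ∂W) ^ (1 / (p / (p - 1)))) := by
        rw [← hnorm]
        gcongr
    _ = _ := by
        rw [ENNReal.mul_rpow_of_nonneg _ _ hi, ENNReal.mul_rpow_of_nonneg _ _ hi']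
        ring

end SparseForm

end VqCZ

end

/-! ### Sparse operators on weighted spaces and admissibility. -/

noncomputable section

namespace VqCZ

open Filter Topology

section SparseOperator

variable {p : ℝ} {v : ℝ → ℝ≥0∞} {C : ℝ≥0}

lemma ApDensity.withDensity_Icc_ne_top (hv : ApDensity p v C) (a b : ℝ) :
    volume.withDensity v (Icc a b) ≠ ∞ := by
  rw [withDensity_apply _ measurableSet_Icc]
  exact hv.lintegral_ne_top _ _

/-- The weighted bound for finite sparse operators. -/
lemma ApDensity.exists_lintegral_sum_rpow_le (hp : 1 < p) (hv : ApDensity p v C) (k : ℝ≥0) :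
    ∃ D : ℝ≥0, ∀ (ι : Type) (S : Finset ι) (a b : ι → ℝ) (E Q : ι → Set ℝ), (∀ i ∈ S, a i < b i) →
      (∀ i, E i ⊆ Icc (a i) (b i)) → (∀ i, MeasurableSet (E i)) →
      Pairwise (Function.onFun Disjoint E) →
      (∀ i ∈ S, ENNReal.ofReal (b i - a i) ≤ k * volume (E i)) →
      (∀ i, Q i ⊆ Icc (a i) (b i)) → (∀ i, MeasurableSet (Q i)) →
      ∀ F : ℝ → ℝ≥0∞, Measurable F → ∫⁻ x, F x ≠ ∞ →
      ∫⁻ x, (∑ i ∈ S, (Q i).indicator (fun _ => (∫⁻ y in Icc (a i) (b i), F y) /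
        ENNReal.ofReal (b i - a i)) x) ^ p ∂volume.withDensity v ≤
      D * ∫⁻ x, F x ^ p ∂volume.withDensity v := by
  have hp1 : 0 < p - 1 := sub_pos.2 hp
  have hp0 : 0 < p := by linarith
  obtain ⟨D, hD⟩ := hv.exists_sum_mul_le hp k
  refine ⟨D ^ p, fun ι S a b E Q hab hE hEm hEd hk hQ hQm F hF hFi => ?_⟩
  set W := volume.withDensity v with hW
  set A : ι → ℝ≥0∞ := fun i => (∫⁻ y in Icc (a i) (b i), F y) / ENNReal.ofReal (b i - a i) with hA
  set Φ : ℝ → ℝ≥0∞ := fun x => ∑ i ∈ S, (Q i).indicator (fun _ => A i) x with hΦ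
  have hΦm : Measurable Φ := Finset.measurable_fun_sum _ fun i _ => measurable_const.indicator (hQm i)
  set I := ∫⁻ x, Φ x ^ p ∂W with hI
  set N := ∫⁻ x, F x ^ p ∂W with hN
  have hAt : ∑ i ∈ S, A i ≠ ∞ := by
    refine ENNReal.sum_ne_top.2 fun i hi => (ENNReal.div_lt_top ?_ ?_).ne
    · exact ((lintegral_mono' Measure.restrict_le_self le_rfl).trans_lt (lt_top_iff_ne_top.2 hFi)).ne
    · simpa using hab i hi
  -- A priori finiteness, from finitely many bounded intervals and finite averages, so that a power
  -- of `I` may be cancelled below.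
  have hIt : I ≠ ∞ := by
    have h1 : ∀ x, Φ x ^ p ≤ (⋃ i ∈ S, Q i).indicator (fun _ => (∑ i ∈ S, A i) ^ p) x := by
      intro x
      by_cases hx : x ∈ ⋃ i ∈ S, Q i
      · rw [indicator_of_mem hx]
        exact ENNReal.rpow_le_rpow (Finset.sum_le_sum fun i _ =>
          indicator_le_self (Q i) (fun _ => A i) x) hp0.le
      · have : Φ x = 0 := Finset.sum_eq_zero fun i hi =>
          indicator_of_notMem (fun h => hx (mem_biUnion hi h)) _
        rw [this, ENNReal.zero_rpow_of_pos hp0]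
        exact zero_le
    refine ((lintegral_mono h1).trans_lt ?_).ne
    rw [lintegral_indicator (Finset.measurableSet_biUnion _ fun i _ => hQm i), setLIntegral_const]
    refine ENNReal.mul_lt_top (ENNReal.rpow_lt_top_of_nonneg hp0.le hAt) ?_
    refine (measure_biUnion_finset_le _ _).trans_lt (ENNReal.sum_lt_top.2 fun i _ => ?_)
    exact (measure_mono (hQ i)).trans_lt (lt_top_iff_ne_top.2 (hv.withDensity_Icc_ne_top _ _))
  -- Duality with the extremal test function Φ^(p-1), whose conjugate power is again Φ^p.
  have hmain : I ≤ D * N ^ (1 / p) * I ^ (1 / (p / (p - 1))) := by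
    calc I = ∫⁻ x, ∑ i ∈ S, (Q i).indicator (fun x => A i * Φ x ^ (p - 1)) x ∂W := by
          refine lintegral_congr fun x => ?_
          have e : Φ x ^ p = Φ x * Φ x ^ (p - 1) := by
            conv_rhs => rw [← ENNReal.rpow_one (Φ x), ← ENNReal.rpow_mul,
              ← ENNReal.rpow_add_of_nonneg _ _ zero_le_one (by linarith)]
            ring_nf
          rw [e]
          nth_rewrite 1 [hΦ]
          rw [Finset.sum_mul]
          refine Finset.sum_congr rfl fun i _ => ?_
          simp only [indicator]
          split_ifs <;> simp
      _ = ∑ i ∈ S, A i * ∫⁻ x in Q i, Φ x ^ (p - 1) ∂W := by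
          rw [lintegral_finsetSum _ fun i _ => ((hΦm.pow_const _).const_mul _).indicator (hQm i)]
          refine Finset.sum_congr rfl fun i _ => ?_
          rw [lintegral_indicator (hQm i), lintegral_const_mul _ (hΦm.pow_const _)]
      _ ≤ ∑ i ∈ S, A i * ∫⁻ x in Icc (a i) (b i), Φ x ^ (p - 1) ∂W :=
          Finset.sum_le_sum fun i _ => mul_le_mul' le_rfl (lintegral_mono_set (hQ i))
      _ ≤ D * N ^ (1 / p) * (∫⁻ x, (Φ x ^ (p - 1)) ^ (p / (p - 1)) ∂W) ^ (1 / (p / (p - 1))) :=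
          hD ι S a b E hab hE hEm hEd hk F _ hF (hΦm.pow_const _)
      _ = _ := by
          congr 2
          refine lintegral_congr fun x => ?_
          rw [← ENNReal.rpow_mul, mul_div_cancel₀ _ hp1.ne']
  rcases eq_or_ne I 0 with h0 | h0
  · rw [h0]
    exact zero_le
  have hsplit : I = I ^ (1 / p) * I ^ (1 / (p / (p - 1))) := by
    rw [← ENNReal.rpow_add _ _ h0 hIt]
    conv_lhs => rw [← ENNReal.rpow_one I]
    congr 1
    field_simp
    ring
  have hc : I ^ (1 / p) ≤ D * N ^ (1 / p) := by
    refine (ENNReal.mul_le_mul_iff_left (c := I ^ (1 / (p / (p - 1))))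
      (ENNReal.rpow_pos (pos_iff_ne_zero.2 h0) hIt).ne'
      (ENNReal.rpow_ne_top_of_nonneg (by positivity) hIt)).1 ?_
    rw [← hsplit]
    exact hmain
  have h := ENNReal.rpow_le_rpow hc hp0.le
  rwa [ENNReal.mul_rpow_of_nonneg _ _ hp0.le, ← ENNReal.rpow_mul, ← ENNReal.rpow_mul,
    one_div_mul_cancel hp0.ne', ENNReal.rpow_one, ENNReal.rpow_one,
    ← ENNReal.coe_rpow_of_nonneg _ hp0.le] at h

/-- Functions in `L^p(w)` with `w ∈ A_p` have convergent truncated singular integrals. -/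
lemma ApDensity.admissible (hp : 1 < p) (hv : ApDensity p v C) {f : ℝ → ℂ} (hf : Measurable f)
    (hfp : ∫⁻ x, ‖f x‖ₑ ^ p ∂volume.withDensity v ≠ ∞) : Admissible f := by
  have hp1 : 0 < p - 1 := sub_pos.2 hp
  have hp0 : 0 < p := by linarith
  refine ⟨hf, ?_⟩
  obtain ⟨D, hD⟩ := hv.exists_sum_mul_le hp 2
  set W := volume.withDensity v with hW
  set a : ℕ → ℝ≥0∞ := fun n => (∫⁻ y in Icc (-2 ^ n) (2 ^ n), ‖f y‖ₑ) /
    ENNReal.ofReal (2 ^ n - -2 ^ n) with ha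
  set w₀ := W (Icc 0 1) with hw₀
  have hw0 : w₀ ≠ 0 := by
    rw [hw₀, hW, withDensity_apply _ measurableSet_Icc]
    exact hv.lintegral_ne_zero (by simp)
  have hwt : w₀ ≠ ∞ := hv.withDensity_Icc_ne_top _ _
  have hsum : ∀ n, (∑ i ∈ Finset.range n, a i) * w₀ ≤
      D * (∫⁻ x, ‖f x‖ₑ ^ p ∂W) ^ (1 / p) * w₀ ^ (1 / (p / (p - 1))) := by
    intro n
    -- The centred dyadic intervals form a sparse family: the shells in [-2^n, 2^n] are disjoint and
    -- fill half of it. Testing against the indicator of [0,1], contained in all of them, makes the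
    -- averages of |f| summable.
    have h := hD ℕ (Finset.range n) (fun n => -2 ^ n) (fun n => 2 ^ n)
      (fun n => Icc (-2 ^ n) (2 ^ n) \ Icc (-2 ^ n / 2) (2 ^ n / 2))
      (fun i _ => by linarith [pow_pos (two_pos (α := ℝ)) i]) (fun i => sdiff_subset)
      (fun i => measurableSet_Icc.diff measurableSet_Icc) ?_ ?_ (fun y => ‖f y‖ₑ)
      ((Icc 0 1).indicator 1) hf.enorm (measurable_one.indicator measurableSet_Icc)
    · have e1 : ∀ x : ℝ, (Icc (0 : ℝ) 1).indicator (1 : ℝ → ℝ≥0∞) x ^ (p / (p - 1)) =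
          (Icc (0 : ℝ) 1).indicator 1 x := fun x => by
        simp only [indicator]
        split_ifs <;> simp [div_pos hp0 hp1]
      have e2 : ∀ i, ∫⁻ x in Icc (-2 ^ i) (2 ^ i), (Icc (0 : ℝ) 1).indicator (1 : ℝ → ℝ≥0∞) x ∂W =
          w₀ := fun i => by
        rw [lintegral_indicator_one measurableSet_Icc, Measure.restrict_apply measurableSet_Icc,
          inter_eq_left.2]
        have : (1 : ℝ) ≤ 2 ^ i := one_le_pow₀ one_le_two
        exact Icc_subset_Icc (by linarith) this
      simp only [e1, e2, lintegral_indicator_one measurableSet_Icc] at h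
      rwa [← Finset.sum_mul] at h
    · intro i j hne
      wlog hij : i < j generalizing i j
      · exact (this hne.symm (lt_of_le_of_ne (not_lt.1 hij) hne.symm)).symm
      rw [Function.onFun, Set.disjoint_left]
      intro x hx hx'
      refine hx'.2 (Icc_subset_Icc ?_ ?_ hx.1)
      all_goals
        have h3 : (2 : ℝ) ^ (i + 1) ≤ 2 ^ j := pow_le_pow_right₀ one_le_two hij
        rw [pow_succ] at h3
        linarith
    · intro i _
      have h2 : (0 : ℝ) < 2 ^ i := by positivity
      rw [measure_sdiff (Icc_subset_Icc (by linarith) (by linarith))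
        measurableSet_Icc.nullMeasurableSet (by simp), Real.volume_Icc, Real.volume_Icc,
        ← ENNReal.ofReal_sub _ (by linarith), ENNReal.coe_ofNat, ← ENNReal.ofReal_ofNat,
        ← ENNReal.ofReal_mul (by norm_num)]
      exact ENNReal.ofReal_le_ofReal (by linarith)
  have hsum' : (∑' i, a i) * w₀ ≠ ∞ := by
    refine ne_top_of_le_ne_top ?_ (b := D * (∫⁻ x, ‖f x‖ₑ ^ p ∂W) ^ (1 / p) *
      w₀ ^ (1 / (p / (p - 1)))) ?_
    · refine ENNReal.mul_ne_top (ENNReal.mul_ne_top ENNReal.coe_ne_top ?_) ?_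
      · exact ENNReal.rpow_ne_top_of_nonneg (by positivity) hfp
      · exact ENNReal.rpow_ne_top_of_nonneg (by positivity) hwt
    · rw [ENNReal.tsum_eq_iSup_nat, ENNReal.iSup_mul]
      exact iSup_le hsum
  have ht : ∑' i, a i ≠ ∞ := fun h => hsum' (by rw [h, ENNReal.top_mul hw0])
  have hle : ∀ y : ℝ, ‖f y‖ₑ * ENNReal.ofReal ((1 + |y|)⁻¹) ≤ ∑' n : ℕ,
      (Icc (-2 ^ n) (2 ^ n)).indicator (fun y => 4 * (ENNReal.ofReal (2 ^ n - -2 ^ n))⁻¹ * ‖f y‖ₑ) y := by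
    intro y
    obtain ⟨n, h1, h2⟩ := exists_nat_pow_near (show (1 : ℝ) ≤ 1 + |y| by linarith [abs_nonneg y])
      one_lt_two
    -- With 2^n ≤ 1 + |y| < 2^(n+1), the interval of index n + 1 contains y, and 4 divided by its
    -- length 2^(n+2) is 2^(-n).
    refine le_trans ?_ (ENNReal.le_tsum (n + 1))
    have hy := abs_le.1 (show |y| ≤ 2 ^ (n + 1) by linarith)
    rw [indicator_of_mem (show y ∈ Icc (-2 ^ (n + 1)) (2 ^ (n + 1)) from hy), mul_comm]
    refine mul_le_mul' ?_ le_rfl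
    have h2 : (0 : ℝ) < 2 ^ n := by positivity
    rw [← ENNReal.ofReal_inv_of_pos (by rw [pow_succ]; linarith), ← ENNReal.ofReal_ofNat,
      ← ENNReal.ofReal_mul (by norm_num)]
    refine ENNReal.ofReal_le_ofReal ?_
    calc (1 + |y|)⁻¹ ≤ (2 ^ n)⁻¹ := inv_anti₀ h2 h1
      _ = _ := by
          rw [pow_succ]
          field_simp
          norm_num
  have hfin : ∫⁻ y, ‖f y‖ₑ * ENNReal.ofReal ((1 + |y|)⁻¹) ≤ 4 * ∑' i, a i := by
    refine (lintegral_mono hle).trans_eq ?_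
    rw [lintegral_tsum fun n => ((hf.enorm.const_mul _).indicator measurableSet_Icc).aemeasurable,
      ← ENNReal.tsum_mul_left]
    refine tsum_congr fun n => ?_
    rw [lintegral_indicator measurableSet_Icc, lintegral_const_mul _ hf.enorm, ha]
    simp only [div_eq_mul_inv]
    ring
  exact ne_top_of_le_ne_top (ENNReal.mul_ne_top (by simp) ht) hfin

end SparseOperator

end VqCZ

end

/-! ### Weighted strong and weak type bounds. -/

noncomputable section

namespace VqCZ

open Filter Topology

section StrongType

variable {K : ℝ → ℝ → ℂ} {δ C₀ q ρ p : ℝ} {v : ℝ → ℝ≥0∞} {C : ℝ≥0} {f : ℕ → ℝ → ℂ}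

/-- The weighted strong type bound for functions of compact support. -/
lemma ApDensity.exists_lintegral_vecOp_rpow_le_of_support (hK : KernelBounds K δ C₀) (hq : 1 < q)
    (hρ : 1 < ρ) (hB : StrongBound K q ρ volume) (hp : 1 < p) (hv : ApDensity p v C) :
    ∃ D : ℝ≥0, ∀ f : ℕ → ℝ → ℂ, (∀ k, Measurable (f k)) → ∫⁻ y, vecNorm ρ f y ≠ ∞ →
      ∀ n₀ : ℕ, (∀ k x, (n₀ : ℝ) < |x| → f k x = 0) →
        ∫⁻ x, vecOp K q ρ f x ^ p ∂volume.withDensity v ≤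
          D * ∫⁻ x, vecNorm ρ f x ^ p ∂volume.withDensity v := by
  have hp0 : 0 < p := by linarith
  have hρ0 : 0 < ρ := by linarith
  obtain ⟨D₁, hD₁⟩ := exists_sparse_domination hK hq hρ hB
  -- The averages are over eleven-fold dilates, so relative to these the family has sparseness
  -- constant 11·2, and changing the normalising length costs a factor 11.
  obtain ⟨D₂, hD₂⟩ := hv.exists_lintegral_sum_rpow_le hp 22
  refine ⟨(11 * D₁) ^ p * D₂, fun f hf hfi n₀ hsupp => ?_⟩
  set W := volume.withDensity v with hW
  set F := vecNorm ρ f with hF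
  have hFm : Measurable F := measurable_vecNorm hf
  have hlocal : ∀ n : ℕ, n₀ ≤ n → ∫⁻ x in Ioo (-(n : ℝ)) n, vecOp K q ρ f x ^ p ∂W ≤
      ((11 * D₁) ^ p * D₂ : ℝ≥0) * ∫⁻ x, F x ^ p ∂W := by
    intro n hn
    have hn' : (n₀ : ℝ) ≤ n := by exact_mod_cast hn
    have hnn : (0 : ℝ) ≤ n := n.cast_nonneg
    obtain ⟨α, β, E, hαβ, hE, hEm, hEd, hvol, hdom⟩ := hD₁ f hf hfi (-n) n (by linarith)
    -- The endpoints are discarded for the sake of n = 0, where the dilate is empty while f may be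
    -- nonzero at the origin.
    have hres : ∀ k, vecRestrict f (dil (-n) n) k =ᵐ[volume] f k := by
      intro k
      filter_upwards [compl_mem_ae_iff.2 (measure_singleton ((-n : ℝ) - 5 * (n - -n)) : volume _ = 0),
        compl_mem_ae_iff.2 (measure_singleton (n + 5 * (n - -n) : ℝ) : volume _ = 0)] with x h1 h2
      by_cases hx : x ∈ dil (-n) n
      · exact indicator_of_mem hx _
      · refine (indicator_of_notMem hx _).trans (hsupp k x ?_).symm
        refine hn'.trans_lt ?_
        by_contra h
        have h3 := abs_le.1 (not_lt.1 h)
        refine hx ⟨lt_of_le_of_ne (by linarith) fun e => h1 e.symm,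
          lt_of_le_of_ne (by linarith) fun e => h2 e⟩
    set J : List ℕ → ℝ≥0∞ := fun L => (∫⁻ y in Icc (α L - 5 * (β L - α L)) (β L + 5 * (β L - α L)), F y) /
      ENNReal.ofReal (β L + 5 * (β L - α L) - (α L - 5 * (β L - α L))) with hJ
    set Φ : Finset (List ℕ) → ℝ → ℝ≥0∞ := fun S x =>
      ∑ L ∈ S, (Ioo (α L) (β L)).indicator (fun _ => J L) x with hΦ
    have hterm : ∀ L x, (Ioo (α L) (β L)).indicator (fun _ =>
        (∫⁻ y in dil (α L) (β L), F y) / ENNReal.ofReal (β L - α L)) x ≤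
        11 * (Ioo (α L) (β L)).indicator (fun _ => J L) x := by
      intro L x
      by_cases hx : x ∈ Ioo (α L) (β L)
      · rw [indicator_of_mem hx, indicator_of_mem hx, hJ]
        have e : β L + 5 * (β L - α L) - (α L - 5 * (β L - α L)) = 11 * (β L - α L) := by ring
        have h1 : 0 < β L - α L := by linarith [hx.1, hx.2]
        simp only [e]
        rw [ENNReal.ofReal_mul (by norm_num), ENNReal.ofReal_ofNat, div_eq_mul_inv, div_eq_mul_inv,
          ENNReal.mul_inv (by simp) (by simp), mul_left_comm, ← mul_assoc 11,
          ENNReal.mul_inv_cancel (by simp) (by simp), one_mul]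
        gcongr
        exact Ioo_subset_Icc_self
      · rw [indicator_of_notMem hx]
        exact zero_le
    have hfinite : ∀ S : Finset (List ℕ), ∫⁻ x, Φ S x ^ p ∂W ≤ D₂ * ∫⁻ x, F x ^ p ∂W := by
      intro S
      have h := hD₂ (List ℕ) (S.filter fun L => α L < β L) (fun L => α L - 5 * (β L - α L))
        (fun L => β L + 5 * (β L - α L)) E (fun L => Ioo (α L) (β L))
        (fun L hL => by linarith [(Finset.mem_filter.1 hL).2])
        (fun L => (hE L).trans (Ioo_subset_Icc_self.trans
          (Icc_subset_Icc (by linarith [hαβ L]) (by linarith [hαβ L])))) hEm hEd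
        (fun L _ => ?_) (fun L => Ioo_subset_Icc_self.trans
          (Icc_subset_Icc (by linarith [hαβ L]) (by linarith [hαβ L])))
        (fun L => measurableSet_Ioo) F hFm hfi
      · refine le_trans (lintegral_mono fun x => ?_) h
        refine ENNReal.rpow_le_rpow (Finset.sum_filter_of_ne fun L _ hne => ?_).ge hp0.le
        by_contra hlt
        exact hne (indicator_of_notMem (fun hx => hlt (hx.1.trans hx.2)) _)
      · calc _ = 11 * ENNReal.ofReal (β L - α L) := by
              rw [← ENNReal.ofReal_ofNat, ← ENNReal.ofReal_mul (by norm_num)]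
              ring_nf
          _ ≤ 11 * (2 * volume (E L)) := mul_le_mul' le_rfl (hvol L)
          _ = _ := by
              rw [← mul_assoc]
              norm_num
    have hΦm : ∀ S, Measurable (Φ S) := fun S => Finset.measurable_fun_sum _ fun L _ =>
      measurable_const.indicator measurableSet_Ioo
    have htsum : ∫⁻ x, (∑' L, (Ioo (α L) (β L)).indicator (fun _ => J L) x) ^ p ∂W ≤
        D₂ * ∫⁻ x, F x ^ p ∂W := by
      have e1 : ∀ x, (∑' L, (Ioo (α L) (β L)).indicator (fun _ => J L) x) ^ p =
          ⨆ S, Φ S x ^ p := fun x => by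
        rw [ENNReal.tsum_eq_iSup_sum]
        exact (ENNReal.orderIsoRpow p hp0).map_iSup _
      simp only [e1]
      rw [lintegral_iSup_directed (fun S => ((hΦm S).pow_const p).aemeasurable)]
      · exact iSup_le hfinite
      · refine Monotone.directed_le fun S T hST x => ?_
        exact ENNReal.rpow_le_rpow (Finset.sum_le_sum_of_subset hST) hp0.le
    have hac : W ≪ volume := withDensity_absolutelyContinuous _ _
    calc _ ≤ ∫⁻ x in Ioo (-(n : ℝ)) n, (11 * D₁ : ℝ≥0) ^ p *
          (∑' L, (Ioo (α L) (β L)).indicator (fun _ => J L) x) ^ p ∂W := by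
          refine lintegral_mono_ae ((ae_restrict_iff' measurableSet_Ioo).2 ?_)
          filter_upwards [hac.ae_le hdom] with x hx hxn
          rw [← ENNReal.mul_rpow_of_nonneg _ _ hp0.le]
          refine ENNReal.rpow_le_rpow ?_ hp0.le
          rw [← vecOp_congr_ae hres]
          refine (hx hxn).trans ?_
          calc _ ≤ (D₁ : ℝ≥0∞) * ∑' L, 11 * (Ioo (α L) (β L)).indicator (fun _ => J L) x :=
                mul_le_mul' le_rfl (ENNReal.tsum_le_tsum fun L => hterm L x)
            _ = _ := by
                rw [ENNReal.tsum_mul_left, ENNReal.coe_mul, ENNReal.coe_ofNat]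
                ring
      _ ≤ ∫⁻ x, (11 * D₁ : ℝ≥0) ^ p *
          (∑' L, (Ioo (α L) (β L)).indicator (fun _ => J L) x) ^ p ∂W :=
          lintegral_mono' Measure.restrict_le_self le_rfl
      _ ≤ ((11 * D₁ : ℝ≥0) : ℝ≥0∞) ^ p * (D₂ * ∫⁻ x, F x ^ p ∂W) := by
          rw [lintegral_const_mul']
          · exact mul_le_mul' le_rfl htsum
          · exact ENNReal.rpow_ne_top_of_nonneg hp0.le ENNReal.coe_ne_top
      _ = _ := by
          rw [ENNReal.coe_mul ((11 * D₁) ^ p), ENNReal.coe_rpow_of_nonneg _ hp0.le, mul_assoc]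
  have hcov : (⋃ n : ℕ, Ioo (-(n : ℝ)) n) = univ := by
    refine eq_univ_of_forall fun x => ?_
    obtain ⟨n, hn⟩ := exists_nat_gt |x|
    exact mem_iUnion.2 ⟨n, abs_lt.1 hn⟩
  have hmono : Monotone fun n : ℕ => Ioo (-(n : ℝ)) n := fun n m h => by
    have h' : (n : ℝ) ≤ m := by exact_mod_cast h
    exact Ioo_subset_Ioo (by linarith) h'
  rw [← setLIntegral_univ, ← hcov, setLIntegral_iUnion_of_directed _ hmono.directed_le]
  refine iSup_le fun n => ?_
  exact (lintegral_mono_set (hmono (le_max_right n₀ n))).trans (hlocal _ (le_max_left n₀ n))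

/-- The sets used to truncate a sequence of functions. -/
def truncSet (ρ : ℝ) (f : ℕ → ℝ → ℂ) (n : ℕ) : Set ℝ := {x | |x| ≤ n ∧ vecNorm ρ f x ≤ n}

lemma measurableSet_truncSet (hf : ∀ k, Measurable (f k)) (n : ℕ) :
    MeasurableSet (truncSet ρ f n) :=
  MeasurableSet.inter (s₁ := {x : ℝ | |x| ≤ n}) (s₂ := {x | vecNorm ρ f x ≤ n})
    (measurableSet_le (by fun_prop) measurable_const)
    (measurableSet_le (measurable_vecNorm hf) measurable_const)

lemma measurable_vecRestrict (hf : ∀ k, Measurable (f k)) {s : Set ℝ} (hs : MeasurableSet s)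
    (k : ℕ) : Measurable (vecRestrict f s k) :=
  (hf k).indicator hs

lemma lintegral_vecNorm_truncSet_ne_top (hρ : 0 < ρ) (n : ℕ) :
    ∫⁻ y, vecNorm ρ (vecRestrict f (truncSet ρ f n)) y ≠ ∞ := by
  rw [vecNorm_vecRestrict hρ]
  have h : ∀ y, (truncSet ρ f n).indicator (vecNorm ρ f) y ≤
      (Icc (-(n : ℝ)) n).indicator (fun _ => (n : ℝ≥0∞)) y := fun y => by
    by_cases hy : y ∈ truncSet ρ f n
    · rw [indicator_of_mem hy, indicator_of_mem (show y ∈ Icc (-(n : ℝ)) n from abs_le.1 hy.1)]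
      exact hy.2
    · rw [indicator_of_notMem hy]
      exact zero_le
  refine ((lintegral_mono h).trans_lt ?_).ne
  rw [lintegral_indicator measurableSet_Icc, setLIntegral_const, Real.volume_Icc]
  exact ENNReal.mul_lt_top (ENNReal.natCast_lt_top n) ENNReal.ofReal_lt_top

/-- Almost everywhere finiteness of the norm makes the truncations eventually equal to f at almost
every point; two applications of Fatou, for the variation and for the `ℓ^ρ` norm, finish. -/
lemma vecOp_le_liminf (hK : KernelBounds K δ C₀) (hq : 0 < q) (hρ : 0 < ρ)
    (hf : ∀ k, Admissible (f k)) (hfin : ∀ᵐ y, vecNorm ρ f y ≠ ∞) (x : ℝ) :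
    vecOp K q ρ f x ≤
      liminf (fun n => vecOp K q ρ (vecRestrict f (truncSet ρ f n)) x) atTop := by
  refine le_trans (lpn_mono hρ fun k => ?_) (lpn_liminf_le hρ _)
  refine variationOp_le_liminf hK (hf k) hq
    (fun n => (hf k).1.indicator (measurableSet_truncSet (fun k => (hf k).1) n))
    (fun n y => norm_indicator_le_norm_self _ _) ?_ x
  filter_upwards [hfin] with y hy
  refine tendsto_const_nhds.congr' ?_
  obtain ⟨n₁, h1⟩ := exists_nat_ge |y|
  obtain ⟨n₂, h2⟩ := ENNReal.exists_nat_gt hy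
  filter_upwards [eventually_ge_atTop (max n₁ n₂)] with n hn
  have h3 : (n₁ : ℝ) ≤ n := by exact_mod_cast (le_max_left _ _).trans hn
  have h4 : (n₂ : ℝ≥0∞) ≤ n := by exact_mod_cast (le_max_right _ _).trans hn
  exact (indicator_of_mem (show y ∈ truncSet ρ f n from ⟨h1.trans h3, h2.le.trans h4⟩) _).symm

/-- The weighted strong type bound. -/
lemma ApDensity.exists_lintegral_vecOp_rpow_le (hK : KernelBounds K δ C₀) (hq : 1 < q)
    (hρ : 1 < ρ) (hB : StrongBound K q ρ volume) (hp : 1 < p) (hv : ApDensity p v C) :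
    ∃ D : ℝ≥0, ∀ f : ℕ → ℝ → ℂ, (∀ k, Admissible (f k)) →
        ∫⁻ x, vecOp K q ρ f x ^ p ∂volume.withDensity v ≤
          D * ∫⁻ x, vecNorm ρ f x ^ p ∂volume.withDensity v := by
  have hp0 : 0 < p := by linarith
  have hρ0 : 0 < ρ := by linarith
  obtain ⟨D, hD⟩ := hv.exists_lintegral_vecOp_rpow_le_of_support hK hq hρ hB hp
  -- Adding 1 keeps the constant nonzero, so that the right-hand side is ∞ when the norm of f is
  -- infinite.
  refine ⟨D + 1, fun f hf => ?_⟩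
  set W := volume.withDensity v with hW
  have hfm := fun k => (hf k).1
  have hNm := measurable_vecNorm (ρ := ρ) hfm
  rcases eq_or_ne (∫⁻ x, vecNorm ρ f x ^ p ∂W) ∞ with htop | htop
  · rw [htop, ENNReal.mul_top (by simp)]
    exact le_top
  have hac : volume ≪ W := withDensity_absolutelyContinuous' hv.measurable.aemeasurable
    (Eventually.of_forall hv.ne_zero)
  have hfin : ∀ᵐ y, vecNorm ρ f y ≠ ∞ := by
    refine hac.ae_le ?_
    filter_upwards [ae_lt_top (hNm.pow_const p) htop] with x hx h
    rw [h, ENNReal.top_rpow_of_pos hp0] at hx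
    exact hx.ne rfl
  have hn : ∀ n, ∫⁻ x, vecOp K q ρ (vecRestrict f (truncSet ρ f n)) x ^ p ∂W ≤
      D * ∫⁻ x, vecNorm ρ f x ^ p ∂W := by
    intro n
    refine (hD _ (measurable_vecRestrict hfm (measurableSet_truncSet hfm n))
      (lintegral_vecNorm_truncSet_ne_top hρ0 n) n fun k x hx => ?_).trans ?_
    · exact indicator_of_notMem (fun h => hx.not_ge h.1) _
    · rw [vecNorm_vecRestrict hρ0]
      gcongr with x
      exact indicator_le_self _ _ x
  calc _ ≤ ∫⁻ x, liminf (fun n => vecOp K q ρ (vecRestrict f (truncSet ρ f n)) x ^ p) atTop ∂W := by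
        refine lintegral_mono fun x => ?_
        refine (ENNReal.rpow_le_rpow (vecOp_le_liminf hK (by linarith) hρ0 hf hfin x)
          hp0.le).trans_eq ?_
        exact (ENNReal.orderIsoRpow p hp0).liminf_apply
    _ ≤ liminf (fun n => ∫⁻ x, vecOp K q ρ (vecRestrict f (truncSet ρ f n)) x ^ p ∂W) atTop := by
        refine lintegral_liminf_le fun n => (measurable_vecOp hK (fun k => ?_) (by linarith)).pow_const p
        exact (hf k).indicator (measurableSet_truncSet hfm n)
    _ ≤ D * ∫⁻ x, vecNorm ρ f x ^ p ∂W := by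
        refine (liminf_le_liminf (Eventually.of_forall hn)).trans_eq ?_
        exact liminf_const _
    _ ≤ _ := by
        gcongr
        simp

/-- The weighted weak type bound. -/
lemma exists_weak_type_admissible {W : Measure ℝ} {A : ℝ≥0} (hK : KernelBounds K δ C₀) (hq : 1 < q)
    (hρ : 1 < ρ) (hWac : W ≪ volume) (hacW : volume ≪ W) (hW : A1Measure W A)
    (hB : StrongBound K q ρ W) :
    ∃ D : ℝ≥0, ∀ f : ℕ → ℝ → ℂ, (∀ k, Admissible (f k)) → ∀ l : ℝ≥0∞, l ≠ 0 → l ≠ ∞ →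
        l * W {x | l < vecOp K q ρ f x} ≤ D * ∫⁻ y, vecNorm ρ f y ∂W := by
  have hρ0 : 0 < ρ := by linarith
  obtain ⟨D, hD⟩ := exists_weak_type hK hq hρ hWac hW hB
  refine ⟨D + 1, fun f hf l hl0 hlt => ?_⟩
  have hfm := fun k => (hf k).1
  have hNm := measurable_vecNorm (ρ := ρ) hfm
  rcases eq_or_ne (∫⁻ x, vecNorm ρ f x ∂W) ∞ with htop | htop
  · rw [htop, ENNReal.mul_top (by simp)]
    exact le_top
  have hfin : ∀ᵐ y, vecNorm ρ f y ≠ ∞ := by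
    refine hacW.ae_le ?_
    filter_upwards [ae_lt_top hNm htop] with x hx h
    exact hx.ne h
  set T : ℕ → ℝ → ℝ≥0∞ := fun n => vecOp K q ρ (vecRestrict f (truncSet ρ f n)) with hT
  have hn : ∀ n, l * W {x | l < T n x} ≤ D * ∫⁻ x, vecNorm ρ f x ∂W := by
    intro n
    refine (hD _ (measurable_vecRestrict hfm (measurableSet_truncSet hfm n))
      (lintegral_vecNorm_truncSet_ne_top hρ0 n) l hl0 hlt).trans ?_
    rw [vecNorm_vecRestrict hρ0]
    gcongr with x
    exact indicator_le_self _ _ x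
  -- The strict inequality passes to all late truncations, so the level set is covered by an
  -- increasing union of sets to which the truncated bound applies.
  have hsub : {x | l < vecOp K q ρ f x} ⊆ ⋃ N : ℕ, ⋂ n, ⋂ (_ : N ≤ n), {x | l < T n x} := by
    intro x hx
    have h := eventually_lt_of_lt_liminf (lt_of_lt_of_le hx
      (vecOp_le_liminf hK (by linarith) hρ0 hf hfin x))
    obtain ⟨N, hN⟩ := eventually_atTop.1 h
    exact mem_iUnion.2 ⟨N, mem_iInter₂.2 hN⟩
  have hmono : Monotone fun N : ℕ => ⋂ n, ⋂ (_ : N ≤ n), {x | l < T n x} := fun N M h x hx =>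
    mem_iInter₂.2 fun n hn => mem_iInter₂.1 hx n (h.trans hn)
  calc _ ≤ l * ⨆ N : ℕ, W (⋂ n, ⋂ (_ : N ≤ n), {x | l < T n x}) := by
        rw [← hmono.measure_iUnion]
        gcongr
    _ ≤ D * ∫⁻ x, vecNorm ρ f x ∂W := by
        rw [ENNReal.mul_iSup]
        refine iSup_le fun N => le_trans ?_ (hn N)
        gcongr
        exact iInter₂_subset N le_rfl
    _ ≤ _ := by
        gcongr
        simp

end StrongType

end VqCZ

end

/-! ### `A_1` weights. -/

noncomputable section

namespace VqCZ

open Filter Topology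

section AOne

variable {w : ℝ → ℝ} {v : ℝ → ℝ≥0∞} {A : ℝ≥0}

lemma IsA1Weight.exists_le (hw : IsA1Weight w) : ∃ (v : ℝ → ℝ≥0∞) (A : ℝ≥0), 1 ≤ A ∧
    Measurable v ∧ (∀ x, v x ≠ 0) ∧ (∀ x, v x ≠ ∞) ∧ (∀ a b : ℝ, ∫⁻ x in Icc a b, v x ≠ ∞) ∧
    weightMeasure w = volume.withDensity v ∧
    ∀ᵐ x, ∀ a b : ℝ, a < b → x ∈ Icc a b →
      ∫⁻ y in Icc a b, v y ≤ A * ENNReal.ofReal (b - a) * v x := by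
  obtain ⟨v, hv, h0, ht, hae, hfin⟩ := exists_density hw.1
  obtain ⟨A, hA⟩ := hw.2
  refine ⟨v, max A 1, le_max_right _ _, hv, h0, ht, hfin, withDensity_congr_ae hae, ?_⟩
  filter_upwards [hA, hae] with x h1 h2 a b hab hx
  have hl0 : ENNReal.ofReal (b - a) ≠ 0 := by simpa using hab
  have h3 : (∫⁻ y in Icc a b, ‖w y‖ₑ) / ENNReal.ofReal (b - a) ≤ maximalFunction w x :=
    le_iSup_of_le a (le_iSup_of_le b (le_iSup_of_le hab (le_iSup_of_le hx le_rfl)))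
  have h4 := (ENNReal.div_le_iff hl0 ENNReal.ofReal_ne_top).1 (h3.trans h1)
  have h5 : ∫⁻ y in Icc a b, v y ≤ ∫⁻ y in Icc a b, ‖w y‖ₑ := by
    rw [← lintegral_congr_ae (ae_restrict_of_ae hae)]
    exact lintegral_mono fun y => Real.ofReal_le_enorm _
  calc _ ≤ A * ENNReal.ofReal (w x) * ENNReal.ofReal (b - a) := h5.trans h4
    _ = A * ENNReal.ofReal (b - a) * v x := by
        rw [h2]
        ring
    _ ≤ _ := by
        gcongr
        exact le_max_left _ _

lemma a1Measure_withDensity (hv : Measurable v) (h : ∀ᵐ x, ∀ a b : ℝ, a < b → x ∈ Icc a b →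
      ∫⁻ y in Icc a b, v y ≤ A * ENNReal.ofReal (b - a) * v x) :
    A1Measure (volume.withDensity v) A := by
  intro a b c d hsub F hF
  rw [setLIntegral_withDensity_eq_setLIntegral_mul _ hv hF measurableSet_Ioo,
    withDensity_apply _ measurableSet_Ioo, ← lintegral_const_mul _ hF,
    ← lintegral_const_mul _ (hv.mul hF)]
  refine lintegral_mono_ae ((ae_restrict_iff' measurableSet_Ioo).2 ?_)
  filter_upwards [h] with x hx hxI
  have hxJ := hsub hxI
  have h1 := hx a b (hxJ.1.trans hxJ.2) (Ioo_subset_Icc_self hxJ)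
  rw [Pi.mul_apply, ← mul_assoc]
  exact mul_le_mul' ((lintegral_mono_set Ioo_subset_Icc_self).trans h1) le_rfl

/-- The class `A_1` is contained in `A_p`. -/
lemma apDensity_of_a1 {p : ℝ} (hp : 1 < p) (hA : 1 ≤ A) (hv : Measurable v) (h0 : ∀ x, v x ≠ 0)
    (ht : ∀ x, v x ≠ ∞) (hfin : ∀ a b : ℝ, ∫⁻ x in Icc a b, v x ≠ ∞)
    (h : ∀ᵐ x, ∀ a b : ℝ, a < b → x ∈ Icc a b →
      ∫⁻ y in Icc a b, v y ≤ A * ENNReal.ofReal (b - a) * v x) : ApDensity p v A := by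
  have hp1 : 0 < p - 1 := sub_pos.2 hp
  have hs : 0 ≤ 1 / (p - 1) := by positivity
  refine ⟨hv, h0, ht, hfin, fun a b hab => ?_⟩
  set V := ∫⁻ x in Icc a b, v x with hV
  set ℓ := ENNReal.ofReal (b - a) with hℓ
  have hl0 : ℓ ≠ 0 := by simpa [hℓ] using hab
  have hlt : ℓ ≠ ∞ := ENNReal.ofReal_ne_top
  have hA0 : (A : ℝ≥0∞) ≠ 0 := by
    have : A ≠ 0 := (zero_lt_one.trans_le hA).ne'
    exact_mod_cast this
  have hV0 : V ≠ 0 := by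
    intro hV0
    rw [hV, lintegral_eq_zero_iff hv] at hV0
    have h2 : ∀ᵐ x ∂volume.restrict (Icc a b), False := by
      filter_upwards [hV0] with x hx
      exact h0 x hx
    rw [ae_iff] at h2
    simp at h2
    exact absurd hab (not_lt.2 h2)
  have hVt : V ≠ ∞ := hfin a b
  -- The `A_1` condition bounds 1/v by `B` almost everywhere on the interval, which gives the dual
  -- integral pointwise.
  set B := A * ℓ / V with hB
  have hpt : ∀ᵐ x, x ∈ Icc a b → v x ^ (-(1 / (p - 1))) ≤ B ^ (1 / (p - 1)) := by
    filter_upwards [h] with x hx hxI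
    rw [ENNReal.rpow_neg, ← ENNReal.inv_rpow]
    refine ENNReal.rpow_le_rpow ?_ hs
    rw [hB, ENNReal.le_div_iff_mul_le (Or.inl hV0) (Or.inl hVt)]
    calc (v x)⁻¹ * V ≤ (v x)⁻¹ * (A * ℓ * v x) := mul_le_mul' le_rfl (hx a b hab hxI)
      _ = A * ℓ * (v x * (v x)⁻¹) := by ring
      _ = A * ℓ := by rw [ENNReal.mul_inv_cancel (h0 x) (ht x), mul_one]
  have hint : ∫⁻ x in Icc a b, v x ^ (-(1 / (p - 1))) ≤ B ^ (1 / (p - 1)) * ℓ := by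
    calc _ ≤ ∫⁻ _ in Icc a b, B ^ (1 / (p - 1)) :=
          lintegral_mono_ae ((ae_restrict_iff' measurableSet_Icc).2 hpt)
      _ = _ := by rw [setLIntegral_const, Real.volume_Icc]
  calc _ ≤ V * (B ^ (1 / (p - 1)) * ℓ) ^ (p - 1) := by gcongr
    _ = V * B * ℓ ^ (p - 1) := by
        rw [ENNReal.mul_rpow_of_nonneg _ _ hp1.le, ← ENNReal.rpow_mul,
          one_div_mul_cancel hp1.ne', ENNReal.rpow_one, mul_assoc]
    _ = A * (ℓ * ℓ ^ (p - 1)) := by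
        rw [hB, ENNReal.mul_div_cancel hV0 hVt, mul_assoc]
    _ = A * ℓ ^ p := by
        congr 1
        conv_lhs => rw [← ENNReal.rpow_one ℓ, ← ENNReal.rpow_mul,
          ← ENNReal.rpow_add _ _ hl0 hlt]
        ring_nf
    _ ≤ _ := le_rfl

/-- An `A_1` density is bounded below by a multiple of 1/(1+|y|): apply the condition on an interval
of length 2(1+|y|) about 0, which contains both y and [-1,1]. -/
lemma admissible_of_a1 (h0 : ∀ x, v x ≠ 0) (hv : Measurable v)
    (h : ∀ᵐ x, ∀ a b : ℝ, a < b → x ∈ Icc a b →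
      ∫⁻ y in Icc a b, v y ≤ A * ENNReal.ofReal (b - a) * v x)
    (hfin : ∀ a b : ℝ, ∫⁻ x in Icc a b, v x ≠ ∞) {f : ℝ → ℂ} (hf : Measurable f)
    (hfi : ∫⁻ x, ‖f x‖ₑ ∂volume.withDensity v ≠ ∞) : Admissible f := by
  refine ⟨hf, ?_⟩
  set V := ∫⁻ x in Icc (-1 : ℝ) 1, v x with hV
  have hV0 : V ≠ 0 := by
    intro hV0
    rw [hV, lintegral_eq_zero_iff hv] at hV0
    have h2 : ∀ᵐ x ∂volume.restrict (Icc (-1 : ℝ) 1), False := by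
      filter_upwards [hV0] with x hx
      exact h0 x hx
    rw [ae_iff] at h2
    norm_num at h2
  have hVt : V ≠ ∞ := hfin _ _
  rw [lintegral_withDensity_eq_lintegral_mul _ hv hf.enorm] at hfi
  have hle : ∀ᵐ y, V * (‖f y‖ₑ * ENNReal.ofReal ((1 + |y|)⁻¹)) ≤ A * 2 * (v * fun x => ‖f x‖ₑ) y := by
    filter_upwards [h] with y hy
    have hp : 0 < 1 + |y| := by positivity
    have hy1 := abs_le.1 (le_refl |y|)
    have h1 := hy (-(1 + |y|)) (1 + |y|) (by linarith) ⟨by linarith, by linarith⟩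
    have h2 : V ≤ A * ENNReal.ofReal (1 + |y| - -(1 + |y|)) * v y := by
      refine (lintegral_mono_set (Icc_subset_Icc ?_ ?_)).trans h1 <;> linarith [abs_nonneg y]
    have e : ENNReal.ofReal (1 + |y| - -(1 + |y|)) * ENNReal.ofReal ((1 + |y|)⁻¹) = 2 := by
      rw [← ENNReal.ofReal_mul (by linarith), ← ENNReal.ofReal_ofNat]
      congr 1
      field_simp
      ring
    calc _ ≤ A * ENNReal.ofReal (1 + |y| - -(1 + |y|)) * v y *
          (‖f y‖ₑ * ENNReal.ofReal ((1 + |y|)⁻¹)) := mul_le_mul' h2 le_rfl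
      _ = A * (ENNReal.ofReal (1 + |y| - -(1 + |y|)) * ENNReal.ofReal ((1 + |y|)⁻¹)) *
          (v y * ‖f y‖ₑ) := by ring
      _ = _ := by rw [e, Pi.mul_apply]
  have h3 : V * ∫⁻ y, ‖f y‖ₑ * ENNReal.ofReal ((1 + |y|)⁻¹) ≠ ∞ := by
    rw [← lintegral_const_mul' _ _ hVt]
    refine ne_top_of_le_ne_top ?_ (lintegral_mono_ae hle)
    rw [lintegral_const_mul' _ _ (by finiteness)]
    exact ENNReal.mul_ne_top (by finiteness) hfi
  exact fun htop => h3 (by rw [htop, ENNReal.mul_top hV0])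

end AOne

/-! ### From vector-valued back to scalar bounds. -/

section Scalar

variable {K : ℝ → ℝ → ℂ} {δ C₀ q ρ p : ℝ} {v : ℝ → ℝ≥0∞} {C : ℝ≥0}

lemma lpn_single (hρ : 0 < ρ) (a : ℝ≥0∞) : lpn ρ (fun k : ℕ => if k = 0 then a else 0) = a := by
  have h : ∀ k : ℕ, (if k = 0 then a else 0) ^ ρ = if k = 0 then a ^ ρ else 0 := fun k => by
    split_ifs
    · rfl
    · exact ENNReal.zero_rpow_of_pos hρ
  rw [lpn]
  simp only [h]
  rw [tsum_ite_eq, ← ENNReal.rpow_mul, mul_one_div_cancel hρ.ne', ENNReal.rpow_one]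

/-- A strong bound for one exponent extrapolates to weighted strong bounds for all exponents. -/
lemma ApDensity.strongBound (hK : KernelBounds K δ C₀) (hq : 1 < q) (hρ : 1 < ρ)
    (hB : StrongBound K q ρ volume) (hp : 1 < p) (hv : ApDensity p v C) :
    StrongBound K q p (volume.withDensity v) := by
  obtain ⟨D, hD⟩ := hv.exists_lintegral_vecOp_rpow_le hK hq hρ hB hp
  have hρ0 : 0 < ρ := by linarith
  refine ⟨D, fun f hf => ?_⟩
  set g : ℕ → ℝ → ℂ := fun k => if k = 0 then f else fun _ => 0 with hg
  have g0 : g 0 = f := if_pos rfl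
  have gk : ∀ k, k ≠ 0 → g k = fun _ => 0 := fun k hk => if_neg hk
  have hadm : ∀ k, Admissible (g k) := by
    intro k
    by_cases hk : k = 0
    · rw [hk, g0]
      exact hf
    · rw [gk k hk]
      exact Admissible.of_lintegral measurable_const (by simp)
  have h := hD g hadm
  have e1 : ∀ x, vecOp K q ρ g x = variationOp K q f x := by
    intro x
    rw [← lpn_single hρ0 (variationOp K q f x)]
    refine congrArg (lpn ρ) (funext fun k => ?_)
    by_cases hk : k = 0
    · rw [hk, g0, if_pos rfl]
    · rw [gk k hk, if_neg hk]
      exact variationOp_zero (by linarith) x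
  have e2 : ∀ x, vecNorm ρ g x = ‖f x‖ₑ := by
    intro x
    rw [← lpn_single hρ0 ‖f x‖ₑ]
    refine congrArg (lpn ρ) (funext fun k => ?_)
    by_cases hk : k = 0
    · rw [hk, g0, if_pos rfl]
    · rw [gk k hk, if_neg hk, enorm_zero]
  simpa only [e1, e2] using h

lemma apDensity_one (hp : 1 < p) : ApDensity p 1 1 := by
  have hp0 : 0 < p - 1 := sub_pos.2 hp
  refine ⟨measurable_one, fun x => one_ne_zero, fun x => ENNReal.one_ne_top, fun a b => ?_,
    fun a b hab => ?_⟩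
  · simp
  · have h0 : ENNReal.ofReal (b - a) ≠ 0 := by simpa using hab
    simp only [Pi.one_apply, ENNReal.one_rpow, setLIntegral_const, Real.volume_Icc, one_mul,
      ENNReal.coe_one]
    refine le_of_eq ?_
    conv_lhs => rw [← ENNReal.rpow_one (ENNReal.ofReal (b - a)), ← ENNReal.rpow_mul,
      ← ENNReal.rpow_add _ _ h0 ENNReal.ofReal_ne_top]
    ring_nf

/-- Extends the hypothesis to all admissible functions: outside L^p the right-hand side is infinite,
provided the constant is not 0. -/
lemma strongBound_of_memLp (hp : 0 < p) (hbdd : ∃ C : ℝ≥0, ∀ f : ℝ → ℂ,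
    MemLp f (ENNReal.ofReal p) volume →
      ∫⁻ x, variationOp K q f x ^ p ≤ C * ∫⁻ x, ‖f x‖ₑ ^ p) : StrongBound K q p volume := by
  obtain ⟨C, hC⟩ := hbdd
  refine ⟨C + 1, fun f hf => ?_⟩
  rcases eq_or_ne (∫⁻ x, ‖f x‖ₑ ^ p) ∞ with h | h
  · rw [h, ENNReal.mul_top (by simp)]
    exact le_top
  · refine (hC f ⟨hf.1.aestronglyMeasurable, ?_⟩).trans ?_
    · rw [eLpNorm_lt_top_iff_lintegral_rpow_enorm_lt_top (by simpa using hp) ENNReal.ofReal_ne_top,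
        ENNReal.toReal_ofReal hp.le]
      exact lt_top_iff_ne_top.2 h
    · gcongr
      simp

lemma integrableOn_kernel_mul_congr {f g : ℝ → ℂ} (hK : KernelBounds K δ C₀) (hg : Admissible g)
    (h : f =ᵐ[volume] g) (x : ℝ) {t : ℝ} (ht : 0 < t) :
    IntegrableOn (fun y => K x y * f y) {y : ℝ | t < |x - y|} volume := by
  refine (integrableOn_kernel_mul hK hg x ht).congr (ae_restrict_of_ae ?_)
  filter_upwards [h] with y hy
  rw [hy]

lemma vecNorm_congr_ae {f g : ℕ → ℝ → ℂ} {W : Measure ℝ} (h : ∀ k, f k =ᵐ[W] g k) :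
    vecNorm ρ f =ᵐ[W] vecNorm ρ g := by
  filter_upwards [ae_all_iff.2 h] with x hx
  simp only [vecNorm, hx]

end Scalar

end VqCZ

end

/-! ### Assembly. -/

theorem mainTheorem6 (K : ℝ → ℝ → ℂ) (hK : VqCZ.IsRegularKernel K)
    (q ρ : ℝ) (hq : 2 < q) (hρ : 1 < ρ)
    (p₀ : ℝ) (hp₀ : 1 < p₀)
    (hbdd : ∃ C : ℝ≥0, ∀ f : ℝ → ℂ, MemLp f (ENNReal.ofReal p₀) volume →
      ∫⁻ x, VqCZ.variationOp K q f x ^ p₀ ≤ C * ∫⁻ x, ‖f x‖ₑ ^ p₀) :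
    (∀ w : ℝ → ℝ, VqCZ.IsA1Weight w →
      ∃ C : ℝ≥0, ∀ f : ℕ → ℝ → ℂ, (∀ k, MemLp (f k) 1 (VqCZ.weightMeasure w)) →
        (∀ k x t, 0 < t → IntegrableOn (fun y => K x y * f k y) {y : ℝ | t < |x - y|} volume) ∧
        ∀ l : ℝ, 0 < l →
          VqCZ.weightMeasure w
              {x | ENNReal.ofReal l < (∑' k, VqCZ.variationOp K q (f k) x ^ ρ) ^ (1 / ρ)} ≤
            C / ENNReal.ofReal l *
              ∫⁻ x, (∑' k, ‖f k x‖ₑ ^ ρ) ^ (1 / ρ) ∂(VqCZ.weightMeasure w)) ∧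
    (∀ p : ℝ, 1 < p → ∀ w : ℝ → ℝ, VqCZ.IsApWeight p w →
      ∃ C : ℝ≥0, ∀ f : ℕ → ℝ → ℂ,
        (∀ k, MemLp (f k) (ENNReal.ofReal p) (VqCZ.weightMeasure w)) →
        (∀ k x t, 0 < t → IntegrableOn (fun y => K x y * f k y) {y : ℝ | t < |x - y|} volume) ∧
        ∫⁻ x, (∑' k, VqCZ.variationOp K q (f k) x ^ ρ) ^ (p / ρ) ∂(VqCZ.weightMeasure w) ≤
          C * ∫⁻ x, (∑' k, ‖f k x‖ₑ ^ ρ) ^ (p / ρ) ∂(VqCZ.weightMeasure w)) := by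
  obtain ⟨δ, hδ, C₀, hC₀, h1, h2, h3⟩ := hK
  have hKB : VqCZ.KernelBounds K δ C₀ := ⟨hδ, hC₀, h1, h2, h3⟩
  have hq1 : 1 < q := by linarith
  have hρ0 : 0 < ρ := by linarith
  -- First run: vector exponent `p₀`, target exponent ρ, weight 1. Afterwards `p₀` plays no further
  -- role.
  have hBρ : VqCZ.StrongBound K q ρ volume := by
    have h := (VqCZ.apDensity_one hρ).strongBound hKB hq1 hp₀
      (VqCZ.strongBound_of_memLp (by linarith) hbdd) hρ
    rwa [withDensity_one] at h
  refine ⟨fun w hw => ?_, fun p hp w hw => ?_⟩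
  · obtain ⟨v, A, hA, hv, h0, ht, hfin, hwv, hle⟩ := hw.exists_le
    have hBW := (VqCZ.apDensity_of_a1 hρ hA hv h0 ht hfin hle).strongBound hKB hq1 hρ hBρ hρ
    have hac : volume ≪ volume.withDensity v :=
      withDensity_absolutelyContinuous' hv.aemeasurable (Filter.Eventually.of_forall h0)
    obtain ⟨D, hD⟩ := VqCZ.exists_weak_type_admissible hKB hq1 hρ
      (withDensity_absolutelyContinuous _ _) hac (VqCZ.a1Measure_withDensity hv hle) hBW
    rw [hwv]
    refine ⟨D, fun f hf => ?_⟩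
    -- Measurable representatives for the weighted measure. Positivity of the density makes them
    -- Lebesgue almost everywhere equal to f, so the truncated integrals agree at every point.
    choose g hg hfg using fun k => (hf k).1
    have hfg' : ∀ k, f k =ᵐ[volume] g k := fun k => hac.ae_le (hfg k)
    have hadm : ∀ k, VqCZ.Admissible (g k) := fun k => by
      refine VqCZ.admissible_of_a1 h0 hv hle hfin (hg k).measurable ?_
      rw [← eLpNorm_one_eq_lintegral_enorm]
      exact ((memLp_congr_ae (hfg k)).1 (hf k)).2.ne
    refine ⟨fun k x t hx => VqCZ.integrableOn_kernel_mul_congr hKB (hadm k) (hfg' k) x hx,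
      fun l hl => ?_⟩
    have hl0 : ENNReal.ofReal l ≠ 0 := by simpa using hl
    have h := hD g hadm (ENNReal.ofReal l) hl0 ENNReal.ofReal_ne_top
    rw [← lintegral_congr_ae (VqCZ.vecNorm_congr_ae hfg)] at h
    simp_rw [← VqCZ.vecOp_congr_ae hfg'] at h
    rw [mul_comm, ← ENNReal.le_div_iff_mul_le (Or.inl hl0) (Or.inl ENNReal.ofReal_ne_top)] at h
    refine h.trans_eq ?_
    rw [div_eq_mul_inv, div_eq_mul_inv, mul_right_comm]
    rfl
  · obtain ⟨v, C, hv, hwv⟩ := hw.exists_apDensity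
    have hp0 : 0 < p := by linarith
    have hac : volume ≪ volume.withDensity v :=
      withDensity_absolutelyContinuous' hv.measurable.aemeasurable
        (Filter.Eventually.of_forall hv.ne_zero)
    obtain ⟨D, hD⟩ := hv.exists_lintegral_vecOp_rpow_le hKB hq1 hρ hBρ hp
    rw [hwv]
    refine ⟨D, fun f hf => ?_⟩
    choose g hg hfg using fun k => (hf k).1
    have hfg' : ∀ k, f k =ᵐ[volume] g k := fun k => hac.ae_le (hfg k)
    have hadm : ∀ k, VqCZ.Admissible (g k) := fun k => by
      refine hv.admissible hp (hg k).measurable ?_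
      have h := ((memLp_congr_ae (hfg k)).1 (hf k)).2
      rw [eLpNorm_lt_top_iff_lintegral_rpow_enorm_lt_top (by simpa using hp0)
        ENNReal.ofReal_ne_top, ENNReal.toReal_ofReal hp0.le] at h
      exact h.ne
    refine ⟨fun k x t hx => VqCZ.integrableOn_kernel_mul_congr hKB (hadm k) (hfg' k) x hx, ?_⟩
    have h := hD g hadm
    have e : ∫⁻ x, VqCZ.vecNorm ρ g x ^ p ∂volume.withDensity v =
        ∫⁻ x, VqCZ.vecNorm ρ f x ^ p ∂volume.withDensity v := by
      refine lintegral_congr_ae ?_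
      filter_upwards [VqCZ.vecNorm_congr_ae (ρ := ρ) hfg] with x hx
      rw [hx]
    rw [e] at h
    simp_rw [← VqCZ.vecOp_congr_ae hfg'] at h
    simpa only [VqCZ.vecOp, VqCZ.vecNorm, VqCZ.lpn, ← ENNReal.rpow_mul, one_div_mul_eq_div] using h
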